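/- Let $\nu\in\{-\tfrac12,-\tfrac13,-\tfrac14,-\tfrac16\}$. Powers and logarithms are principal ($\arg\in(-\pi,\pi]$). For $x\in\mathbb C\smallsetminus(-\infty,-1]$ let $$P_\nu(x)=-\frac{\sin(\nu\pi)}{\pi}\int_0^1\left[\frac{X\left(1-\frac{1-x}{2}X\right)}{1-X}\right]^{\nu}\frac{dX}{1-X}$$ be the Legendre function, and for real $x<-1$ put $P_\nu(x)=\lim_{\varepsilon\to0^+}P_\nu(x+i\varepsilon)$ (which is also the value of the integral with principal powers). The Legendre–Ramanujan function is $$R_\nu(\xi)=\frac{1-\xi^2}{P_\nu(\xi)}\frac{dP_\nu(\xi)}{d\xi}+\frac{1-\xi^2}{P_\nu(-\xi)}\frac{dP_\nu(-\xi)}{d\xi}-\frac{\sin(\nu\pi)}{\pi}\left\{\frac{1}{[P_\nu(\xi)]^2\,\mathrm{Im}\frac{iP_\nu(-\xi)}{P_\nu(\xi)}}-\frac{1}{[P_\nu(-\xi)]^2\,\mathrm{Im}\frac{iP_\nu(\xi)}{P_\nu(-\xi)}}\right\}$$ for $\xi\in(\mathbb C\smallsetminus\mathbb R)\cup(-1,1)$,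 extended by $R_\nu(\pm1)=0$, and by $R_\nu(\xi)=-R_\nu(-\xi)=\lim_{\varepsilon\to0^+}R_\nu(\xi+ i\varepsilon)$ for real $\xi>1$. Let $t\in\mathbb C$ satisfy $0<|4t(1-t)|\le1$, $\mathrm{Re}\,t\le\frac12$ and $t\ne\frac12$. For $a,b\in\mathbb C$ and a sequence $(c_k)_{k\ge0}$ of complex numbers put $$\Sigma_\nu(a,b;c_k;X_\nu(t))=\sum_{k=0}^\infty B_\nu(k)\,(ak+b)\,c_k\,X_\nu(t)^k,$$ where $$\begin{array}{c|c|c}\nu&B_\nu(k)&X_\nu(t)\\\hline -\frac12&\binom{2k}{k}^3&t(1-t)/2^4\\ -\frac13&\binom{2k}{k}^2\binom{3k}{k}&t(1-t)/3^3\\ -\frac14&\binom{2k}{k}^2\binom{4k}{2k}&t(1-t)/2^6\\ -\frac16&\binom{2k}{k}\binom{3k}{k}\binom{6k}{3k}&t(1-t)/(2^43^3)\end{array}$$ If $c_k=O(\log k)$, this series converges absolutely whenever $|4t(1-t)|<1$ or $a=0$. With $H_m^{(r)}=\sum_{j=1}^m j^{-r}$ and $H_m=H_m^{(1)}$, let $$c_{\nu,k}=\begin{cases}6(H_{2k}-H_k)&\nu=-\frac12\\3H_{3k}+2H_{2k}-5H_k&\nu=-\frac13\\4(H_{4k}-H_k)&\nu=-\frac14\\3(2H_{6k}-H_{3k}-H_k)&\nu=-\frac16\end{cases}\qquad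 d_{\nu,k}=\begin{cases}6[-2H^{(2)}_{2k}+H^{(2)}_k]&\nu=-\frac12\\-9H^{(2)}_{3k}-4H^{(2)}_{2k}+5H^{(2)}_k&\nu=-\frac13\\4[-4H^{(2)}_{4k}+H^{(2)}_k]&\nu=-\frac14\\3[-12H^{(2)}_{6k}+3H^{(2)}_{3k}+H^{(2)}_k]&\nu=-\frac16.\end{cases}$$ Then $P_\nu(1-2t)\ne0$ and $P_\nu(2t-1)\ne0$, and $\rho:=\dfrac{iP_\nu(2t-1)}{P_\nu(1-2t)}$ has $\mathrm{Im}\,\rho\ne0$; if $t<0$ is real, the limits of $R_\nu(1-2t\pm i\varepsilon)$ as $\varepsilon\to0^+$ exist and both equal $R_\nu(1-2t)$. Moreover, all the series below converge (as limits of partial sums), and $$\Sigma_\nu(2(2t-1),-R_\nu(1-2t);1;X_\nu(t))=\frac{2\sin(\nu\pi)}{\pi\,\mathrm{Im}\,\rho},$$ $$\Sigma_\nu(2(2t-1),-R_\nu(1-2t);c_{\nu,k};X_\nu(t))+\Sigma_\nu(0,2(2t-1);1;X_\nu(t))=-\frac{2\sin(\nu\pi)\log X_\nu(t)}{\pi\,\mathrm{Im}\,\rho}-2i\,\frac{\mathrm{Re}\,\rho}{\mathrm{Im}\,\rho},$$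 $$\Sigma_\nu(2(2t-1),-R_\nu(1-2t);c_{\nu,k}^2+d_{\nu,k};X_\nu(t))+\Sigma_\nu(0,4(2t-1);c_{\nu,k};X_\nu(t))=-\frac{2\pi|\rho|^2}{\sin(\nu\pi)\,\mathrm{Im}\,\rho}+4i\,\frac{\mathrm{Re}\,\rho}{\mathrm{Im}\,\rho}\log X_\nu(t)+\frac{2\sin(\nu\pi)}{\pi\,\mathrm{Im}\,\rho}\log^2X_\nu(t).$$ -/

import Mathlib

open Filter Topology Asymptotics

namespace RamanujanSun

/-- The four admissible degrees `-1/2`, `-1/3`, `-1/4`, `-1/6`. -/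
inductive Degree
  | half
  | third
  | quarter
  | sixth

/-- The value of the degree as a real number. -/
noncomputable def Degree.nu : Degree → ℝ
  | .half => -1 / 2
  | .third => -1 / 3
  | .quarter => -1 / 4
  | .sixth => -1 / 6

/-- The Legendre function `P_ν`, `-1 < ν < 0`:
`P_ν(1 - 2s) = -(sin νπ / π) ∫₀¹ (X (1 - s X) / (1 - X))^ν dX / (1 - X)`, written at `x = 1 - 2s`,
with principal powers (`arg ∈ (-π, π]`). It is holomorphic off the cut `(-∞, -1]`; for real
`x < -1` the principal power gives the boundary value `P_ν(x + i0⁺)`. -/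
noncomputable def legendreP (ν : ℝ) (x : ℂ) : ℂ :=
  -((Real.sin (ν * Real.pi) / Real.pi : ℝ) : ℂ) *
    ∫ X in (0 : ℝ)..1,
      ((X : ℂ) * (1 - (1 - x) / 2 * (X : ℂ)) / (1 - (X : ℂ))) ^ (ν : ℂ) * (1 / (1 - (X : ℂ)))

/-- The analytic expression of the Legendre–Ramanujan function, meaningful for
`ξ ∈ (ℂ ∖ ℝ) ∪ (-1, 1)`. -/
noncomputable def legendreRamanujanFormula (ν : ℝ) (ξ : ℂ) : ℂ :=
  (1 - ξ ^ 2) / legendreP ν ξ * deriv (legendreP ν) ξ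
    + (1 - ξ ^ 2) / legendreP ν (-ξ) * deriv (fun z : ℂ => legendreP ν (-z)) ξ
    - ((Real.sin (ν * Real.pi) / Real.pi : ℝ) : ℂ) *
      (1 / (legendreP ν ξ ^ 2
            * ((Complex.I * legendreP ν (-ξ) / legendreP ν ξ).im : ℂ))
        - 1 / (legendreP ν (-ξ) ^ 2
            * ((Complex.I * legendreP ν ξ / legendreP ν (-ξ)).im : ℂ)))

/-- The Legendre–Ramanujan function `R_ν`: the analytic expression on `(ℂ ∖ ℝ) ∪ (-1, 1)`, then
`R_ν(±1) = 0`, `R_ν(ξ) = R_ν(ξ + i0⁺)` for real `ξ > 1`, and `R_ν(ξ) = -R_ν(-ξ)` for real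
`ξ < -1`. -/
noncomputable def legendreRamanujan (ν : ℝ) (ξ : ℂ) : ℂ :=
  if ξ.im ≠ 0 ∨ |ξ.re| < 1 then legendreRamanujanFormula ν ξ
  else if |ξ.re| = 1 then 0
  else if 1 < ξ.re then
    limUnder (𝓝[>] (0 : ℝ)) fun ε => legendreRamanujanFormula ν (ξ + ε * Complex.I)
  else
    -limUnder (𝓝[>] (0 : ℝ)) fun ε => legendreRamanujanFormula ν (-ξ + ε * Complex.I)

/-- The harmonic number `H_m^{(r)} = ∑_{j=1}^m 1 / j^r`. -/
noncomputable def harmonicNumber (r m : ℕ) : ℂ :=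
  ∑ j ∈ Finset.Icc 1 m, 1 / (j : ℂ) ^ r

/-- The cubic binomial weights. -/
def binomialWeight : Degree → ℕ → ℕ
  | .half, k => (2 * k).choose k ^ 3
  | .third, k => (2 * k).choose k ^ 2 * (3 * k).choose k
  | .quarter, k => (2 * k).choose k ^ 2 * (4 * k).choose (2 * k)
  | .sixth, k => (2 * k).choose k * (3 * k).choose k * (6 * k).choose (3 * k)

/-- The variable `X_ν(t)` of the power series. -/
noncomputable def seriesVar : Degree → ℂ → ℂ
  | .half, t => t * (1 - t) / 2 ^ 4
  | .third, t => t * (1 - t) / 3 ^ 3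
  | .quarter, t => t * (1 - t) / 2 ^ 6
  | .sixth, t => t * (1 - t) / (2 ^ 4 * 3 ^ 3)

/-- The `k`-th summand of `Σ_ν(a, b; c_k; X_ν(t))`. -/
noncomputable def sigmaTerm (D : Degree) (a b : ℂ) (c : ℕ → ℂ) (t : ℂ) (k : ℕ) : ℂ :=
  (binomialWeight D k : ℂ) * (a * k + b) * c k * seriesVar D t ^ k

/-- The (possibly only conditionally convergent) series `Σ_ν(a, b; c_k; X_ν(t))` converges
to `S`. -/
def HasSigma (D : Degree) (a b : ℂ) (c : ℕ → ℂ) (t : ℂ) (S : ℂ) : Prop :=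
  Tendsto (fun n : ℕ => ∑ k ∈ Finset.range n, sigmaTerm D a b c t k) atTop (𝓝 S)

/-- The weights `c_{ν,k}`. -/
noncomputable def cWeight : Degree → ℕ → ℂ
  | .half, k => 6 * (harmonicNumber 1 (2 * k) - harmonicNumber 1 k)
  | .third, k =>
      3 * harmonicNumber 1 (3 * k) + 2 * harmonicNumber 1 (2 * k) - 5 * harmonicNumber 1 k
  | .quarter, k => 4 * (harmonicNumber 1 (4 * k) - harmonicNumber 1 k)
  | .sixth, k =>
      3 * (2 * harmonicNumber 1 (6 * k) - harmonicNumber 1 (3 * k) - harmonicNumber 1 k)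

/-- The weights `d_{ν,k}`. -/
noncomputable def dWeight : Degree → ℕ → ℂ
  | .half, k => 6 * (-2 * harmonicNumber 2 (2 * k) + harmonicNumber 2 k)
  | .third, k =>
      -9 * harmonicNumber 2 (3 * k) - 4 * harmonicNumber 2 (2 * k) + 5 * harmonicNumber 2 k
  | .quarter, k => 4 * (-4 * harmonicNumber 2 (4 * k) + harmonicNumber 2 k)
  | .sixth, k =>
      3 * (-12 * harmonicNumber 2 (6 * k) + 3 * harmonicNumber 2 (3 * k) + harmonicNumber 2 k)

/-- The quotient `i P_ν(2t - 1) / P_ν(1 - 2t)`. -/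
noncomputable def ratio (ν : ℝ) (t : ℂ) : ℂ :=
  Complex.I * legendreP ν (2 * t - 1) / legendreP ν (1 - 2 * t)

end RamanujanSun

/-!
Write `F(t) = P_ν(1 - 2t)`, `G(t) = P_ν(2t - 1)`, `s = sin (νπ) / π`, `κ = -ν (ν + 1)`,
`u = 4 t (1 - t)` and `ρ = i G / F`. The series `Σ_ν` are power series in `u` with coefficients
`a_k`, `a_k c_k`, `a_k (c_k² + d_k)`, where `a_k` are the coefficients of
`₃F₂(-ν, 1/2, ν + 1; 1, 1; u)`; the weights `c_k` and `d_k` are the first and second logarithmic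
derivatives of `a_{k + ε} / a_ε` in `ε`, which is why harmonic numbers occur.

*Clausen's formula.* Let `g` and `g log u + j` be the two solutions at `u = 0` of the second-order
hypergeometric equation for `₂F₁(-ν/2, (ν + 1)/2; 1; u)`. Its symmetric square is the equation of
`₃F₂`, so comparison of coefficients gives `∑ a_k u^k = g²`, `∑ a_k c_k u^k = g j` and
`∑ a_k (c_k² + d_k) u^k = j²` (`gFun_sq`, `gFun_mul_jFun`, `jFun_sq`).

*Identification with Legendre functions.* On the lens `|u| < 1`, `Re t < 1/2` the substitution
`u = 4 t (1 - t)` turns this equation into Legendre's equation, so `F = g(u)` (`regSol_eq_gFun`) and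
`G / F` differs from a multiple of `log u + j / g` by a constant. The behaviour of `G` at `t = 0`
fixes both constants: for the four admissible degrees the digamma constant in
`G = s (log t - log K) + o(1)` is the logarithm of an integer `K`, and
`G = s F (log X_ν(t) + j / g)` (`logSol_eq`). It also gives the Wronskian
`t (1 - t) (F G' - F' G) = s` on the doubly slit plane (`wronskian_eq`).

*Elimination.* The Wronskian and `Re r⁻¹ = Re r / |r|²` reduce the Legendre–Ramanujan function to
`R_ν(1 - 2t) = -4 t (1 - t) F' / F - 2 s / (F² Im ρ)` (`legendreRamanujanFormula_eq`). With
`L = G / (s F)`, so that `ρ = i s L`, the three sums are `F²`, `F² (L - log X)` and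
`F² (L - log X)²`; termwise differentiation along `u d/du` and substitution of `R_ν` make
all derivatives of `F` cancel, and the right-hand sides remain.

*The boundary of the lens.* The coefficients `k a_k` tend to zero with bounded variation, and so do
their products with the weights. By Dirichlet's test the series converge for `|u| ≤ 1`, `u ≠ 1`, to
continuous functions there (`tendsto_sum_abelSum`, `continuousWithinAt_abelSum`). The Legendre
functions are continuous up to their cuts from above, so every identity extends from the open slit
lens to the closed lens.

*Nonvanishing.* The Euler integral has positive real part because `-1/2 ≤ ν < 0`, and `Im ρ > 0`
because `F̄ G` is a double integral of terms `ā^ν b^ν` in which the angle between `a` and `b` is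
less than `π` (`re_shiftedP_pos`, `re_conj_shiftedP_mul_pos`).
-/

namespace RamanujanSun

open Set MeasureTheory

/-! ### The Euler integral on the slit plane -/

/-- The Euler weight `X^ν (1 - X)^(-ν-1)` on `(0, 1)`. -/
noncomputable def eulerWeight (ν X : ℝ) : ℝ := X ^ ν * (1 - X) ^ (-ν - 1)

/-- The Euler integral `∫₀¹ X^ν (1 - X)^(-ν-1) X^n (1 - X + z X)^μ dX`. -/
noncomputable def eulerMoment (ν : ℝ) (n : ℕ) (μ : ℝ) (z : ℂ) : ℂ :=
  ∫ X in (0 : ℝ)..1, (eulerWeight ν X : ℂ) * ((X : ℂ) ^ n * (1 - X + z * X) ^ (μ : ℂ))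

/-- The Legendre function in the variable `z = (1 + x) / 2`, which has its cut on `(-∞, 0]`. -/
noncomputable def shiftedP (ν : ℝ) (z : ℂ) : ℂ := legendreP ν (2 * z - 1)

lemma eulerWeight_nonneg {ν X : ℝ} (h0 : 0 ≤ X) (h1 : X ≤ 1) : 0 ≤ eulerWeight ν X :=
  mul_nonneg (Real.rpow_nonneg h0 _) (Real.rpow_nonneg (by linarith) _)

lemma eulerWeight_pos {ν X : ℝ} (h0 : 0 < X) (h1 : X < 1) : 0 < eulerWeight ν X :=
  mul_pos (Real.rpow_pos_of_pos h0 _) (Real.rpow_pos_of_pos (by linarith) _)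

/-- Euler's weight in the form used by `Complex.betaIntegral`. -/
lemma eulerWeight_cast {ν X : ℝ} (h0 : 0 ≤ X) (h1 : X ≤ 1) :
    (eulerWeight ν X : ℂ) =
      (X : ℂ) ^ (((ν + 1 : ℝ) : ℂ) - 1) * (1 - (X : ℂ)) ^ (((-ν : ℝ) : ℂ) - 1) := by
  have e1 : (((ν + 1 : ℝ) : ℂ) - 1) = ((ν : ℝ) : ℂ) := by push_cast; ring
  have e2 : (((-ν : ℝ) : ℂ) - 1) = ((-ν - 1 : ℝ) : ℂ) := by push_cast; ring
  have e3 : (1 - (X : ℂ)) = ((1 - X : ℝ) : ℂ) := by push_cast; ring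
  rw [e1, e2, e3, ← Complex.ofReal_cpow h0, ← Complex.ofReal_cpow (by linarith), eulerWeight]
  push_cast; ring

lemma intervalIntegrable_eulerWeight_cast {ν : ℝ} (h1 : -1 < ν) (h0 : ν < 0) :
    IntervalIntegrable (fun X => (eulerWeight ν X : ℂ)) volume 0 1 := by
  refine (Complex.betaIntegral_convergent (u := ((ν + 1 : ℝ) : ℂ)) (v := ((-ν : ℝ) : ℂ))
    (by simpa using by linarith) (by simpa using h0)).congr ?_
  rw [uIoc_of_le zero_le_one]
  intro X hX
  exact (eulerWeight_cast hX.1.le hX.2).symm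

lemma intervalIntegrable_eulerWeight {ν : ℝ} (h1 : -1 < ν) (h0 : ν < 0) :
    IntervalIntegrable (eulerWeight ν) volume 0 1 := by
  refine (intervalIntegrable_eulerWeight_cast h1 h0).norm.congr ?_
  rw [uIoc_of_le zero_le_one]
  intro X hX
  simp [abs_of_nonneg (eulerWeight_nonneg (ν := ν) hX.1.le hX.2)]

/-- The beta integral `B(ν + 1, -ν)`, evaluated by Euler's reflection formula. -/
lemma integral_eulerWeight {ν : ℝ} (h1 : -1 < ν) (h0 : ν < 0) :
    ∫ X in (0 : ℝ)..1, (eulerWeight ν X : ℂ) = -((Real.pi / Real.sin (ν * Real.pi) : ℝ) : ℂ) := by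
  have hb := Complex.Gamma_mul_Gamma_eq_betaIntegral (s := ((ν + 1 : ℝ) : ℂ))
    (t := ((-ν : ℝ) : ℂ)) (by simpa using by linarith) (by simpa using h0)
  have h2 : ((ν + 1 : ℝ) : ℂ) + ((-ν : ℝ) : ℂ) = 1 := by push_cast; ring
  have h3 : ((ν + 1 : ℝ) : ℂ) = 1 - ((-ν : ℝ) : ℂ) := by push_cast; ring
  rw [h2, Complex.Gamma_one, one_mul, mul_comm] at hb
  rw [h3, Complex.Gamma_mul_Gamma_one_sub, ← h3] at hb
  rw [intervalIntegral.integral_congr (g := fun X : ℝ => (X : ℂ) ^ (((ν + 1 : ℝ) : ℂ) - 1)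
    * (1 - (X : ℂ)) ^ (((-ν : ℝ) : ℂ) - 1))]
  · rw [← Complex.betaIntegral, ← hb, ← Complex.ofReal_mul, ← Complex.ofReal_sin,
      ← Complex.ofReal_div, ← Complex.ofReal_neg]
    congr 1
    rw [show Real.pi * -ν = -(ν * Real.pi) by ring, Real.sin_neg, div_neg]
  · intro X hX
    rw [uIcc_of_le zero_le_one] at hX
    exact eulerWeight_cast hX.1 hX.2

/-- The segment from `1` to `z` stays in the slit plane. -/
lemma lin_mem_slitPlane {z : ℂ} (hz : z ∈ Complex.slitPlane) {X : ℝ} (h0 : 0 ≤ X) (h1 : X ≤ 1) :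
    (1 - X + z * X : ℂ) ∈ Complex.slitPlane := by
  have := Complex.starConvex_one_slitPlane hz (a := 1 - X) (b := X) (by linarith) h0 (by ring)
  simpa [mul_comm] using this

lemma continuousOn_lin_cpow (n : ℕ) (μ : ℝ) :
    ContinuousOn (fun p : ℂ × ℝ => ((p.2 : ℂ) ^ n * (1 - p.2 + p.1 * p.2) ^ (μ : ℂ)))
      (Complex.slitPlane ×ˢ Icc (0 : ℝ) 1) := by
  refine ContinuousOn.mul (by fun_prop) (ContinuousOn.cpow (by fun_prop) (by fun_prop) ?_)
  rintro ⟨z, X⟩ ⟨hz, hX⟩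
  exact lin_mem_slitPlane hz hX.1 hX.2

lemma continuousOn_lin_cpow_right (n : ℕ) (μ : ℝ) {z : ℂ} (hz : z ∈ Complex.slitPlane) :
    ContinuousOn (fun X : ℝ => ((X : ℂ) ^ n * (1 - X + z * X) ^ (μ : ℂ))) (Icc (0 : ℝ) 1) :=
  (continuousOn_lin_cpow n μ).comp (f := fun X : ℝ => (z, X)) (by fun_prop)
    (fun X hX => ⟨hz, hX⟩)

lemma intervalIntegrable_eulerMoment {ν : ℝ} (h1 : -1 < ν) (h0 : ν < 0) (n : ℕ) (μ : ℝ) {z : ℂ}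
    (hz : z ∈ Complex.slitPlane) :
    IntervalIntegrable (fun X : ℝ =>
      (eulerWeight ν X : ℂ) * ((X : ℂ) ^ n * (1 - X + z * X) ^ (μ : ℂ))) volume 0 1 :=
  (intervalIntegrable_eulerWeight_cast h1 h0).mul_continuousOn (by
    rw [uIcc_of_le zero_le_one]; exact continuousOn_lin_cpow_right n μ hz)

lemma hasDerivAt_eulerMoment {ν : ℝ} (h1 : -1 < ν) (h0 : ν < 0) (n : ℕ) (μ : ℝ) {z : ℂ}
    (hz : z ∈ Complex.slitPlane) :
    HasDerivAt (eulerMoment ν n μ) (μ * eulerMoment ν (n + 1) (μ - 1) z) z := by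
  obtain ⟨r, hr, hball⟩ := Metric.nhds_basis_closedBall.mem_iff.1
    (Complex.isOpen_slitPlane.mem_nhds hz)
  obtain ⟨C, hC⟩ := ((isCompact_closedBall z r).prod (isCompact_Icc (a := (0 : ℝ))
    (b := 1))).exists_bound_of_continuousOn
      ((continuousOn_lin_cpow (n + 1) (μ - 1)).mono (prod_mono hball subset_rfl))
  have key := intervalIntegral.hasDerivAt_integral_of_dominated_loc_of_deriv_le (μ := volume)
    (a := 0) (b := 1) (x₀ := z) (s := Metric.closedBall z r)
    (F := fun z (X : ℝ) => (eulerWeight ν X : ℂ) * ((X : ℂ) ^ n * (1 - X + z * X) ^ (μ : ℂ)))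
    (F' := fun z (X : ℝ) => (μ : ℂ) * ((eulerWeight ν X : ℂ) *
      ((X : ℂ) ^ (n + 1) * (1 - X + z * X) ^ ((μ - 1 : ℝ) : ℂ))))
    (bound := fun X => |μ| * (eulerWeight ν X * C))
    (Metric.closedBall_mem_nhds z hr) ?_ (intervalIntegrable_eulerMoment h1 h0 n μ hz) ?_ ?_ ?_ ?_
  · refine key.2.congr_deriv ?_
    rw [intervalIntegral.integral_const_mul, eulerMoment]
  · filter_upwards [Complex.isOpen_slitPlane.mem_nhds hz] with y hy
    exact (intervalIntegrable_eulerMoment h1 h0 n μ hy).def'.aestronglyMeasurable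
  · exact ((intervalIntegrable_eulerMoment h1 h0 (n + 1) (μ - 1) hz).const_mul
      _).def'.aestronglyMeasurable
  · refine Eventually.of_forall fun X hX y hy => ?_
    rw [uIoc_of_le zero_le_one] at hX
    rw [norm_mul, norm_mul, Complex.norm_real, Complex.norm_real, Real.norm_eq_abs,
      Real.norm_eq_abs, abs_of_nonneg (eulerWeight_nonneg hX.1.le hX.2)]
    exact mul_le_mul_of_nonneg_left (mul_le_mul_of_nonneg_left (hC (y, X) ⟨hy, hX.1.le, hX.2⟩)
      (eulerWeight_nonneg hX.1.le hX.2)) (abs_nonneg _)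
  · exact ((intervalIntegrable_eulerWeight h1 h0).mul_const C).const_mul _
  · refine Eventually.of_forall fun X hX y hy => ?_
    rw [uIoc_of_le zero_le_one] at hX
    have hl : HasDerivAt (fun y : ℂ => 1 - (X : ℂ) + y * X) (X : ℂ) y := by
      simpa using ((hasDerivAt_id y).mul_const (X : ℂ)).const_add (1 - (X : ℂ))
    have := ((hl.cpow_const (c := (μ : ℂ)) (lin_mem_slitPlane (hball hy) hX.1.le hX.2)).const_mul
      ((X : ℂ) ^ n)).const_mul (eulerWeight ν X : ℂ)
    refine this.congr_deriv ?_
    push_cast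
    ring

lemma ofReal_pos_mul_cpow {r : ℝ} (hr : 0 < r) (w c : ℂ) :
    ((r : ℂ) * w) ^ c = (r : ℂ) ^ c * w ^ c := by
  have hr' : (r : ℂ) ≠ 0 := by exact_mod_cast hr.ne'
  by_cases hw : w = 0
  · subst hw
    by_cases hc : c = 0 <;> simp [hc]
  · rw [Complex.cpow_def_of_ne_zero (mul_ne_zero hr' hw), Complex.cpow_def_of_ne_zero hr',
      Complex.cpow_def_of_ne_zero hw, Complex.log_ofReal_mul hr hw, Complex.ofReal_log hr.le,
      ← Complex.exp_add]
    ring_nf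

lemma ae_ne_const (c : ℝ) : ∀ᵐ X : ℝ, X ≠ c := by simp [ae_iff]

/-- The Legendre function as an Euler integral, valid on the cut as well. -/
lemma shiftedP_eq (ν : ℝ) (z : ℂ) :
    shiftedP ν z = -((Real.sin (ν * Real.pi) / Real.pi : ℝ) : ℂ) * eulerMoment ν 0 ν z := by
  rw [shiftedP, legendreP, eulerMoment]
  congr 1
  refine intervalIntegral.integral_congr_ae ?_
  filter_upwards [ae_ne_const 1] with X hX1 hX
  rw [uIoc_of_le zero_le_one] at hX
  have hlt : X < 1 := lt_of_le_of_ne hX.2 hX1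
  have hp : 0 < X / (1 - X) := div_pos hX.1 (by linarith)
  have hne : (1 - X : ℝ) ≠ 0 := by linarith
  have hc : (1 - (X : ℂ)) ≠ 0 := by exact_mod_cast hne
  have e : (X : ℂ) * (1 - (1 - (2 * z - 1)) / 2 * X) / (1 - X)
      = ((X / (1 - X) : ℝ) : ℂ) * (1 - X + z * X) := by
    push_cast; field_simp; ring
  rw [e, ofReal_pos_mul_cpow hp, ← Complex.ofReal_cpow hp.le,
    Real.div_rpow hX.1.le (by linarith), eulerWeight, Real.rpow_sub (by linarith : 0 < 1 - X),
    Real.rpow_neg (by linarith), Real.rpow_one]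
  push_cast
  have h3 : (((1 - X) ^ ν : ℝ) : ℂ) ≠ 0 := by
    exact_mod_cast (Real.rpow_pos_of_pos (by linarith : 0 < 1 - X) ν).ne'
  field_simp

/-! ### Legendre's equation -/

/-- The derivative of `shiftedP ν` on the slit plane. -/
noncomputable def shiftedP' (ν : ℝ) (z : ℂ) : ℂ :=
  -((Real.sin (ν * Real.pi) / Real.pi : ℝ) : ℂ) * (ν * eulerMoment ν 1 (ν - 1) z)

lemma hasDerivAt_shiftedP {ν : ℝ} (h1 : -1 < ν) (h0 : ν < 0) {z : ℂ}
    (hz : z ∈ Complex.slitPlane) : HasDerivAt (shiftedP ν) (shiftedP' ν z) z := by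
  have : shiftedP ν = fun z => -((Real.sin (ν * Real.pi) / Real.pi : ℝ) : ℂ) *
      eulerMoment ν 0 ν z := funext (shiftedP_eq ν)
  rw [this]
  exact (hasDerivAt_eulerMoment h1 h0 0 ν hz).const_mul _

lemma hasDerivAt_eulerBoundary {ν : ℝ} {z : ℂ} (hz : z ∈ Complex.slitPlane) {X : ℝ}
    (hX0 : 0 < X) (hX1 : X < 1) :
    HasDerivAt (fun X : ℝ => ((X ^ (ν + 1) * (1 - X) ^ (-ν) : ℝ) : ℂ) *
        (1 - X + z * X) ^ ((ν - 1 : ℝ) : ℂ))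
      (((eulerWeight ν X * (ν + 1 - X) : ℝ) : ℂ) * (1 - X + z * X) ^ ((ν - 1 : ℝ) : ℂ)
        + ((X ^ (ν + 1) * (1 - X) ^ (-ν) : ℝ) : ℂ) *
          (((ν - 1 : ℝ) : ℂ) * (1 - X + z * X) ^ ((ν - 2 : ℝ) : ℂ) * (z - 1))) X := by
  have hX1' : 0 < 1 - X := by linarith
  have hr : HasDerivAt (fun X : ℝ => X ^ (ν + 1) * (1 - X) ^ (-ν))
      (eulerWeight ν X * (ν + 1 - X)) X := by
    have a := Real.hasDerivAt_rpow_const (x := X) (p := ν + 1) (Or.inl hX0.ne')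
    have b := ((hasDerivAt_id X).const_sub 1).rpow_const (p := -ν) (Or.inl hX1'.ne')
    refine (a.mul b).congr_deriv ?_
    have e1 : X ^ (ν + 1) = X ^ ν * X := by rw [Real.rpow_add hX0, Real.rpow_one]
    have e2 : (1 - X) ^ (-ν) = (1 - X) ^ (-ν - 1) * (1 - X) := by
      rw [← Real.rpow_add_one hX1'.ne']; ring_nf
    simp only [id, eulerWeight, e1, e2, add_sub_cancel_right]
    ring
  have hl : HasDerivAt (fun X : ℝ => 1 - (X : ℂ) + z * X) (z - 1) X := by
    have := ((hasDerivAt_id X).ofReal_comp.const_mul (z - 1)).const_add (1 : ℂ)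
    refine (this.congr_deriv (by simp)).congr_of_eventuallyEq (Eventually.of_forall fun Y => ?_)
    simp only [id]; ring
  have hm := (Complex.hasStrictDerivAt_cpow_const (c := ((ν - 1 : ℝ) : ℂ))
    (lin_mem_slitPlane hz hX0.le hX1.le)).hasDerivAt.comp X hl
  have e : ((ν - 2 : ℝ) : ℂ) = ((ν - 1 : ℝ) : ℂ) - 1 := by push_cast; ring
  rw [e]
  exact hr.ofReal_comp.mul hm

/-- The hypergeometric equation for the Euler integrals: the integrand of the left-hand side is
the exact derivative of `ν X^(ν+1) (1 - X)^(-ν) (1 - X + z X)^(ν-1)`, which vanishes at both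
endpoints. -/
lemma eulerMoment_ode {ν : ℝ} (h1 : -1 < ν) (h0 : ν < 0) {z : ℂ} (hz : z ∈ Complex.slitPlane) :
    z * (1 - z) * (ν - 1) * eulerMoment ν 2 (ν - 2) z + (1 - 2 * z) * eulerMoment ν 1 (ν - 1) z
      + (ν + 1) * eulerMoment ν 0 ν z = 0 := by
  have i2 := (intervalIntegrable_eulerMoment h1 h0 2 (ν - 2) hz).const_mul (z * (1 - z) * (ν - 1))
  have i1 := (intervalIntegrable_eulerMoment h1 h0 1 (ν - 1) hz).const_mul (1 - 2 * z)
  have i0 := (intervalIntegrable_eulerMoment h1 h0 0 ν hz).const_mul ((ν : ℂ) + 1)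
  simp only [eulerMoment]
  rw [← intervalIntegral.integral_const_mul, ← intervalIntegral.integral_const_mul,
    ← intervalIntegral.integral_const_mul, ← intervalIntegral.integral_add i2 i1,
    ← intervalIntegral.integral_add (i2.add i1) i0]
  have hftc := intervalIntegral.integral_eq_sub_of_hasDerivAt_of_le (zero_le_one' ℝ)
    (f := fun X : ℝ => ((X ^ (ν + 1) * (1 - X) ^ (-ν) : ℝ) : ℂ) *
        (1 - X + z * X) ^ ((ν - 1 : ℝ) : ℂ)) ?_ ?_ ((i2.add i1).add i0)
  · rw [hftc]
    have e1 : (0 : ℝ) ^ (ν + 1) = 0 := Real.zero_rpow (by linarith)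
    have e2 : (0 : ℝ) ^ (-ν) = 0 := Real.zero_rpow (by linarith)
    simp [e1, e2]
  · refine ContinuousOn.mul ?_ ?_
    · refine Continuous.continuousOn (Complex.continuous_ofReal.comp ?_)
      exact (Real.continuous_rpow_const (by linarith)).mul
        ((Real.continuous_rpow_const (by linarith)).comp (by fun_prop))
    · simpa using continuousOn_lin_cpow_right 0 (ν - 1) hz
  · rintro X ⟨hX0, hX1⟩
    refine (hasDerivAt_eulerBoundary hz hX0 hX1).congr_deriv ?_
    have hX1' : 0 < 1 - X := by linarith
    have hne := Complex.slitPlane_ne_zero (lin_mem_slitPlane hz hX0.le hX1.le)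
    have e1 : X ^ (ν + 1) = X ^ ν * X := by rw [Real.rpow_add hX0, Real.rpow_one]
    have e2 : (1 - X) ^ (-ν) = (1 - X) ^ (-ν - 1) * (1 - X) := by
      rw [← Real.rpow_add_one hX1'.ne']; ring_nf
    have e3 : (1 - X + z * X : ℂ) ^ ((ν - 1 : ℝ) : ℂ)
        = (1 - X + z * X : ℂ) ^ ((ν - 2 : ℝ) : ℂ) * (1 - X + z * X) := by
      rw [show ((ν - 1 : ℝ) : ℂ) = ((ν - 2 : ℝ) : ℂ) + 1 by push_cast; ring,
        Complex.cpow_add _ _ hne, Complex.cpow_one]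
    have e4 : (1 - X + z * X : ℂ) ^ (ν : ℂ)
        = (1 - X + z * X : ℂ) ^ ((ν - 2 : ℝ) : ℂ) * (1 - X + z * X) ^ 2 := by
      rw [show (ν : ℂ) = ((ν - 2 : ℝ) : ℂ) + 1 + 1 by push_cast; ring,
        Complex.cpow_add _ _ hne, Complex.cpow_add _ _ hne, Complex.cpow_one]
      push_cast; ring
    rw [e1, e2, e3, e4, eulerWeight]
    push_cast
    ring

/-- Legendre's equation in self-adjoint form. -/
lemma hasDerivAt_mul_shiftedP' {ν : ℝ} (h1 : -1 < ν) (h0 : ν < 0) {z : ℂ}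
    (hz : z ∈ Complex.slitPlane) :
    HasDerivAt (fun z => z * (1 - z) * shiftedP' ν z) (-ν * (ν + 1) * shiftedP ν z) z := by
  have hd := ((hasDerivAt_eulerMoment h1 h0 1 (ν - 1) hz).const_mul (ν : ℂ)).const_mul
    (-((Real.sin (ν * Real.pi) / Real.pi : ℝ) : ℂ))
  have hp : HasDerivAt (fun z : ℂ => z * (1 - z)) (1 - 2 * z) z :=
    ((hasDerivAt_id z).mul ((hasDerivAt_id z).const_sub 1)).congr_deriv (by simp; ring)
  refine (hp.mul hd).congr_deriv ?_
  have := eulerMoment_ode h1 h0 hz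
  rw [show ν - 1 - 1 = ν - 2 by ring, shiftedP_eq, Complex.ofReal_sub ν, Complex.ofReal_one]
  linear_combination (-((Real.sin (ν * Real.pi) / Real.pi : ℝ) : ℂ)) * ν * this

lemma sin_nu_pi_neg {ν : ℝ} (h1 : -1 < ν) (h0 : ν < 0) : Real.sin (ν * Real.pi) < 0 :=
  Real.sin_neg_of_neg_of_neg_pi_lt (by nlinarith [Real.pi_pos]) (by nlinarith [Real.pi_pos])

/-- The normalization `P_ν(1) = 1`. -/
lemma shiftedP_one {ν : ℝ} (h1 : -1 < ν) (h0 : ν < 0) : shiftedP ν 1 = 1 := by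
  have hs := (sin_nu_pi_neg h1 h0).ne
  have : eulerMoment ν 0 ν 1 = ∫ X in (0 : ℝ)..1, (eulerWeight ν X : ℂ) := by
    simp [eulerMoment]
  rw [shiftedP_eq, this, integral_eulerWeight h1 h0, neg_mul_neg, ← Complex.ofReal_mul]
  have hpi := Real.pi_pos.ne'
  norm_cast
  field_simp

lemma shiftedP_conj {ν : ℝ} {z : ℂ} (hz : z ∈ Complex.slitPlane) :
    shiftedP ν (starRingEnd ℂ z) = starRingEnd ℂ (shiftedP ν z) := by
  rw [shiftedP_eq, shiftedP_eq, map_mul, map_neg, Complex.conj_ofReal, eulerMoment, eulerMoment,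
    ← intervalIntegral.intervalIntegral_conj]
  congr 1
  refine intervalIntegral.integral_congr fun X hX => ?_
  rw [uIcc_of_le zero_le_one] at hX
  have := Complex.conj_cpow (1 - X + z * X : ℂ) (ν : ℂ)
    (Complex.slitPlane_arg_ne_pi (lin_mem_slitPlane hz hX.1 hX.2))
  rw [Complex.conj_ofReal] at this
  simp only [map_add, map_sub, map_one, map_mul, Complex.conj_ofReal] at this
  simp [this]

/-! ### Positivity and nonvanishing -/

lemma cos_nu_mul_pos {ν θ : ℝ} (h1 : -(1 / 2) ≤ ν) (h0 : ν < 0) (hl : -Real.pi < θ)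
    (hr : θ < Real.pi) : 0 < Real.cos (ν * θ) := by
  apply Real.cos_pos_of_mem_Ioo
  constructor <;> nlinarith

lemma re_cpow_eq (w : ℂ) (ν : ℝ) :
    (w ^ (ν : ℂ)).re = ‖w‖ ^ ν * Real.cos (ν * w.arg) := by
  rw [Complex.cpow_ofReal_re, mul_comm w.arg]

lemma re_cpow_pos {ν : ℝ} (h1 : -(1 / 2) ≤ ν) (h0 : ν < 0) {w : ℂ} (hw : w ∈ Complex.slitPlane) :
    0 < (w ^ (ν : ℂ)).re := by
  have hw0 := Complex.slitPlane_ne_zero hw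
  rw [re_cpow_eq]
  exact mul_pos (Real.rpow_pos_of_pos (norm_pos_iff.2 hw0) _) (cos_nu_mul_pos h1 h0
    (Complex.neg_pi_lt_arg w) (lt_of_le_of_ne (Complex.arg_le_pi w)
      (Complex.slitPlane_arg_ne_pi hw)))

/-- The angle between `a` and `b` is less than `π`, hence the angle between `a ^ ν` and `b ^ ν` is
acute. -/
lemma re_conj_cpow_mul_cpow_pos {ν : ℝ} (h1 : -(1 / 2) ≤ ν) (h0 : ν < 0) {a b : ℂ}
    (ha : 0 < a.im) (hb : b.im < 0) (hab : 0 < (a * starRingEnd ℂ b).im) :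
    0 < (starRingEnd ℂ (a ^ (ν : ℂ)) * b ^ (ν : ℂ)).re := by
  have ha0 : a ≠ 0 := by rintro rfl; simp at ha
  have hb0 : b ≠ 0 := by rintro rfl; simp at hb
  have hna := norm_pos_iff.2 ha0
  have hnb := norm_pos_iff.2 hb0
  have e : (starRingEnd ℂ (a ^ (ν : ℂ)) * b ^ (ν : ℂ)).re
      = ‖a‖ ^ ν * ‖b‖ ^ ν * Real.cos (ν * (a.arg - b.arg)) := by
    rw [Complex.mul_re, Complex.conj_re, Complex.conj_im, Complex.cpow_ofReal_re,
      Complex.cpow_ofReal_re, Complex.cpow_ofReal_im, Complex.cpow_ofReal_im,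
      show ν * (a.arg - b.arg) = a.arg * ν - b.arg * ν by ring, Real.cos_sub]
    ring
  have hs : (a * starRingEnd ℂ b).im = ‖a‖ * ‖b‖ * Real.sin (a.arg - b.arg) := by
    rw [Complex.mul_im, Complex.conj_re, Complex.conj_im, Real.sin_sub,
      ← Complex.norm_mul_cos_arg a, ← Complex.norm_mul_cos_arg b, ← Complex.norm_mul_sin_arg a,
      ← Complex.norm_mul_sin_arg b]
    ring
  rw [hs] at hab
  have hsin : 0 < Real.sin (a.arg - b.arg) := pos_of_mul_pos_right hab (by positivity)
  have hargb : b.arg < 0 := Complex.arg_neg_iff.2 hb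
  have harga : 0 ≤ a.arg := Complex.arg_nonneg_iff.2 ha.le
  have hlt : a.arg - b.arg < Real.pi := by
    by_contra! hge
    have := Real.sin_nonneg_of_mem_Icc (x := a.arg - b.arg - Real.pi)
      ⟨by linarith, by linarith [Complex.arg_le_pi a, Complex.neg_pi_lt_arg b]⟩
    rw [Real.sin_sub_pi] at this
    linarith
  rw [e]
  exact mul_pos (by positivity) (cos_nu_mul_pos h1 h0 (by linarith [Real.pi_pos]) hlt)

lemma re_integral_pos {f : ℝ → ℂ} {a b : ℝ} (hab : a < b) (hf : IntervalIntegrable f volume a b)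
    (h : ∀ X ∈ Ioo a b, 0 < (f X).re) : 0 < (∫ X in a..b, f X).re := by
  have := Complex.reCLM.intervalIntegral_comp_comm hf
  simp only [Complex.reCLM_apply] at this
  rw [← this]
  refine intervalIntegral.intervalIntegral_pos_of_pos_on ?_ h hab
  exact ⟨hf.1.re, hf.2.re⟩

/-- Positivity of the real part passes from the linear factors to the Euler integral. -/
lemma re_mul_eulerMoment_pos {ν : ℝ} (h1 : -1 < ν) (h0 : ν < 0) {z : ℂ}
    (hz : z ∈ Complex.slitPlane) (v : ℂ)
    (h : ∀ X : ℝ, 0 < X → X < 1 → 0 < (v * (1 - X + z * X : ℂ) ^ (ν : ℂ)).re) :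
    0 < (v * eulerMoment ν 0 ν z).re := by
  have hi := (intervalIntegrable_eulerMoment h1 h0 0 ν hz).const_mul v
  rw [eulerMoment, ← intervalIntegral.integral_const_mul]
  refine re_integral_pos zero_lt_one hi fun X hX => ?_
  have e : v * ((eulerWeight ν X : ℂ) * ((X : ℂ) ^ 0 * (1 - X + z * X) ^ (ν : ℂ)))
      = (eulerWeight ν X : ℂ) * (v * (1 - X + z * X) ^ (ν : ℂ)) := by ring
  rw [e, Complex.re_ofReal_mul]
  exact mul_pos (eulerWeight_pos hX.1 hX.2) (h X hX.1 hX.2)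

lemma neg_sin_div_pi_pos {ν : ℝ} (h1 : -1 < ν) (h0 : ν < 0) :
    0 < -(Real.sin (ν * Real.pi) / Real.pi) := by
  rw [← neg_div]
  exact div_pos (neg_pos.2 (sin_nu_pi_neg h1 h0)) Real.pi_pos

lemma re_shiftedP_pos {ν : ℝ} (h1 : -(1 / 2) ≤ ν) (h0 : ν < 0) {z : ℂ}
    (hz : z ∈ Complex.slitPlane) : 0 < (shiftedP ν z).re := by
  rw [shiftedP_eq, ← Complex.ofReal_neg, Complex.re_ofReal_mul]
  refine mul_pos (neg_sin_div_pi_pos (by linarith) h0) ?_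
  simpa using re_mul_eulerMoment_pos (by linarith) h0 hz 1 fun X hX0 hX1 => by
    simpa using re_cpow_pos h1 h0 (lin_mem_slitPlane hz hX0.le hX1.le)

lemma shiftedP_ne_zero {ν : ℝ} (h1 : -(1 / 2) ≤ ν) (h0 : ν < 0) {z : ℂ}
    (hz : z ∈ Complex.slitPlane) : shiftedP ν z ≠ 0 := by
  intro h
  have := re_shiftedP_pos h1 h0 hz
  simp [h] at this

/-- The plane slit along `(-∞, 0]` and `[1, ∞)`. -/
def doubleSlit : Set ℂ := {t | t ∈ Complex.slitPlane ∧ 1 - t ∈ Complex.slitPlane}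

lemma shiftedP_im_zero {ν : ℝ} {z : ℂ} (hz : z ∈ Complex.slitPlane) (h : z.im = 0) :
    (shiftedP ν z).im = 0 := by
  have := shiftedP_conj (ν := ν) hz
  rw [Complex.conj_eq_iff_im.2 h] at this
  exact Complex.conj_eq_iff_im.1 this.symm

/-- In the upper half plane, `1 - X + t X` lies above and `1 - Y + (1 - t) Y` below the real axis,
and `re_conj_cpow_mul_cpow_pos` applies to each pair of linear factors in the double integral. -/
lemma re_conj_shiftedP_mul_pos_of_im_pos {ν : ℝ} (h1 : -(1 / 2) ≤ ν) (h0 : ν < 0) {t : ℂ}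
    (ht : 0 < t.im) : 0 < (starRingEnd ℂ (shiftedP ν (1 - t)) * shiftedP ν t).re := by
  have h1' : -1 < ν := by linarith
  have ht' : t ∈ Complex.slitPlane := Or.inr ht.ne'
  have hs' : 1 - t ∈ Complex.slitPlane := Or.inr (by simpa using ht.ne')
  have key : 0 < (starRingEnd ℂ (eulerMoment ν 0 ν (1 - t)) * eulerMoment ν 0 ν t).re := by
    refine re_mul_eulerMoment_pos h1' h0 ht' _ fun X hX0 hX1 => ?_
    have hflip : (starRingEnd ℂ (eulerMoment ν 0 ν (1 - t)) * (1 - X + t * X : ℂ) ^ (ν : ℂ)).re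
        = (starRingEnd ℂ ((1 - X + t * X : ℂ) ^ (ν : ℂ)) * eulerMoment ν 0 ν (1 - t)).re := by
      rw [← Complex.conj_re, map_mul, Complex.conj_conj, mul_comm]
    rw [hflip]
    refine re_mul_eulerMoment_pos h1' h0 hs' _ fun Y hY0 hY1 => ?_
    refine re_conj_cpow_mul_cpow_pos h1 h0 ?_ ?_ ?_
    · simp; positivity
    · simp; positivity
    · have e : ((1 - X + t * X : ℂ) * starRingEnd ℂ (1 - Y + (1 - t) * Y)).im
          = t.im * ((1 - X) * Y + X * (1 - Y) + X * Y) := by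
        simp; ring
      rw [e]
      have : 0 < (1 - X) * Y := mul_pos (by linarith) hY0
      have : 0 < X * (1 - Y) := mul_pos hX0 (by linarith)
      positivity
  have hσ := neg_sin_div_pi_pos h1' h0
  rw [shiftedP_eq, shiftedP_eq, ← Complex.ofReal_neg, map_mul, Complex.conj_ofReal,
    mul_mul_mul_comm, ← Complex.ofReal_mul, Complex.re_ofReal_mul]
  exact mul_pos (mul_pos hσ hσ) key

/-- The quotient `P_ν(2t - 1) / P_ν(1 - 2t)` has positive real part off the two cuts. -/
lemma re_conj_shiftedP_mul_pos {ν : ℝ} (h1 : -(1 / 2) ≤ ν) (h0 : ν < 0) {t : ℂ}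
    (ht : t ∈ doubleSlit) : 0 < (starRingEnd ℂ (shiftedP ν (1 - t)) * shiftedP ν t).re := by
  rcases lt_trichotomy t.im 0 with him | him | him
  · have := re_conj_shiftedP_mul_pos_of_im_pos h1 h0 (t := starRingEnd ℂ t) (by simpa using him)
    rw [show (1 - starRingEnd ℂ t) = starRingEnd ℂ (1 - t) by simp, shiftedP_conj ht.1,
      shiftedP_conj ht.2, ← map_mul, Complex.conj_re] at this
    exact this
  · have i1 := shiftedP_im_zero (ν := ν) ht.1 him
    have p1 := re_shiftedP_pos h1 h0 ht.1
    have p2 := re_shiftedP_pos h1 h0 ht.2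
    rw [Complex.mul_re, i1, mul_zero, sub_zero, Complex.conj_re]
    exact mul_pos p2 p1
  · exact re_conj_shiftedP_mul_pos_of_im_pos h1 h0 him

/-! ### Boundary values on the cut -/

lemma mobius_den_pos {p Z : ℝ} (hp : 0 < p) (h0 : 0 ≤ Z) (h1 : Z ≤ 1) : 0 < Z + p * (1 - Z) := by
  rcases h0.eq_or_lt with rfl | h
  · simpa using hp
  · have := mul_nonneg hp.le (sub_nonneg.2 h1)
    linarith

lemma hasDerivAt_mobius {p Z : ℝ} (hD : Z + p * (1 - Z) ≠ 0) :
    HasDerivAt (fun Z => Z / (Z + p * (1 - Z))) (p / (Z + p * (1 - Z)) ^ 2) Z := by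
  have hd : HasDerivAt (fun Z => Z + p * (1 - Z)) (1 - p) Z := by
    have := (hasDerivAt_id Z).add (((hasDerivAt_id Z).const_sub 1).const_mul p)
    refine this.congr_deriv (by ring)
  refine ((hasDerivAt_id Z).div hd hD).congr_deriv ?_
  simp only [id]
  congr 1
  ring

/-- Change of variables along the Möbius transformation `Z ↦ Z / (Z + p (1 - Z))` of `(0, 1)`. -/
lemma integral_comp_mobius {E : Type*} [NormedAddCommGroup E] [NormedSpace ℝ E] {p : ℝ}
    (hp : 0 < p) (f : ℝ → E) :
    ∫ X in (0 : ℝ)..1, f X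
      = ∫ Z in (0 : ℝ)..1, (p / (Z + p * (1 - Z)) ^ 2) • f (Z / (Z + p * (1 - Z))) := by
  have hD : ∀ Z ∈ Ioo (0 : ℝ) 1, 0 < Z + p * (1 - Z) := fun Z hZ =>
    mobius_den_pos hp hZ.1.le hZ.2.le
  have himg : (fun Z => Z / (Z + p * (1 - Z))) '' Ioo (0 : ℝ) 1 = Ioo (0 : ℝ) 1 := by
    ext X
    constructor
    · rintro ⟨Z, hZ, rfl⟩
      have := hD Z hZ
      refine ⟨div_pos hZ.1 this, (div_lt_one this).2 ?_⟩
      have := mul_pos hp (sub_pos.2 hZ.2)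
      linarith
    · rintro ⟨h0, h1⟩
      have hE : 0 < 1 - X + p * X := by nlinarith
      refine ⟨p * X / (1 - X + p * X), ⟨by positivity, (div_lt_one hE).2 (by linarith)⟩, ?_⟩
      have : p * X / (1 - X + p * X) + p * (1 - p * X / (1 - X + p * X))
          = p / (1 - X + p * X) := by field_simp; ring
      simp only [this]
      field_simp
  have hinj : InjOn (fun Z => Z / (Z + p * (1 - Z))) (Ioo (0 : ℝ) 1) := by
    intro Z hZ W hW h
    have h1 := hD Z hZ
    have h2 := hD W hW
    simp only at h
    rw [div_eq_div_iff h1.ne' h2.ne'] at h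
    have : p * (Z - W) = 0 := by linarith
    rcases mul_eq_zero.1 this with h | h <;> linarith
  rw [intervalIntegral.integral_of_le zero_le_one, intervalIntegral.integral_of_le zero_le_one,
    integral_Ioc_eq_integral_Ioo, integral_Ioc_eq_integral_Ioo]
  conv_lhs => rw [← himg]
  rw [integral_image_eq_integral_abs_deriv_smul measurableSet_Ioo
    (fun Z hZ => (hasDerivAt_mobius (hD Z hZ).ne').hasDerivWithinAt) hinj]
  refine setIntegral_congr_fun measurableSet_Ioo fun Z hZ => ?_
  have := hD Z hZ
  rw [abs_of_pos (by positivity)]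

/-- The integrand of the Euler integral after a Möbius change of variables with `p = ‖z‖`; its
singularity on the cut sits at `Z = 1 / 2`, independently of `z`. -/
noncomputable def balancedIntegrand (ν : ℝ) (z : ℂ) (Z : ℝ) : ℂ :=
  ((eulerWeight ν Z * (Z + ‖z‖ * (1 - Z)) ^ (-1 - ν) : ℝ) : ℂ) *
    (1 - Z + z / (‖z‖ : ℂ) * Z) ^ (ν : ℂ)

lemma eulerMoment_eq_balanced {ν : ℝ} {z : ℂ} (hz : z ≠ 0) :
    eulerMoment ν 0 ν z = ∫ Z in (0 : ℝ)..1, balancedIntegrand ν z Z := by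
  have hp : 0 < ‖z‖ := norm_pos_iff.2 hz
  rw [eulerMoment, integral_comp_mobius hp]
  refine intervalIntegral.integral_congr_ae ?_
  filter_upwards [ae_ne_const 1] with Z hZ1 hZ
  rw [uIoc_of_le zero_le_one] at hZ
  have hlt : 0 < 1 - Z := sub_pos.2 (lt_of_le_of_ne hZ.2 hZ1)
  have hZ0 := hZ.1
  set p := ‖z‖
  have hD : 0 < Z + p * (1 - Z) := mobius_den_pos hp hZ.1.le hZ.2
  set D := Z + p * (1 - Z) with hDdef
  have hpc : (p : ℂ) ≠ 0 := by exact_mod_cast hp.ne'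
  have hDc : (D : ℂ) ≠ 0 := by exact_mod_cast hD.ne'
  have hDc' : (D : ℂ) = Z + p * (1 - Z) := by rw [hDdef]; push_cast; ring
  have e1 : 1 - Z / D = p * (1 - Z) / D := by field_simp; rw [hDdef]; ring
  have e2 : (1 - ((Z / D : ℝ) : ℂ) + z * ((Z / D : ℝ) : ℂ))
      = ((p / D : ℝ) : ℂ) * (1 - Z + z / p * Z) := by
    push_cast
    field_simp
    rw [hDc']
    ring
  have e3 : p / D ^ 2 * eulerWeight ν (Z / D) * (p / D) ^ ν = eulerWeight ν Z * D ^ (-1 - ν) := by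
    have hx := Real.rpow_pos_of_pos hD ν
    have hy := Real.rpow_pos_of_pos hp ν
    have hw := Real.rpow_pos_of_pos hlt ν
    rw [eulerWeight, eulerWeight, e1, Real.div_rpow hZ.1.le hD.le,
      Real.div_rpow (by positivity) hD.le, Real.div_rpow hp.le hD.le,
      Real.mul_rpow hp.le hlt.le, Real.rpow_sub hp, Real.rpow_sub hD, Real.rpow_sub hD,
      Real.rpow_neg hp.le, Real.rpow_neg hD.le, Real.rpow_one, Real.rpow_one,
      Real.rpow_neg hD.le, Real.rpow_one]
    field_simp
  rw [e2, ofReal_pos_mul_cpow (by positivity), ← Complex.ofReal_cpow (by positivity),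
    Complex.real_smul, balancedIntegrand, ← e3]
  push_cast
  ring

lemma intervalIntegrable_abs_rpow {ν : ℝ} (h1 : -1 < ν) :
    IntervalIntegrable (fun Z : ℝ => |1 - 2 * Z| ^ ν) volume 0 1 := by
  have hp : IntervalIntegrable (fun x : ℝ => |x| ^ ν) volume 0 1 := by
    refine (intervalIntegral.intervalIntegrable_rpow' h1).congr ?_
    rw [uIoc_of_le zero_le_one]
    intro x hx
    simp only
    rw [abs_of_pos hx.1]
  have hn : IntervalIntegrable (fun x : ℝ => |x| ^ ν) volume (-1) 0 := by
    have := (IntervalIntegrable.iff_comp_neg (f := fun x : ℝ => |x| ^ ν) (a := 0) (b := 1)).1 hp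
    simpa using this.symm
  have := ((hn.trans hp).comp_sub_left 1).comp_mul_left (c := 2)
  norm_num at this
  exact this.symm

/-- A majorant for the balanced integrands. -/
noncomputable def balancedBound (ν m Z : ℝ) : ℝ :=
  m ^ (-1 - ν) * ((1 / 2) ^ ν * eulerWeight ν Z + 4 * |1 - 2 * Z| ^ ν)

lemma intervalIntegrable_balancedBound {ν : ℝ} (h1 : -1 < ν) (h0 : ν < 0) (m : ℝ) :
    IntervalIntegrable (balancedBound ν m) volume 0 1 :=
  (((intervalIntegrable_eulerWeight h1 h0).const_mul _).add
    ((intervalIntegrable_abs_rpow h1).const_mul _)).const_mul _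

lemma eulerWeight_le_four {ν : ℝ} (h1 : -1 < ν) (h0 : ν < 0) {Z : ℝ} (ha : 1 / 4 ≤ Z)
    (hb : Z ≤ 3 / 4) : eulerWeight ν Z ≤ 4 := by
  have e1 : Z ^ ν ≤ (1 / 4) ^ ν := Real.rpow_le_rpow_of_nonpos (by norm_num) ha h0.le
  have e2 : (1 - Z) ^ (-ν - 1) ≤ (1 / 4) ^ (-ν - 1) :=
    Real.rpow_le_rpow_of_nonpos (by norm_num) (by linarith) (by linarith)
  calc eulerWeight ν Z ≤ (1 / 4) ^ ν * (1 / 4) ^ (-ν - 1) :=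
        mul_le_mul e1 e2 (Real.rpow_nonneg (by linarith) _) (Real.rpow_nonneg (by norm_num) _)
    _ = (1 / 4 : ℝ) ^ (-1 : ℝ) := by
        rw [← Real.rpow_add (by norm_num), show ν + (-ν - 1) = -1 by ring]
    _ = 4 := by rw [Real.rpow_neg_one]; norm_num

/-- On the middle part of the interval the weight is bounded, elsewhere the power is. -/
lemma norm_balancedIntegrand_le {ν : ℝ} (h1 : -1 < ν) (h0 : ν < 0) {z : ℂ} {m : ℝ} (hm : 0 < m)
    (hm1 : m ≤ 1) (hmz : m ≤ ‖z‖) {Z : ℝ} (hZ0 : 0 ≤ Z) (hZ1 : Z ≤ 1) (hZ : Z ≠ 1 / 2) :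
    ‖balancedIntegrand ν z Z‖ ≤ balancedBound ν m Z := by
  have hw := eulerWeight_nonneg (ν := ν) hZ0 hZ1
  have hz : 0 < ‖z‖ := hm.trans_le hmz
  have hD : m ≤ Z + ‖z‖ * (1 - Z) := by nlinarith
  have hq : 0 < |1 - 2 * Z| := abs_pos.2 fun h => hZ (by linarith)
  have hlow : |1 - 2 * Z| ≤ ‖(1 - Z + z / (‖z‖ : ℂ) * Z : ℂ)‖ := by
    have e1 : ‖(1 - Z : ℂ)‖ = 1 - Z := by
      rw [← Complex.ofReal_one, ← Complex.ofReal_sub, Complex.norm_real, Real.norm_eq_abs,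
        abs_of_nonneg (by linarith)]
    have e2 : ‖z / (‖z‖ : ℂ) * Z‖ = Z := by
      rw [norm_mul, norm_div, Complex.norm_real, Complex.norm_real, norm_norm, div_self hz.ne',
        Real.norm_eq_abs, abs_of_nonneg hZ0, one_mul]
    have := abs_norm_sub_norm_le (1 - Z : ℂ) (-(z / (‖z‖ : ℂ) * Z))
    rw [norm_neg, e1, e2, sub_neg_eq_add] at this
    rwa [show 1 - 2 * Z = 1 - Z - Z by ring]
  have hpow : ‖(1 - Z + z / (‖z‖ : ℂ) * Z : ℂ) ^ (ν : ℂ)‖ ≤ |1 - 2 * Z| ^ ν := by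
    rw [Complex.norm_cpow_real]
    exact Real.rpow_le_rpow_of_nonpos hq hlow h0.le
  have hDp : (Z + ‖z‖ * (1 - Z)) ^ (-1 - ν) ≤ m ^ (-1 - ν) :=
    Real.rpow_le_rpow_of_nonpos hm hD (by linarith)
  have hDn : 0 ≤ (Z + ‖z‖ * (1 - Z)) ^ (-1 - ν) := Real.rpow_nonneg (hm.le.trans hD) _
  have hmn : 0 ≤ m ^ (-1 - ν) := Real.rpow_nonneg hm.le _
  have hqn : 0 ≤ |1 - 2 * Z| ^ ν := Real.rpow_nonneg hq.le _
  have hmain : eulerWeight ν Z * |1 - 2 * Z| ^ ν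
      ≤ (1 / 2) ^ ν * eulerWeight ν Z + 4 * |1 - 2 * Z| ^ ν := by
    rcases le_or_gt (1 / 2) |1 - 2 * Z| with h | h
    · have := Real.rpow_le_rpow_of_nonpos (by norm_num) h h0.le
      nlinarith [mul_le_mul_of_nonneg_left this hw]
    · rw [abs_lt] at h
      have := eulerWeight_le_four h1 h0 (Z := Z) (by linarith) (by linarith)
      have h2 : 0 ≤ (1 / 2 : ℝ) ^ ν * eulerWeight ν Z := by positivity
      nlinarith [mul_le_mul_of_nonneg_right this hqn]
  rw [balancedIntegrand, norm_mul, Complex.norm_real, Real.norm_eq_abs,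
    abs_of_nonneg (mul_nonneg hw hDn), balancedBound]
  calc eulerWeight ν Z * (Z + ‖z‖ * (1 - Z)) ^ (-1 - ν) *
        ‖(1 - Z + z / (‖z‖ : ℂ) * Z : ℂ) ^ (ν : ℂ)‖
      ≤ eulerWeight ν Z * m ^ (-1 - ν) * |1 - 2 * Z| ^ ν := by gcongr
    _ = m ^ (-1 - ν) * (eulerWeight ν Z * |1 - 2 * Z| ^ ν) := by ring
    _ ≤ _ := mul_le_mul_of_nonneg_left hmain hmn

lemma measurable_balancedIntegrand (ν : ℝ) (z : ℂ) : Measurable (balancedIntegrand ν z) := by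
  unfold balancedIntegrand eulerWeight
  fun_prop

lemma intervalIntegrable_balancedIntegrand {ν : ℝ} (h1 : -1 < ν) (h0 : ν < 0) {z : ℂ}
    (hz : z ≠ 0) : IntervalIntegrable (balancedIntegrand ν z) volume 0 1 := by
  refine (intervalIntegrable_balancedBound h1 h0 (min 1 ‖z‖)).mono_fun'
    (measurable_balancedIntegrand ν z).aestronglyMeasurable ?_
  rw [EventuallyLE, ae_restrict_iff' measurableSet_uIoc]
  filter_upwards [ae_ne_const (1 / 2)] with Z hZ hZ'
  rw [uIoc_of_le zero_le_one] at hZ'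
  exact norm_balancedIntegrand_le h1 h0 (lt_min one_pos (norm_pos_iff.2 hz)) (min_le_left _ _)
    (min_le_right _ _) hZ'.1.le hZ'.2 hZ

/-- Principal powers are continuous from above along the negative axis. -/
lemma continuousWithinAt_cpow_upper {w : ℂ} (hw : w ≠ 0) (c : ℂ) :
    ContinuousWithinAt (fun w => w ^ c) {w : ℂ | 0 ≤ w.im} w := by
  by_cases h : w ∈ Complex.slitPlane
  · exact (continuousAt_cpow_const h).continuousWithinAt
  · rw [Complex.mem_slitPlane_iff, not_or, not_lt, not_not] at h
    have hre : w.re < 0 := lt_of_le_of_ne h.1 fun h' => hw (Complex.ext h' h.2)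
    have hl := Complex.continuousWithinAt_log_of_re_neg_of_im_zero hre h.2
    have hexp : ContinuousWithinAt (fun w => Complex.exp (Complex.log w * c))
        {w : ℂ | 0 ≤ w.im} w := (hl.mul_const c).cexp
    refine hexp.congr_of_eventuallyEq ?_ (Complex.cpow_def_of_ne_zero hw c)
    filter_upwards [nhdsWithin_le_nhds (isOpen_ne.mem_nhds hw)] with v hv
    exact Complex.cpow_def_of_ne_zero hv c

/-- The Legendre function is continuous from above up to the cut. -/
lemma continuousWithinAt_shiftedP_upper {ν : ℝ} (h1 : -1 < ν) (h0 : ν < 0) {z : ℂ} (hz : z ≠ 0) :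
    ContinuousWithinAt (shiftedP ν) {z : ℂ | 0 ≤ z.im} z := by
  have hzn : 0 < ‖z‖ := norm_pos_iff.2 hz
  have hev : ∀ᶠ y in 𝓝[{z : ℂ | 0 ≤ z.im}] z, min 1 (‖z‖ / 2) ≤ ‖y‖ := by
    refine nhdsWithin_le_nhds ?_
    filter_upwards [continuous_norm.continuousAt.eventually_const_lt
      (show ‖z‖ / 2 < ‖z‖ by linarith)] with y hy
    exact (min_le_right _ _).trans hy.le
  have hm : 0 < min 1 (‖z‖ / 2) := lt_min one_pos (by linarith)
  have key : Tendsto (fun y => ∫ Z in (0 : ℝ)..1, balancedIntegrand ν y Z)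
      (𝓝[{z : ℂ | 0 ≤ z.im}] z) (𝓝 (∫ Z in (0 : ℝ)..1, balancedIntegrand ν z Z)) := by
    refine intervalIntegral.tendsto_integral_filter_of_dominated_convergence
      (balancedBound ν (min 1 (‖z‖ / 2))) ?_ ?_ (intervalIntegrable_balancedBound h1 h0 _) ?_
    · exact Eventually.of_forall fun y => (measurable_balancedIntegrand ν y).aestronglyMeasurable
    · filter_upwards [hev] with y hy
      filter_upwards [ae_ne_const (1 / 2)] with Z hZ hZ'
      rw [uIoc_of_le zero_le_one] at hZ'
      exact norm_balancedIntegrand_le h1 h0 hm (min_le_left _ _) hy hZ'.1.le hZ'.2 hZ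
    · filter_upwards [ae_ne_const (1 / 2)] with Z hZ hZ'
      rw [uIoc_of_le zero_le_one] at hZ'
      have hD := mobius_den_pos hzn hZ'.1.le hZ'.2
      have hne : (1 - Z + z / (‖z‖ : ℂ) * Z : ℂ) ≠ 0 := by
        intro h
        have e2 : ‖z / (‖z‖ : ℂ) * Z‖ = Z := by
          rw [norm_mul, norm_div, Complex.norm_real, Complex.norm_real, norm_norm,
            div_self hzn.ne', Real.norm_eq_abs, abs_of_nonneg hZ'.1.le, one_mul]
        have e3 : z / (‖z‖ : ℂ) * Z = ((Z - 1 : ℝ) : ℂ) := by push_cast; linear_combination h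
        rw [e3, Complex.norm_real, Real.norm_eq_abs, abs_of_nonpos (by linarith [hZ'.2])] at e2
        exact hZ (by linarith)
      have hnc : ContinuousAt (fun y : ℂ => (‖y‖ : ℂ)) z := by fun_prop
      have hnz : (‖z‖ : ℂ) ≠ 0 := by exact_mod_cast hzn.ne'
      refine Tendsto.mul ?_ ?_
      · refine tendsto_nhdsWithin_of_tendsto_nhds ?_
        refine (Complex.continuous_ofReal.tendsto _).comp ?_
        refine Tendsto.const_mul _ ?_
        have : ContinuousAt (fun y : ℂ => Z + ‖y‖ * (1 - Z)) z := by fun_prop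
        exact this.rpow_const (Or.inl hD.ne')
      · refine (continuousWithinAt_cpow_upper hne (ν : ℂ)).tendsto.comp ?_
        refine tendsto_nhdsWithin_iff.2 ⟨tendsto_nhdsWithin_of_tendsto_nhds ?_, ?_⟩
        · exact ContinuousAt.tendsto (f := fun y : ℂ => (1 - Z + y / (‖y‖ : ℂ) * Z : ℂ))
            (((continuousAt_id.div hnc hnz).mul_const _).const_add _)
        · filter_upwards [self_mem_nhdsWithin] with y hy
          have e : (1 - Z + y / (‖y‖ : ℂ) * Z : ℂ).im = y.im / ‖y‖ * Z := by
            simp [Complex.div_ofReal_im]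
          rw [e]
          exact mul_nonneg (div_nonneg hy (norm_nonneg _)) hZ'.1.le
  rw [ContinuousWithinAt, shiftedP_eq, eulerMoment_eq_balanced hz]
  refine (key.const_mul _).congr' ?_
  filter_upwards [hev] with y hy
  rw [shiftedP_eq, eulerMoment_eq_balanced (norm_pos_iff.1 (hm.trans_le hy))]

/-- On the cut the balanced integrand is positive for `Z < 1/2`, and a nonnegative multiple of
`exp (i π ν)`, with `cos (π ν) ≥ 0`, for `Z > 1/2`. -/
lemma re_shiftedP_pos_of_neg {ν : ℝ} (h1 : -(1 / 2) ≤ ν) (h0 : ν < 0) {z : ℂ} (him : z.im = 0)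
    (hre : z.re < 0) : 0 < (shiftedP ν z).re := by
  have h1' : -1 < ν := by linarith
  have hzx : z = (z.re : ℂ) := Complex.ext rfl (by simpa using him)
  have hz : z ≠ 0 := by rintro rfl; simp at hre
  have hnorm : ‖z‖ = -z.re := by rw [hzx, Complex.norm_real, Real.norm_eq_abs, abs_of_neg hre]; simp
  have hω : z / (‖z‖ : ℂ) = -1 := by
    rw [hnorm, Complex.ofReal_neg, ← hzx, div_neg, div_self hz]
  have hi := intervalIntegrable_balancedIntegrand h1' h0 hz
  have hval : ∀ Z : ℝ, (balancedIntegrand ν z Z).re = eulerWeight ν Z *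
      (Z + ‖z‖ * (1 - Z)) ^ (-1 - ν) * ((((1 - 2 * Z : ℝ) : ℂ) ^ (ν : ℂ)).re) := by
    intro Z
    rw [balancedIntegrand, hω, Complex.re_ofReal_mul]
    congr 3
    push_cast; ring
  have hp : 0 < ‖z‖ := norm_pos_iff.2 hz
  have ha : IntervalIntegrable (balancedIntegrand ν z) volume 0 (1 / 2) :=
    hi.mono_set (by rw [uIcc_of_le, uIcc_of_le] <;>
      [exact Icc_subset_Icc_right (by norm_num); norm_num; norm_num])
  have hb : IntervalIntegrable (balancedIntegrand ν z) volume (1 / 2) 1 :=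
    hi.mono_set (by rw [uIcc_of_le, uIcc_of_le] <;>
      [exact Icc_subset_Icc_left (by norm_num); norm_num; norm_num])
  rw [shiftedP_eq, ← Complex.ofReal_neg, Complex.re_ofReal_mul]
  refine mul_pos (neg_sin_div_pi_pos h1' h0) ?_
  rw [eulerMoment_eq_balanced hz, ← intervalIntegral.integral_add_adjacent_intervals ha hb,
    Complex.add_re]
  refine add_pos_of_pos_of_nonneg (re_integral_pos (by norm_num) ha ?_) ?_
  · rintro Z ⟨hZ0, hZ1⟩
    rw [hval]
    refine mul_pos (mul_pos (eulerWeight_pos hZ0 (by linarith))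
      (Real.rpow_pos_of_pos (mobius_den_pos hp hZ0.le (by linarith)) _)) (re_cpow_pos h1 h0 ?_)
    exact Complex.ofReal_mem_slitPlane.2 (by linarith)
  · have := Complex.reCLM.intervalIntegral_comp_comm hb
    simp only [Complex.reCLM_apply] at this
    rw [← this]
    refine intervalIntegral.integral_nonneg (by norm_num) fun Z hZ => ?_
    rw [hval]
    refine mul_nonneg (mul_nonneg (eulerWeight_nonneg (by linarith [hZ.1]) hZ.2)
      (Real.rpow_nonneg (mobius_den_pos hp (by linarith [hZ.1]) hZ.2).le _)) ?_
    rw [re_cpow_eq]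
    refine mul_nonneg (Real.rpow_nonneg (norm_nonneg _) _)
      (Real.cos_nonneg_of_mem_Icc ⟨?_, ?_⟩)
    all_goals
      have h2 := Complex.neg_pi_lt_arg ((1 - 2 * Z : ℝ) : ℂ)
      have h3 := Complex.arg_le_pi ((1 - 2 * Z : ℝ) : ℂ)
      have h4 : 0 ≤ (((1 - 2 * Z : ℝ) : ℂ)).arg := Complex.arg_nonneg_iff.2 (by simp)
      nlinarith [Real.pi_pos]

/-! ### The logarithmic singularity -/

/-- The function `(X^a - 1) / (1 - X)`. Its integral over `(0, 1)` is `-ψ(a + 1) - γ`. -/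
noncomputable def digammaKernel (a X : ℝ) : ℝ := (X ^ a - 1) / (1 - X)

lemma measurable_digammaKernel (a : ℝ) : Measurable (digammaKernel a) := by
  unfold digammaKernel
  fun_prop

lemma digammaKernel_nonneg {a X : ℝ} (h0 : a < 0) (hX0 : 0 < X) (hX1 : X ≤ 1) :
    0 ≤ digammaKernel a X :=
  div_nonneg (sub_nonneg.2 (Real.one_le_rpow_of_pos_of_le_one_of_nonpos hX0 hX1 h0.le))
    (by linarith)

lemma digammaKernel_le {a X : ℝ} (h1 : -1 < a) (hX0 : 0 < X) (hX1 : X < 1) :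
    digammaKernel a X ≤ X ^ a := by
  rw [digammaKernel, div_le_iff₀ (by linarith)]
  have h : X ≤ X ^ (-a) := by
    simpa using Real.rpow_le_rpow_of_exponent_ge hX0 hX1.le (show -a ≤ 1 by linarith)
  have hp := Real.rpow_pos_of_pos hX0 a
  have e : X ^ a * X ^ (-a) = 1 := by rw [← Real.rpow_add hX0]; simp
  nlinarith [mul_le_mul_of_nonneg_left h hp.le]

lemma intervalIntegrable_digammaKernel {a : ℝ} (h1 : -1 < a) (h0 : a < 0) :
    IntervalIntegrable (digammaKernel a) volume 0 1 := by
  refine (intervalIntegral.intervalIntegrable_rpow' h1).mono_fun'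
    (measurable_digammaKernel a).aestronglyMeasurable ?_
  rw [EventuallyLE, ae_restrict_iff' measurableSet_uIoc]
  filter_upwards [ae_ne_const 1] with X hX hX'
  rw [uIoc_of_le zero_le_one] at hX'
  rw [Real.norm_eq_abs, abs_of_nonneg (digammaKernel_nonneg h0 hX'.1 hX'.2)]
  exact digammaKernel_le h1 hX'.1 (lt_of_le_of_ne hX'.2 hX)

lemma tendsto_integral_digammaKernel_mul {a : ℝ} (h1 : -1 < a) (h0 : a < 0) (m : ℝ → ℝ → ℝ)
    (hm : ∀ t, Measurable (m t))
    (hb : ∀ t X : ℝ, 0 < t → 0 < X → X < 1 → |m t X| ≤ 1)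
    (hl : ∀ X : ℝ, 0 < X → X < 1 → Tendsto (fun t => m t X) (𝓝[>] 0) (𝓝 1)) :
    Tendsto (fun t => ∫ X in (0 : ℝ)..1, digammaKernel a X * m t X) (𝓝[>] 0)
      (𝓝 (∫ X in (0 : ℝ)..1, digammaKernel a X)) := by
  refine intervalIntegral.tendsto_integral_filter_of_dominated_convergence
    (digammaKernel a) ?_ ?_ (intervalIntegrable_digammaKernel h1 h0) ?_
  · exact Eventually.of_forall fun t =>
      ((measurable_digammaKernel a).mul (hm t)).aestronglyMeasurable
  · filter_upwards [self_mem_nhdsWithin] with t ht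
    filter_upwards [ae_ne_const 1] with X hX hX'
    rw [uIoc_of_le zero_le_one] at hX'
    have hn := digammaKernel_nonneg h0 hX'.1 hX'.2
    rw [norm_mul, Real.norm_eq_abs, Real.norm_eq_abs, abs_of_nonneg hn]
    exact mul_le_of_le_one_right hn (hb t X ht hX'.1 (lt_of_le_of_ne hX'.2 hX))
  · filter_upwards [ae_ne_const 1] with X hX hX'
    rw [uIoc_of_le zero_le_one] at hX'
    simpa using (hl X hX'.1 (lt_of_le_of_ne hX'.2 hX)).const_mul (digammaKernel a X)

lemma integral_inv_lin {t : ℝ} (h0 : 0 < t) (h1 : t < 1) :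
    ∫ W in (0 : ℝ)..1, 1 / (1 - W + t * W) = -Real.log t / (1 - t) := by
  have hpos : ∀ W ∈ Icc (0 : ℝ) 1, 0 < 1 - W + t * W := fun W hW => by nlinarith [hW.1, hW.2]
  have h1' : 1 - t ≠ 0 := by linarith
  have hd : ∀ W ∈ uIcc (0 : ℝ) 1, HasDerivAt (fun W => -Real.log (1 - W + t * W) / (1 - t))
      (1 / (1 - W + t * W)) W := by
    intro W hW
    rw [uIcc_of_le zero_le_one] at hW
    have hl : HasDerivAt (fun W : ℝ => 1 - W + t * W) (t - 1) W := by
      refine (((hasDerivAt_id W).const_sub 1).add ((hasDerivAt_id W).const_mul t)).congr_deriv ?_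
      ring
    have hne := (hpos W hW).ne'
    refine ((hl.log hne).neg.div_const (1 - t)).congr_deriv ?_
    field_simp
    ring
  rw [intervalIntegral.integral_eq_sub_of_hasDerivAt hd]
  · simp
  · refine ContinuousOn.intervalIntegrable ?_
    rw [uIcc_of_le zero_le_one]
    exact ContinuousOn.div (by fun_prop) (by fun_prop) fun W hW => (hpos W hW).ne'

lemma eulerMoment_ofReal {ν t : ℝ} (ht : 0 < t) :
    eulerMoment ν 0 ν (t : ℂ)
      = ((∫ X in (0 : ℝ)..1, eulerWeight ν X * (1 - X + t * X) ^ ν : ℝ) : ℂ) := by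
  rw [eulerMoment, ← intervalIntegral.integral_ofReal]
  refine intervalIntegral.integral_congr fun X hX => ?_
  rw [uIcc_of_le zero_le_one] at hX
  have : 0 ≤ 1 - X + t * X := by nlinarith [hX.1, hX.2, mul_nonneg ht.le hX.1]
  rw [Complex.ofReal_mul, Complex.ofReal_cpow this]
  push_cast
  ring

/-- Splitting off the singular part of the Euler integral at a small positive argument. The two
regular integrands are exchanged by the involution `X ↦ (1 - X) / (1 - X + t X)`. -/
lemma integral_eulerWeight_split {ν t : ℝ} (h1 : -1 < ν) (h0 : ν < 0) (ht0 : 0 < t) (ht1 : t < 1) :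
    ∫ X in (0 : ℝ)..1, eulerWeight ν X * (1 - X + t * X) ^ ν
      = (∫ X in (0 : ℝ)..1, digammaKernel ν X * ((1 - X + t * X) / (1 - X)) ^ ν)
        + (∫ X in (0 : ℝ)..1, digammaKernel (-ν - 1) X * ((1 - X) / (1 - X + t * X)))
        - Real.log t / (1 - t) := by
  have hpos : ∀ X ∈ Ioo (0 : ℝ) 1, 0 < 1 - X + t * X := fun X hX => by
    nlinarith [hX.1, hX.2, mul_pos ht0 hX.1]
  have hposI : ∀ X ∈ Icc (0 : ℝ) 1, 0 < 1 - X + t * X := fun W hW => by nlinarith [hW.1, hW.2]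
  have hcong : ∀ f g : ℝ → ℝ, (∀ X, 0 < X → X < 1 → f X = g X) →
      ∫ X in (0 : ℝ)..1, f X = ∫ X in (0 : ℝ)..1, g X := by
    intro f g h
    refine intervalIntegral.integral_congr_ae ?_
    filter_upwards [ae_ne_const 1] with X hX hX'
    rw [uIoc_of_le zero_le_one] at hX'
    exact h X hX'.1 (lt_of_le_of_ne hX'.2 hX)
  have i1 : IntervalIntegrable (fun X => digammaKernel ν X * ((1 - X + t * X) / (1 - X)) ^ ν)
      volume 0 1 := by
    refine (intervalIntegrable_digammaKernel h1 h0).mono_fun'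
      ((measurable_digammaKernel ν).mul (by fun_prop)).aestronglyMeasurable ?_
    rw [EventuallyLE, ae_restrict_iff' measurableSet_uIoc]
    filter_upwards [ae_ne_const 1] with X hX hX'
    rw [uIoc_of_le zero_le_one] at hX'
    have hX1 := lt_of_le_of_ne hX'.2 hX
    have hn := digammaKernel_nonneg h0 hX'.1 hX'.2
    have hge : 1 ≤ (1 - X + t * X) / (1 - X) := by
      rw [le_div_iff₀ (by linarith)]; nlinarith [mul_pos ht0 hX'.1]
    rw [norm_mul, Real.norm_eq_abs, Real.norm_eq_abs, abs_of_nonneg hn,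
      abs_of_nonneg (Real.rpow_nonneg (by linarith) _)]
    exact mul_le_of_le_one_right hn (Real.rpow_le_one_of_one_le_of_nonpos hge h0.le)
  have i0 : IntervalIntegrable (fun X => eulerWeight ν X * (1 - X + t * X) ^ ν) volume 0 1 := by
    refine (intervalIntegrable_eulerWeight h1 h0).mul_continuousOn ?_
    rw [uIcc_of_le zero_le_one]
    exact ContinuousOn.rpow_const (by fun_prop) fun X hX => Or.inl (hposI X hX).ne'
  have j2 : IntervalIntegrable (fun X : ℝ => 1 / (1 - X + t * X)) volume 0 1 := by
    refine ContinuousOn.intervalIntegrable ?_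
    rw [uIcc_of_le zero_le_one]
    exact ContinuousOn.div (by fun_prop) (by fun_prop) fun W hW => (hposI W hW).ne'
  have j1 : IntervalIntegrable (fun X => digammaKernel (-ν - 1) X * ((1 - X) / (1 - X + t * X)))
      volume 0 1 := by
    refine (intervalIntegrable_digammaKernel (by linarith) (by linarith)).mul_continuousOn ?_
    rw [uIcc_of_le zero_le_one]
    exact ContinuousOn.div (by fun_prop) (by fun_prop) fun W hW => (hposI W hW).ne'
  -- the part of the integrand that carries the logarithm
  have hB : (∫ X in (0 : ℝ)..1, eulerWeight ν X * (1 - X + t * X) ^ ν)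
      - ∫ X in (0 : ℝ)..1, digammaKernel ν X * ((1 - X + t * X) / (1 - X)) ^ ν
      = ∫ X in (0 : ℝ)..1, ((1 - X + t * X) / (1 - X)) ^ ν / (1 - X) := by
    rw [← intervalIntegral.integral_sub i0 i1]
    refine hcong _ _ fun X hX0 hX1 => ?_
    have hX1' : 0 < 1 - X := by linarith
    have := Real.rpow_pos_of_pos hX1' ν
    rw [Real.div_rpow (hpos X ⟨hX0, hX1⟩).le hX1'.le, eulerWeight, digammaKernel,
      Real.rpow_sub hX1', Real.rpow_neg hX1'.le, Real.rpow_one]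
    field_simp
    ring
  have hC : ∫ X in (0 : ℝ)..1, ((1 - X + t * X) / (1 - X)) ^ ν / (1 - X)
      = ∫ W in (0 : ℝ)..1, W ^ (-ν - 1) / (1 - W + t * W) := by
    rw [integral_comp_mobius ht0]
    have hrefl := intervalIntegral.integral_comp_sub_left (a := 0) (b := 1)
      (fun W : ℝ => W ^ (-ν - 1) / (1 - W + t * W)) 1
    rw [sub_self, sub_zero] at hrefl
    rw [← hrefl]
    refine hcong _ _ fun Z hZ0 hZ1 => ?_
    have hD := mobius_den_pos ht0 hZ0.le hZ1.le
    set D := Z + t * (1 - Z) with hDdef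
    have hZ1' : 0 < 1 - Z := by linarith
    have e1 : 1 - Z / D = t * (1 - Z) / D := by field_simp; rw [hDdef]; ring
    have e2 : (1 - Z / D + t * (Z / D)) / (1 - Z / D) = (1 - Z)⁻¹ := by
      rw [e1]; field_simp; ring
    have e3 : 1 - (1 - Z) + t * (1 - Z) = D := by rw [hDdef]; ring
    rw [e2, e1, e3, Real.inv_rpow hZ1'.le, Real.rpow_sub hZ1', Real.rpow_neg hZ1'.le,
      Real.rpow_one, smul_eq_mul]
    field_simp
  have hDd : ∫ W in (0 : ℝ)..1, W ^ (-ν - 1) / (1 - W + t * W)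
      = (∫ X in (0 : ℝ)..1, digammaKernel (-ν - 1) X * ((1 - X) / (1 - X + t * X)))
        - Real.log t / (1 - t) := by
    have := integral_inv_lin ht0 ht1
    rw [neg_div] at this
    rw [sub_eq_add_neg _ (Real.log t / (1 - t)), ← this, ← intervalIntegral.integral_add j1 j2]
    refine hcong _ _ fun X hX0 hX1 => ?_
    have hX1' : 1 - X ≠ 0 := by linarith
    have := (hpos X ⟨hX0, hX1⟩).ne'
    rw [digammaKernel]
    field_simp
    ring
  rw [hC, hDd] at hB
  linarith

/-- The constant term is `-ψ(ν + 1) - ψ(-ν) - 2γ`. -/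
lemma tendsto_eulerMoment_add_log {ν : ℝ} (h1 : -1 < ν) (h0 : ν < 0) :
    Tendsto (fun t : ℝ => (∫ X in (0 : ℝ)..1, eulerWeight ν X * (1 - X + t * X) ^ ν) + Real.log t)
      (𝓝[>] 0) (𝓝 ((∫ X in (0 : ℝ)..1, digammaKernel ν X)
        + ∫ X in (0 : ℝ)..1, digammaKernel (-ν - 1) X)) := by
  have hlin : ∀ X : ℝ, Tendsto (fun t : ℝ => 1 - X + t * X) (𝓝[>] 0) (𝓝 (1 - X)) := fun X => by
    have : ContinuousAt (fun t : ℝ => 1 - X + t * X) 0 := by fun_prop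
    simpa using this.tendsto.mono_left (nhdsWithin_le_nhds (s := Ioi 0))
  have a1 := tendsto_integral_digammaKernel_mul h1 h0
    (fun t X => ((1 - X + t * X) / (1 - X)) ^ ν) (fun t => by fun_prop) (by
      intro t X ht hX0 hX1
      have hge : 1 ≤ (1 - X + t * X) / (1 - X) := by
        rw [le_div_iff₀ (by linarith)]; nlinarith [mul_pos ht hX0]
      rw [abs_of_nonneg (Real.rpow_nonneg (by linarith) _)]
      exact Real.rpow_le_one_of_one_le_of_nonpos hge h0.le) (by
      intro X hX0 hX1
      have hX : 1 - X ≠ 0 := by linarith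
      have := ((hlin X).div_const (1 - X)).rpow_const (p := ν) (Or.inl (by simp [hX]))
      simpa [hX] using this)
  have a2 := tendsto_integral_digammaKernel_mul (a := -ν - 1) (by linarith) (by linarith)
    (fun t X => (1 - X) / (1 - X + t * X)) (fun t => by fun_prop) (by
      intro t X ht hX0 hX1
      have := mul_pos ht hX0
      rw [abs_of_nonneg (div_nonneg (by linarith) (by linarith))]
      exact (div_le_one (by linarith)).2 (by linarith)) (by
      intro X hX0 hX1
      have hX : 1 - X ≠ 0 := by linarith
      have := (tendsto_const_nhds (x := 1 - X)).div (hlin X) hX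
      rwa [div_self hX] at this)
  have a3 : Tendsto (fun t : ℝ => -(Real.log t * t) / (1 - t)) (𝓝[>] 0) (𝓝 0) := by
    have e1 : Tendsto (fun t : ℝ => Real.log t * t) (𝓝[>] 0) (𝓝 0) := by
      simpa using tendsto_log_mul_rpow_nhdsGT_zero one_pos
    have e2 : Tendsto (fun t : ℝ => 1 - t) (𝓝[>] 0) (𝓝 1) := by
      have : ContinuousAt (fun t : ℝ => 1 - t) 0 := by fun_prop
      simpa using this.tendsto.mono_left (nhdsWithin_le_nhds (s := Ioi 0))
    have := e1.neg.div e2 one_ne_zero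
    rwa [neg_zero, zero_div] at this
  have := (a1.add a2).add a3
  rw [add_zero] at this
  refine this.congr' ?_
  filter_upwards [Ioo_mem_nhdsGT (zero_lt_one' ℝ)] with t ht
  rw [integral_eulerWeight_split h1 h0 ht.1 ht.2]
  have : 1 - t ≠ 0 := by linarith [ht.2]
  have e : -(Real.log t * t) / (1 - t) = Real.log t - Real.log t / (1 - t) := by
    field_simp
    ring
  rw [e, ← add_sub_assoc, sub_add_eq_add_sub]

/-- If `ν = -1/m`, the substitution `v = X^(1/m)` makes the integrand rational. -/
lemma integral_digammaKernel_add {m : ℕ} (hm : 2 ≤ m) {ν : ℝ} (hν : ν = -1 / m) (Φ Φ' : ℝ → ℝ)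
    (hc : ContinuousOn Φ (Icc 0 1)) (hd : ∀ v ∈ Ioo (0 : ℝ) 1, HasDerivAt Φ (Φ' v) v)
    (h : ∀ v ∈ Ioo (0 : ℝ) 1,
      Φ' v * (v / v ^ m) / m * (1 - v ^ m) = v⁻¹ + v / v ^ m - 2) :
    (∫ X in (0 : ℝ)..1, digammaKernel ν X) + ∫ X in (0 : ℝ)..1, digammaKernel (-ν - 1) X
      = Φ 1 - Φ 0 := by
  have hm0 : (0 : ℝ) < m := by exact_mod_cast (by omega : 0 < m)
  have hm2 : (2 : ℝ) ≤ m := by exact_mod_cast hm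
  have h0 : ν < 0 := by rw [hν]; exact div_neg_of_neg_of_pos (by norm_num) hm0
  have h1 : -1 < ν := by
    rw [hν, lt_div_iff₀ hm0]; linarith
  have i1 := intervalIntegrable_digammaKernel h1 h0
  have i2 := intervalIntegrable_digammaKernel (a := -ν - 1) (by linarith) (by linarith)
  rw [← intervalIntegral.integral_add i1 i2]
  have hmaps : MapsTo (fun X : ℝ => X ^ (-ν)) (Icc 0 1) (Icc 0 1) := fun X hX =>
    ⟨Real.rpow_nonneg hX.1 _, Real.rpow_le_one hX.1 hX.2 (by linarith)⟩
  rw [intervalIntegral.integral_eq_sub_of_hasDerivAt_of_le (zero_le_one' ℝ)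
    (f := fun X => Φ (X ^ (-ν)))]
  · rw [Real.one_rpow, Real.zero_rpow (by linarith)]
  · exact hc.comp (Real.continuous_rpow_const (by linarith)).continuousOn hmaps
  · rintro X ⟨hX0, hX1⟩
    have hv0 : 0 < X ^ (-ν) := Real.rpow_pos_of_pos hX0 _
    have hv1 : X ^ (-ν) < 1 := Real.rpow_lt_one hX0.le hX1 (by linarith)
    refine ((hd _ ⟨hv0, hv1⟩).comp X
      (Real.hasDerivAt_rpow_const (p := -ν) (Or.inl hX0.ne'))).congr_deriv ?_
    have hvm : (X ^ (-ν)) ^ m = X := by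
      rw [← Real.rpow_natCast, ← Real.rpow_mul hX0.le, hν]
      rw [show -(-1 / (m : ℝ)) * m = 1 by field_simp, Real.rpow_one]
    have e1 : X ^ (-ν - 1) = X ^ (-ν) / X := by rw [Real.rpow_sub hX0, Real.rpow_one]
    have e2 : X ^ ν = (X ^ (-ν))⁻¹ := by rw [Real.rpow_neg hX0.le, inv_inv]
    have := h _ ⟨hv0, hv1⟩
    rw [hvm] at this
    have hX1' : 1 - X ≠ 0 := by linarith
    rw [digammaKernel, digammaKernel, e1, e2, ← add_div, eq_div_iff hX1']
    rw [show -ν = 1 / (m : ℝ) by rw [hν]; ring] at this ⊢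
    linear_combination this
  · exact i1.add i2

/-- The constant `K` in `X_ν(t) = t (1 - t) / K`. -/
noncomputable def seriesConst : Degree → ℝ
  | .half => 16
  | .third => 27
  | .quarter => 64
  | .sixth => 432

lemma seriesVar_eq (D : Degree) (t : ℂ) : seriesVar D t = t * (1 - t) / seriesConst D := by
  cases D <;> simp [seriesVar, seriesConst] <;> norm_num

/-- The values of the digamma function at `1/m` and `1 - 1/m` for `m = 2, 3, 4, 6`. -/
lemma integral_digammaKernel_eq_log (D : Degree) :
    (∫ X in (0 : ℝ)..1, digammaKernel D.nu X) + ∫ X in (0 : ℝ)..1, digammaKernel (-D.nu - 1) X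
      = Real.log (seriesConst D) := by
  have d1 : ∀ v : ℝ, v ∈ Ioo (0 : ℝ) 1 → HasDerivAt (fun v => Real.log (1 + v)) (1 / (1 + v)) v :=
    fun v hv => ((hasDerivAt_id v).const_add 1).log (by simp only [id]; linarith [hv.1])
  have q1 : ∀ v : ℝ, 0 < 1 + v + v ^ 2 := fun v => by nlinarith [sq_nonneg (v + 1 / 2)]
  have q2 : ∀ v : ℝ, 0 < 1 - v + v ^ 2 := fun v => by nlinarith [sq_nonneg (v - 1 / 2)]
  have q3 : ∀ v : ℝ, 0 < 1 + v ^ 2 := fun v => by positivity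
  have d2 : ∀ v : ℝ, HasDerivAt (fun v => Real.log (1 + v + v ^ 2))
      ((1 + 2 * v) / (1 + v + v ^ 2)) v := fun v => by
    refine ((((hasDerivAt_id v).const_add 1).add (hasDerivAt_pow 2 v)).log
      (q1 v).ne').congr_deriv ?_
    simp
  have d3 : ∀ v : ℝ, HasDerivAt (fun v => Real.log (1 - v + v ^ 2))
      ((-1 + 2 * v) / (1 - v + v ^ 2)) v := fun v => by
    refine ((((hasDerivAt_id v).const_sub 1).add (hasDerivAt_pow 2 v)).log
      (q2 v).ne').congr_deriv ?_
    simp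
  have d4 : ∀ v : ℝ, HasDerivAt (fun v => Real.log (1 + v ^ 2))
      (2 * v / (1 + v ^ 2)) v := fun v => by
    refine (((hasDerivAt_pow 2 v).const_add 1).log (q3 v).ne').congr_deriv ?_
    simp
  have c1 : ContinuousOn (fun v : ℝ => Real.log (1 + v)) (Icc 0 1) :=
    ContinuousOn.log (by fun_prop) fun v hv => by linarith [hv.1]
  have c2 : ContinuousOn (fun v : ℝ => Real.log (1 + v + v ^ 2)) (Icc 0 1) :=
    ContinuousOn.log (by fun_prop) fun v _ => (q1 v).ne'
  have c3 : ContinuousOn (fun v : ℝ => Real.log (1 - v + v ^ 2)) (Icc 0 1) :=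
    ContinuousOn.log (by fun_prop) fun v _ => (q2 v).ne'
  have c4 : ContinuousOn (fun v : ℝ => Real.log (1 + v ^ 2)) (Icc 0 1) :=
    ContinuousOn.log (by fun_prop) fun v _ => (q3 v).ne'
  -- Over `ℝ`, the factors of `1 - v ^ m` other than `1 - v` provide the antiderivative.
  cases D
  · rw [integral_digammaKernel_add (m := 2) le_rfl (by simp [Degree.nu])
      (fun v => 4 * Real.log (1 + v)) _ (continuousOn_const.mul c1)
      (fun v hv => (d1 v hv).const_mul 4)]
    · rw [seriesConst, show (16 : ℝ) = (1 + 1) ^ 4 by norm_num, Real.log_pow]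
      simp
    · intro v hv
      have h0 : v ≠ 0 := hv.1.ne'
      have h1 : 1 + v ≠ 0 := by linarith [hv.1]
      field_simp
      push_cast
      ring
  · rw [integral_digammaKernel_add (m := 3) (by norm_num) (by simp [Degree.nu])
      (fun v => 3 * Real.log (1 + v + v ^ 2)) _ (continuousOn_const.mul c2)
      (fun v hv => (d2 v).const_mul 3)]
    · rw [seriesConst, show (27 : ℝ) = (1 + 1 + 1 ^ 2) ^ 3 by norm_num, Real.log_pow]
      simp
    · intro v hv
      have h0 : v ≠ 0 := hv.1.ne'
      have h1 := (q1 v).ne'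
      field_simp
      push_cast
      ring
  · rw [integral_digammaKernel_add (m := 4) (by norm_num) (by simp [Degree.nu])
      (fun v => 4 * Real.log (1 + v) + 2 * Real.log (1 + v ^ 2)) _
      ((continuousOn_const.mul c1).add (continuousOn_const.mul c4))
      (fun v hv => ((d1 v hv).const_mul 4).add ((d4 v).const_mul 2))]
    · rw [seriesConst, show (64 : ℝ) = 2 ^ 6 by norm_num, Real.log_pow]
      norm_num
      ring
    · intro v hv
      have h0 : v ≠ 0 := hv.1.ne'
      have h1 : 1 + v ≠ 0 := by linarith [hv.1]
      have h2 := (q3 v).ne'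
      field_simp
      push_cast
      ring
  · rw [integral_digammaKernel_add (m := 6) (by norm_num) (by simp [Degree.nu])
      (fun v => 4 * Real.log (1 + v) + 3 * Real.log (1 + v + v ^ 2) + Real.log (1 - v + v ^ 2)) _
      (((continuousOn_const.mul c1).add (continuousOn_const.mul c2)).add c3)
      (fun v hv => (((d1 v hv).const_mul 4).add ((d2 v).const_mul 3)).add (d3 v))]
    · rw [seriesConst, show (432 : ℝ) = 2 ^ 4 * 3 ^ 3 by norm_num,
        Real.log_mul (by norm_num) (by norm_num), Real.log_pow, Real.log_pow]
      norm_num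
    · intro v hv
      have h0 : v ≠ 0 := hv.1.ne'
      have h1 : 1 + v ≠ 0 := by linarith [hv.1]
      have h2 := (q1 v).ne'
      have h3 := (q2 v).ne'
      field_simp
      push_cast
      ring

/-- Behaviour of the Legendre function near its logarithmic singularity. -/
lemma tendsto_shiftedP_sub_log {D : Degree} (h1 : -1 < D.nu) (h0 : D.nu < 0) :
    Tendsto (fun t : ℝ => shiftedP D.nu t - ((Real.sin (D.nu * Real.pi) / Real.pi : ℝ) : ℂ) *
      ((Real.log t - Real.log (seriesConst D) : ℝ) : ℂ)) (𝓝[>] 0) (𝓝 0) := by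
  have h := tendsto_eulerMoment_add_log h1 h0
  rw [integral_digammaKernel_eq_log] at h
  have h' := ((Complex.continuous_ofReal.tendsto _).comp (h.sub_const
    (Real.log (seriesConst D)))).const_mul (-((Real.sin (D.nu * Real.pi) / Real.pi : ℝ) : ℂ))
  rw [sub_self, Complex.ofReal_zero, mul_zero] at h'
  refine h'.congr' ?_
  filter_upwards [self_mem_nhdsWithin] with t ht
  rw [shiftedP_eq, eulerMoment_ofReal ht]
  simp only [Function.comp]
  push_cast
  ring

/-! ### Clausen's formula and its logarithmic companions -/

open PowerSeries in
/-- The Euler operator `θ = u d/du` on formal power series. -/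
noncomputable def theta : Derivation ℝ ℝ⟦X⟧ ℝ⟦X⟧ :=
  (PowerSeries.X : ℝ⟦X⟧) • PowerSeries.derivative ℝ

section Formal
open PowerSeries

lemma coeff_theta (f : ℝ⟦X⟧) (n : ℕ) : coeff n (theta f) = n * coeff n f := by
  rw [theta, Derivation.smul_apply, smul_eq_mul]
  cases n with
  | zero => simp
  | succ n => rw [coeff_succ_X_mul, coeff_derivative]; push_cast; ring

lemma theta_X : theta X = X := by
  simp [theta]

lemma theta_C (r : ℝ) : theta (C r) = 0 := by
  simp [theta]

lemma theta_mul (f g : ℝ⟦X⟧) : theta (f * g) = f * theta g + g * theta f := by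
  simp [Derivation.leibniz]

lemma theta_ofNat (n : ℕ) [n.AtLeastTwo] : theta (ofNat(n) : ℝ⟦X⟧) = 0 := by
  have : (ofNat(n) : ℝ⟦X⟧) = C (ofNat(n) : ℝ) := (map_ofNat (C (R := ℝ)) n).symm
  rw [this, theta_C]

lemma theta_one : theta 1 = 0 := by simp [theta]

lemma coeff_ofNat_mul (f : ℝ⟦X⟧) (k n : ℕ) [n.AtLeastTwo] :
    coeff k ((ofNat(n) : ℝ⟦X⟧) * f) = ofNat(n) * coeff k f := by
  have : (ofNat(n) : ℝ⟦X⟧) = C (ofNat(n) : ℝ) := (map_ofNat (C (R := ℝ)) n).symm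
  rw [this, coeff_C_mul]

/-- Four times the second-order hypergeometric operator `(1 - u) θ² - u (θ / 2 + κ / 4)`. For
`κ = -ν (ν + 1)` it annihilates `₂F₁(-ν/2, (ν + 1)/2; 1; u)`. -/
noncomputable def quadOp (κ : ℝ) (y : ℝ⟦X⟧) : ℝ⟦X⟧ :=
  4 * (1 - X) * theta (theta y) - X * (2 * theta y + C κ * y)

/-- Twice the third-order hypergeometric operator `θ³ - u (θ + 1/2) (θ² + θ + κ)`. -/
noncomputable def cubicOp (κ : ℝ) (y : ℝ⟦X⟧) : ℝ⟦X⟧ :=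
  2 * theta (theta (theta y)) - X * (2 * theta (theta (theta y)) + 3 * theta (theta y)
    + (1 + 2 * C κ) * theta y + C κ * y)

/-- The third-order operator is the symmetric square of the second-order one. -/
lemma cubicOp_mul (κ : ℝ) (x y : ℝ⟦X⟧) :
    2 * cubicOp κ (x * y) = y * theta (quadOp κ x) + x * theta (quadOp κ y)
      + 3 * theta y * quadOp κ x + 3 * theta x * quadOp κ y := by
  simp only [cubicOp, quadOp, theta_mul, map_add, map_sub, theta_X, theta_C, theta_one, theta_ofNat]
  ring

/-- Coefficients of the solution of `quadOp κ y = 0` that is regular at the origin. -/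
noncomputable def gCoeff (κ : ℝ) : ℕ → ℝ
  | 0 => 1
  | k + 1 => ((k : ℝ) ^ 2 + k / 2 + κ / 4) / ((k : ℝ) + 1) ^ 2 * gCoeff κ k

/-- Coefficients of the regular part of the logarithmic solution `g log u + j`. -/
noncomputable def jCoeff (κ : ℝ) : ℕ → ℝ
  | 0 => 0
  | k + 1 => (((k : ℝ) ^ 2 + k / 2 + κ / 4) * jCoeff κ k + (2 * k + 1 / 2) * gCoeff κ k
      - 2 * (k + 1) * gCoeff κ (k + 1)) / ((k : ℝ) + 1) ^ 2

/-- The polynomial `(k + 1/2) (k² + k + κ)`. -/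
noncomputable def cubicPoly (κ k : ℝ) : ℝ := (k + 1 / 2) * (k ^ 2 + k + κ)

/-- The first derivative of `cubicPoly`. -/
noncomputable def cubicPoly' (κ k : ℝ) : ℝ := 3 * k ^ 2 + 3 * k + 1 / 2 + κ

/-- The second derivative of `cubicPoly`. -/
noncomputable def cubicPoly'' (k : ℝ) : ℝ := 6 * k + 3

/-- Coefficients of Clausen's series `₃F₂(-ν, 1/2, ν + 1; 1, 1; u)`, with `κ = -ν (ν + 1)`. -/
noncomputable def aCoeff (κ : ℝ) : ℕ → ℝ
  | 0 => 1
  | k + 1 => cubicPoly κ k / ((k : ℝ) + 1) ^ 3 * aCoeff κ k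

/-- The logarithmic derivative of `a(k + ε) / a(ε)` with respect to `ε` at `ε = 0`, where `a`
satisfies the recurrence of `aCoeff`. -/
noncomputable def logCoeff (κ : ℝ) (k : ℕ) : ℝ :=
  ∑ i ∈ Finset.range k, (cubicPoly' κ i / cubicPoly κ i - 3 / ((i : ℝ) + 1))

/-- The second derivative of `log (a(k + ε) / a(ε))` with respect to `ε` at `ε = 0`. -/
noncomputable def logCoeff₂ (κ : ℝ) (k : ℕ) : ℝ :=
  ∑ i ∈ Finset.range k, (cubicPoly'' i / cubicPoly κ i - (cubicPoly' κ i / cubicPoly κ i) ^ 2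
    + 3 / ((i : ℝ) + 1) ^ 2)

lemma cubicPoly_pos {κ : ℝ} (hκ : 0 < κ) (k : ℕ) : 0 < cubicPoly κ k := by
  unfold cubicPoly; positivity

lemma gCoeff_succ (κ : ℝ) (k : ℕ) :
    ((k : ℝ) + 1) ^ 2 * gCoeff κ (k + 1) = ((k : ℝ) ^ 2 + k / 2 + κ / 4) * gCoeff κ k := by
  have : ((k : ℝ) + 1) ≠ 0 := by positivity
  rw [gCoeff]; field_simp

lemma jCoeff_succ (κ : ℝ) (k : ℕ) :
    ((k : ℝ) + 1) ^ 2 * jCoeff κ (k + 1) = ((k : ℝ) ^ 2 + k / 2 + κ / 4) * jCoeff κ k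
      + (2 * k + 1 / 2) * gCoeff κ k - 2 * (k + 1) * gCoeff κ (k + 1) := by
  have : ((k : ℝ) + 1) ≠ 0 := by positivity
  rw [jCoeff]; field_simp

lemma aCoeff_succ (κ : ℝ) (k : ℕ) :
    ((k : ℝ) + 1) ^ 3 * aCoeff κ (k + 1) = cubicPoly κ k * aCoeff κ k := by
  have : ((k : ℝ) + 1) ≠ 0 := by positivity
  rw [aCoeff]; field_simp

/-- The regular solution as a formal power series. -/
noncomputable def gSeries (κ : ℝ) : ℝ⟦X⟧ := PowerSeries.mk (gCoeff κ)

/-- The regular part of the logarithmic solution as a formal power series. -/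
noncomputable def jSeries (κ : ℝ) : ℝ⟦X⟧ := PowerSeries.mk (jCoeff κ)

lemma quadOp_gSeries (κ : ℝ) : quadOp κ (gSeries κ) = 0 := by
  ext n
  have e : quadOp κ (gSeries κ) = 4 * theta (theta (gSeries κ))
      - X * (4 * theta (theta (gSeries κ)) + (2 * theta (gSeries κ) + C κ * gSeries κ)) := by
    rw [quadOp]; ring
  rw [e, map_sub, coeff_ofNat_mul, coeff_theta, coeff_theta]
  cases n with
  | zero => simp
  | succ n =>
    rw [coeff_succ_X_mul, map_add, map_add, coeff_ofNat_mul, coeff_ofNat_mul, coeff_C_mul,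
      coeff_theta, coeff_theta]
    simp only [gSeries, coeff_mk, map_zero]
    have := gCoeff_succ κ n
    push_cast
    linear_combination 4 * this

/-- This inhomogeneous equation expresses that `g log u + j` is annihilated by `quadOp`. -/
lemma quadOp_jSeries (κ : ℝ) :
    quadOp κ (jSeries κ) = -8 * (1 - X) * theta (gSeries κ) + 2 * X * gSeries κ := by
  ext n
  have e : quadOp κ (jSeries κ) = 4 * theta (theta (jSeries κ))
      - X * (4 * theta (theta (jSeries κ)) + (2 * theta (jSeries κ) + C κ * jSeries κ)) := by
    rw [quadOp]; ring
  have e' : -8 * (1 - X) * theta (gSeries κ) + 2 * X * gSeries κ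
      = X * (8 * theta (gSeries κ) + 2 * gSeries κ) - 8 * theta (gSeries κ) := by ring
  rw [e, e', map_sub, map_sub, coeff_ofNat_mul, coeff_ofNat_mul, coeff_theta, coeff_theta,
    coeff_theta]
  cases n with
  | zero => simp
  | succ n =>
    rw [coeff_succ_X_mul, coeff_succ_X_mul, map_add, map_add, map_add, coeff_ofNat_mul,
      coeff_ofNat_mul, coeff_ofNat_mul, coeff_ofNat_mul, coeff_C_mul, coeff_theta, coeff_theta,
      coeff_theta]
    simp only [gSeries, jSeries, coeff_mk]
    have := jCoeff_succ κ n
    push_cast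
    linear_combination 4 * this

lemma two_mul_cancel {f g : ℝ⟦X⟧} (h : 2 * f = 2 * g) : f = g := by
  ext n
  have := congrArg (coeff n) h
  rw [coeff_ofNat_mul, coeff_ofNat_mul] at this
  linarith

lemma cubicOp_g_sq (κ : ℝ) : cubicOp κ (gSeries κ * gSeries κ) = 0 := by
  apply two_mul_cancel
  rw [cubicOp_mul, quadOp_gSeries]
  simp

/-- The right-hand side cancels what `cubicOp` applied to `g² log u` contributes besides
`log u * cubicOp (g²)`. -/
lemma cubicOp_g_mul_j (κ : ℝ) : cubicOp κ (gSeries κ * jSeries κ) =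
    X * (6 * theta (theta (gSeries κ * gSeries κ)) + 6 * theta (gSeries κ * gSeries κ)
      + (1 + 2 * C κ) * (gSeries κ * gSeries κ)) - 6 * theta (theta (gSeries κ * gSeries κ)) := by
  have hg := quadOp_gSeries κ
  apply two_mul_cancel
  rw [cubicOp_mul, quadOp_jSeries, hg]
  rw [quadOp] at hg
  generalize gSeries κ = g at *
  simp only [theta_mul, map_add, map_sub, map_neg, theta_X, theta_one, theta_ofNat, map_zero]
  linear_combination (4 * g) * hg

lemma cubicOp_j_sq (κ : ℝ) : cubicOp κ (jSeries κ * jSeries κ) =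
    X * (12 * theta (theta (gSeries κ * jSeries κ)) + 12 * theta (gSeries κ * jSeries κ)
      + (2 + 4 * C κ) * (gSeries κ * jSeries κ) + 12 * theta (gSeries κ * gSeries κ)
      + 6 * (gSeries κ * gSeries κ))
      - 12 * theta (theta (gSeries κ * jSeries κ)) - 12 * theta (gSeries κ * gSeries κ) := by
  have hg := quadOp_gSeries κ
  have hj := quadOp_jSeries κ
  apply two_mul_cancel
  rw [cubicOp_mul, hj]
  rw [quadOp] at hg hj
  generalize gSeries κ = g at *
  generalize jSeries κ = j at *
  simp only [theta_mul, map_add, map_sub, map_neg, theta_X, theta_one, theta_ofNat]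
  linear_combination (2 * j) * hg + (6 * g) * hj

lemma coeff_succ_cubicOp (κ : ℝ) (y : ℝ⟦X⟧) (n : ℕ) : coeff (n + 1) (cubicOp κ y)
    = 2 * (((n : ℝ) + 1) ^ 3 * coeff (n + 1) y - cubicPoly κ n * coeff n y) := by
  have e : cubicOp κ y = 2 * theta (theta (theta y)) - X * (2 * theta (theta (theta y)) +
      (3 * theta (theta y) + (theta y + 2 * (C κ * theta y)) + C κ * y)) := by
    rw [cubicOp]; ring
  rw [e, map_sub, coeff_succ_X_mul]
  simp only [map_add, coeff_ofNat_mul, coeff_C_mul, coeff_theta, cubicPoly]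
  push_cast
  ring

/-- Clausen's formula. -/
lemma coeff_g_sq (κ : ℝ) (n : ℕ) : coeff n (gSeries κ * gSeries κ) = aCoeff κ n := by
  induction n with
  | zero => simp [gSeries, gCoeff, aCoeff]
  | succ n ih =>
    have h := congrArg (coeff (n + 1)) (cubicOp_g_sq κ)
    rw [coeff_succ_cubicOp, ih, map_zero] at h
    have h2 := aCoeff_succ κ n
    have h3 : ((n : ℝ) + 1) ^ 3 ≠ 0 := by positivity
    apply mul_left_cancel₀ h3
    linarith

/-- The logarithmic companion of Clausen's formula. -/
lemma coeff_g_mul_j {κ : ℝ} (hκ : 0 < κ) (n : ℕ) :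
    coeff n (gSeries κ * jSeries κ) = aCoeff κ n * logCoeff κ n := by
  induction n with
  | zero => simp [gSeries, jSeries, jCoeff, logCoeff]
  | succ n ih =>
    have h := congrArg (coeff (n + 1)) (cubicOp_g_mul_j κ)
    have e : X * (6 * theta (theta (gSeries κ * gSeries κ)) + 6 * theta (gSeries κ * gSeries κ)
      + (1 + 2 * C κ) * (gSeries κ * gSeries κ)) - 6 * theta (theta (gSeries κ * gSeries κ))
      = X * (6 * theta (theta (gSeries κ * gSeries κ)) + 6 * theta (gSeries κ * gSeries κ)
      + (gSeries κ * gSeries κ + 2 * (C κ * (gSeries κ * gSeries κ))))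
        - 6 * theta (theta (gSeries κ * gSeries κ)) := by ring
    rw [e, coeff_succ_cubicOp, ih, map_sub, coeff_succ_X_mul] at h
    simp only [map_add, coeff_ofNat_mul, coeff_C_mul, coeff_theta, coeff_g_sq] at h
    have h2 := aCoeff_succ κ n
    have h3 : ((n : ℝ) + 1) ≠ 0 := by positivity
    have h4 := (cubicPoly_pos hκ n).ne'
    have h5 : logCoeff κ (n + 1)
        = logCoeff κ n + (cubicPoly' κ n / cubicPoly κ n - 3 / ((n : ℝ) + 1)) :=
      Finset.sum_range_succ _ _
    have h6 : ((n : ℝ) + 1) ^ 3 * (aCoeff κ (n + 1) * (cubicPoly' κ n / cubicPoly κ n))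
        = cubicPoly' κ n * aCoeff κ n := by
      rw [← mul_assoc, h2]; field_simp
    have h7 : ((n : ℝ) + 1) ^ 3 * (aCoeff κ (n + 1) * (3 / ((n : ℝ) + 1)))
        = 3 * ((n : ℝ) + 1) ^ 2 * aCoeff κ (n + 1) := by field_simp
    apply mul_left_cancel₀ (pow_ne_zero 3 h3)
    rw [h5]
    push_cast at h
    have h8 : cubicPoly' κ n = 3 * (n : ℝ) ^ 2 + 3 * n + 1 / 2 + κ := rfl
    rw [h8] at h6 ⊢
    linear_combination h / 2 - h6 + h7 - logCoeff κ n * h2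

/-- The doubly logarithmic companion of Clausen's formula. -/
lemma coeff_j_sq {κ : ℝ} (hκ : 0 < κ) (n : ℕ) :
    coeff n (jSeries κ * jSeries κ)
      = aCoeff κ n * (logCoeff κ n ^ 2 + logCoeff₂ κ n) := by
  induction n with
  | zero => simp [jSeries, jCoeff, logCoeff, logCoeff₂]
  | succ n ih =>
    have h := congrArg (coeff (n + 1)) (cubicOp_j_sq κ)
    generalize hA : gSeries κ * gSeries κ = A at h
    generalize hB : gSeries κ * jSeries κ = B at h
    have e : X * (12 * theta (theta B) + 12 * theta B + (2 + 4 * C κ) * B + 12 * theta A + 6 * A)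
        - 12 * theta (theta B) - 12 * theta A
      = X * (12 * theta (theta B) + 12 * theta B + (2 * B + 4 * (C κ * B)) + 12 * theta A + 6 * A)
        - 12 * theta (theta B) - 12 * theta A := by ring
    rw [e, coeff_succ_cubicOp, ih, map_sub, map_sub, coeff_succ_X_mul] at h
    simp only [map_add, coeff_ofNat_mul, coeff_C_mul, coeff_theta] at h
    rw [← hA, ← hB] at h
    simp only [coeff_g_sq, coeff_g_mul_j hκ] at h
    have h2 := aCoeff_succ κ n
    have h3 : ((n : ℝ) + 1) ≠ 0 := by positivity
    have h4 := (cubicPoly_pos hκ n).ne'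
    have h5 : logCoeff κ (n + 1)
        = logCoeff κ n + (cubicPoly' κ n / cubicPoly κ n - 3 / ((n : ℝ) + 1)) :=
      Finset.sum_range_succ _ _
    have h5' : logCoeff₂ κ (n + 1) = logCoeff₂ κ n + (cubicPoly'' n / cubicPoly κ n
        - (cubicPoly' κ n / cubicPoly κ n) ^ 2 + 3 / ((n : ℝ) + 1) ^ 2) :=
      Finset.sum_range_succ _ _
    have h9 : aCoeff κ (n + 1) = cubicPoly κ n * aCoeff κ n / ((n : ℝ) + 1) ^ 3 := by
      rw [eq_div_iff (pow_ne_zero 3 h3)]; linarith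
    apply mul_left_cancel₀ (pow_ne_zero 3 h3)
    have h10 : ((n : ℝ) + 1) ^ 3 * coeff (n + 1) (jSeries κ * jSeries κ)
        = cubicPoly κ n * (aCoeff κ n * (logCoeff κ n ^ 2 + logCoeff₂ κ n))
        + 2 * cubicPoly' κ n * (aCoeff κ n * logCoeff κ n) + cubicPoly'' n * aCoeff κ n
        - 6 * ((n : ℝ) + 1) ^ 2 * (aCoeff κ (n + 1) * logCoeff κ (n + 1))
        - 6 * ((n : ℝ) + 1) * aCoeff κ (n + 1) := by
      rw [cubicPoly', cubicPoly'']
      push_cast at h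
      linear_combination h / 2
    rw [h10, h5', h5, h9]
    field_simp
    ring

/-- The Wronskian `g θ(g log u + j) - (g log u + j) θ g`, from which the logarithm drops out. -/
noncomputable def wSeries (κ : ℝ) : ℝ⟦X⟧ :=
  gSeries κ * theta (jSeries κ) - jSeries κ * theta (gSeries κ) + gSeries κ * gSeries κ

/-- Abel's identity; the solution is `(1 - u) ^ (-1/2)`. -/
lemma theta_wSeries (κ : ℝ) : 2 * (1 - X) * theta (wSeries κ) = X * wSeries κ := by
  have hg := quadOp_gSeries κ
  have hj := quadOp_jSeries κ
  apply two_mul_cancel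
  rw [wSeries]
  rw [quadOp] at hg hj
  generalize gSeries κ = g at *
  generalize jSeries κ = j at *
  simp only [theta_mul, map_add, map_sub]
  linear_combination g * hj - j * hg

lemma coeff_wSeries_succ (κ : ℝ) (n : ℕ) :
    ((n : ℝ) + 1) * coeff (n + 1) (wSeries κ) = (n + 1 / 2) * coeff n (wSeries κ) := by
  have h := congrArg (coeff (n + 1)) (theta_wSeries κ)
  have e : 2 * (1 - X) * theta (wSeries κ)
      = 2 * theta (wSeries κ) - X * (2 * theta (wSeries κ)) := by ring
  rw [e, map_sub, coeff_succ_X_mul, coeff_succ_X_mul, coeff_ofNat_mul, coeff_ofNat_mul,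
    coeff_theta, coeff_theta] at h
  push_cast at h
  linear_combination h / 2

lemma coeff_wSeries_zero (κ : ℝ) : coeff 0 (wSeries κ) = 1 := by
  rw [wSeries, map_add, map_sub, coeff_mul, coeff_mul, coeff_mul]
  simp only [Finset.Nat.antidiagonal_zero, Finset.sum_singleton, coeff_theta]
  simp [gSeries, gCoeff]

end Formal

/-! ### Power series on the open unit disc -/

/-- A sequence whose power series converges absolutely on the open unit disc. -/
def Tame (c : ℕ → ℂ) : Prop := ∀ r : ℝ, 0 ≤ r → r < 1 → Summable fun k => ‖c k‖ * r ^ k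

/-- The sum of a power series. -/
noncomputable def powerSum (c : ℕ → ℂ) (u : ℂ) : ℂ := ∑' k, c k * u ^ k

lemma Tame.summable_norm {c : ℕ → ℂ} (h : Tame c) {u : ℂ} (hu : ‖u‖ < 1) :
    Summable fun k => ‖c k * u ^ k‖ := by
  simpa using h ‖u‖ (norm_nonneg _) hu

lemma Tame.summable {c : ℕ → ℂ} (h : Tame c) {u : ℂ} (hu : ‖u‖ < 1) :
    Summable fun k => c k * u ^ k := (h.summable_norm hu).of_norm

lemma Tame.of_isBigO {c : ℕ → ℂ} (m : ℕ) (h : c =O[atTop] fun k => ((k : ℝ) ^ m)) : Tame c := by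
  intro r h0 h1
  have hs := summable_pow_mul_geometric_of_norm_lt_one m
    (r := r) (by rwa [Real.norm_eq_abs, abs_of_nonneg h0])
  refine summable_of_isBigO_nat hs ?_
  exact h.norm_left.mul (isBigO_refl (fun k => r ^ k) _)

lemma Tame.of_le {c : ℕ → ℂ} {C : ℝ} (h : ∀ k, ‖c k‖ ≤ C * k + C) : Tame c := by
  refine Tame.of_isBigO 1 (IsBigO.of_bound (2 * |C|) ?_)
  filter_upwards [eventually_ge_atTop 1] with k hk
  have hk1 : (1 : ℝ) ≤ k := by exact_mod_cast hk
  rw [pow_one, Real.norm_eq_abs, abs_of_nonneg (by linarith : (0 : ℝ) ≤ k)]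
  have := le_abs_self C
  have := abs_nonneg C
  nlinarith [h k]

lemma Tame.add {c d : ℕ → ℂ} (hc : Tame c) (hd : Tame d) : Tame fun k => c k + d k := by
  intro r h0 h1
  refine Summable.of_nonneg_of_le (fun k => by positivity) (fun k => ?_)
    ((hc r h0 h1).add (hd r h0 h1))
  rw [← add_mul]
  exact mul_le_mul_of_nonneg_right (norm_add_le _ _) (by positivity)

lemma Tame.const_mul {c : ℕ → ℂ} (hc : Tame c) (a : ℂ) : Tame fun k => a * c k := by
  intro r h0 h1
  simpa [mul_assoc] using (hc r h0 h1).mul_left ‖a‖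

lemma Tame.nat_mul {c : ℕ → ℂ} (hc : Tame c) : Tame fun k => k * c k := by
  intro r h0 h1
  obtain ⟨s, hrs, hs1⟩ := exists_between h1
  have hs0 : 0 < s := h0.trans_lt hrs
  have hlim := (hc s hs0.le hs1).tendsto_atTop_zero
  have hq : ‖r / s‖ < 1 := by
    rw [Real.norm_eq_abs, abs_of_nonneg (by positivity)]; exact (div_lt_one hs0).2 hrs
  have hs := summable_pow_mul_geometric_of_norm_lt_one 1 hq
  refine summable_of_isBigO_nat hs ?_
  have e : (fun k : ℕ => ‖(k : ℂ) * c k‖ * r ^ k)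
      = fun k : ℕ => (‖c k‖ * s ^ k) * ((k : ℝ) ^ 1 * (r / s) ^ k) := by
    funext k
    rw [norm_mul, Complex.norm_natCast, div_pow]
    field_simp
  rw [e]
  simpa only [one_mul] using
    (hlim.isBigO_one ℝ).mul (isBigO_refl (fun k : ℕ => (k : ℝ) ^ 1 * (r / s) ^ k) _)

lemma Tame.shift {c : ℕ → ℂ} (hc : Tame c) : Tame fun k => c (k + 1) := by
  intro r h0 h1
  obtain ⟨s, hrs, hs1⟩ := exists_between h1
  have hs0 : 0 < s := h0.trans_lt hrs
  have := ((summable_nat_add_iff 1).2 (hc s hs0.le hs1)).mul_left s⁻¹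
  refine Summable.of_nonneg_of_le (fun k => by positivity) (fun k => ?_) this
  have e : s⁻¹ * (‖c (k + 1)‖ * s ^ (k + 1)) = ‖c (k + 1)‖ * s ^ k := by
    rw [pow_succ]; field_simp
  rw [e]
  exact mul_le_mul_of_nonneg_left (pow_le_pow_left₀ h0 hrs.le k) (norm_nonneg _)

/-- Coefficients of the derivative of a power series. -/
noncomputable def derivCoeff (c : ℕ → ℂ) (k : ℕ) : ℂ := (k + 1) * c (k + 1)

lemma Tame.derivCoeff {c : ℕ → ℂ} (hc : Tame c) : Tame (derivCoeff c) := by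
  have := hc.nat_mul.shift
  have e : RamanujanSun.derivCoeff c = fun k : ℕ => ((k + 1 : ℕ) : ℂ) * c (k + 1) := by
    funext k; simp [RamanujanSun.derivCoeff]
  rwa [e]

lemma hasDerivAt_powerSum {c : ℕ → ℂ} (hc : Tame c) {u : ℂ} (hu : ‖u‖ < 1) :
    HasDerivAt (powerSum c) (powerSum (derivCoeff c) u) u := by
  obtain ⟨s, hus, hs1⟩ := exists_between hu
  have hs0 : 0 < s := (norm_nonneg _).trans_lt hus
  have hsum : Summable fun k : ℕ => ‖(k : ℂ) * c k‖ * s ^ (k - 1) := by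
    rw [← summable_nat_add_iff 1]
    simpa [RamanujanSun.derivCoeff] using hc.derivCoeff s hs0.le hs1
  have key := hasDerivAt_tsum_of_isPreconnected (𝕜 := ℂ) (F := ℂ)
    (g := fun k z => c k * z ^ k) (g' := fun k z => c k * ((k : ℂ) * z ^ (k - 1)))
    (t := Metric.ball 0 s) (y₀ := 0) (y := u) hsum Metric.isOpen_ball
    (convex_ball (0 : ℂ) s).isPreconnected (fun k z _ => (hasDerivAt_pow k z).const_mul (c k))
    (fun k z hz => by
      rw [← mul_assoc, mul_comm (c k), norm_mul, norm_pow]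
      rw [mem_ball_zero_iff] at hz
      gcongr) (by simpa using hs0) (hc.summable (by simp)) (by simpa using hus)
  refine key.congr_deriv ?_
  have h1 : Summable fun k : ℕ => c k * ((k : ℂ) * u ^ (k - 1)) := by
    rw [← summable_nat_add_iff 1]
    refine (hc.derivCoeff.summable hu).congr fun k => ?_
    simp only [RamanujanSun.derivCoeff, Nat.cast_add, Nat.cast_one, add_tsub_cancel_right]
    ring
  rw [h1.tsum_eq_zero_add, powerSum]
  simp only [RamanujanSun.derivCoeff, Nat.cast_zero, zero_mul, mul_zero, zero_add, Nat.cast_add,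
    Nat.cast_one, add_tsub_cancel_right]
  exact tsum_congr fun k => by ring

lemma powerSum_nat_mul {c : ℕ → ℂ} (hc : Tame c) {u : ℂ} (hu : ‖u‖ < 1) :
    powerSum (fun k => k * c k) u = u * powerSum (derivCoeff c) u := by
  have h := hc.nat_mul.summable hu
  rw [powerSum, h.tsum_eq_zero_add, powerSum, ← tsum_mul_left]
  simp only [Nat.cast_zero, zero_mul, zero_add, derivCoeff]
  exact tsum_congr fun k => by push_cast; ring

lemma powerSum_add {c d : ℕ → ℂ} (hc : Tame c) (hd : Tame d) {u : ℂ} (hu : ‖u‖ < 1) :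
    powerSum (fun k => c k + d k) u = powerSum c u + powerSum d u := by
  rw [powerSum, powerSum, powerSum, ← (hc.summable hu).tsum_add (hd.summable hu)]
  exact tsum_congr fun k => by ring

lemma powerSum_const_mul (c : ℕ → ℂ) (a u : ℂ) :
    powerSum (fun k => a * c k) u = a * powerSum c u := by
  rw [powerSum, powerSum, ← tsum_mul_left]
  exact tsum_congr fun k => by ring

lemma powerSum_zero (c : ℕ → ℂ) : powerSum c 0 = c 0 := by
  rw [powerSum, tsum_eq_single 0]
  · simp
  · intro k hk; simp [hk]

/-- The coefficients of a real formal power series, as complex numbers. -/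
noncomputable def ofRealCoeff (f : PowerSeries ℝ) (k : ℕ) : ℂ := ((PowerSeries.coeff k f : ℝ) : ℂ)

lemma ofRealCoeff_mul_mul_pow (f g : PowerSeries ℝ) (u : ℂ) (n : ℕ) :
    ofRealCoeff (f * g) n * u ^ n = ∑ p ∈ Finset.HasAntidiagonal.antidiagonal n,
      ofRealCoeff f p.1 * u ^ p.1 * (ofRealCoeff g p.2 * u ^ p.2) := by
  rw [ofRealCoeff, PowerSeries.coeff_mul, Complex.ofReal_sum, Finset.sum_mul]
  refine Finset.sum_congr rfl fun p hp => ?_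
  rw [← Finset.HasAntidiagonal.mem_antidiagonal.1 hp, pow_add, ofRealCoeff, ofRealCoeff]
  push_cast
  ring

lemma Tame.ofRealCoeff_mul {f g : PowerSeries ℝ} (hf : Tame (ofRealCoeff f))
    (hg : Tame (ofRealCoeff g)) : Tame (ofRealCoeff (f * g)) := by
  intro r h0 h1
  have hr : ‖(r : ℂ)‖ < 1 := by rwa [Complex.norm_real, Real.norm_eq_abs, abs_of_nonneg h0]
  refine (summable_norm_sum_mul_antidiagonal_of_summable_norm (hf.summable_norm hr)
      (hg.summable_norm hr)).congr fun n => ?_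
  rw [← ofRealCoeff_mul_mul_pow, norm_mul, norm_pow, Complex.norm_real, Real.norm_eq_abs,
    abs_of_nonneg h0]

/-- Products of formal power series evaluate to products of sums. -/
lemma powerSum_ofRealCoeff_mul {f g : PowerSeries ℝ} (hf : Tame (ofRealCoeff f))
    (hg : Tame (ofRealCoeff g)) {u : ℂ} (hu : ‖u‖ < 1) :
    powerSum (ofRealCoeff f) u * powerSum (ofRealCoeff g) u
      = powerSum (ofRealCoeff (f * g)) u := by
  rw [powerSum, powerSum, tsum_mul_tsum_eq_tsum_sum_antidiagonal_of_summable_norm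
    (hf.summable_norm hu) (hg.summable_norm hu), powerSum]
  exact tsum_congr fun n => (ofRealCoeff_mul_mul_pow f g u n).symm

/-! ### Solutions of the hypergeometric equation on the unit disc -/

lemma abs_gCoeff_le {κ : ℝ} (h0 : 0 < κ) (h1 : κ ≤ 1 / 4) (k : ℕ) : |gCoeff κ k| ≤ 1 := by
  induction k with
  | zero => simp [gCoeff]
  | succ k ih =>
    have hk : (0 : ℝ) ≤ k := k.cast_nonneg
    rw [gCoeff, abs_mul, abs_of_nonneg (by positivity)]
    refine mul_le_one₀ ((div_le_one (by positivity)).2 (by nlinarith)) (abs_nonneg _) ih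

lemma abs_jCoeff_le {κ : ℝ} (h0 : 0 < κ) (h1 : κ ≤ 1 / 4) (k : ℕ) : |jCoeff κ k| ≤ 4 * k := by
  induction k with
  | zero => simp [jCoeff]
  | succ k ih =>
    have hk : (0 : ℝ) ≤ k := k.cast_nonneg
    have h2 := abs_gCoeff_le h0 h1 k
    have h3 := abs_gCoeff_le h0 h1 (k + 1)
    rw [jCoeff, abs_div, abs_of_nonneg (by positivity : (0 : ℝ) ≤ ((k : ℝ) + 1) ^ 2),
      div_le_iff₀ (by positivity)]
    push_cast
    rw [abs_le] at ih h2 h3 ⊢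
    have hp : 0 ≤ (k : ℝ) ^ 2 + k / 2 + κ / 4 := by positivity
    have hq : (k : ℝ) ^ 2 + k / 2 + κ / 4 ≤ ((k : ℝ) + 1) ^ 2 := by nlinarith
    have a1 : ((k : ℝ) ^ 2 + k / 2 + κ / 4) * jCoeff κ k ≤ ((k : ℝ) + 1) ^ 2 * (4 * k) := by
      nlinarith [mul_le_mul_of_nonneg_left ih.2 hp]
    have a2 : -(((k : ℝ) + 1) ^ 2 * (4 * k)) ≤ ((k : ℝ) ^ 2 + k / 2 + κ / 4) * jCoeff κ k := by
      nlinarith [mul_le_mul_of_nonneg_left ih.1 hp]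
    constructor <;> nlinarith

lemma abs_coeff_wSeries_le (κ : ℝ) (k : ℕ) : |PowerSeries.coeff k (wSeries κ)| ≤ 1 := by
  induction k with
  | zero => rw [coeff_wSeries_zero, abs_one]
  | succ k ih =>
    have hk : (0 : ℝ) ≤ k := k.cast_nonneg
    have h := congrArg abs (coeff_wSeries_succ κ k)
    rw [abs_mul, abs_mul, abs_of_nonneg (by positivity : (0 : ℝ) ≤ (k : ℝ) + 1),
      abs_of_nonneg (by positivity : (0 : ℝ) ≤ (k : ℝ) + 1 / 2)] at h
    nlinarith

/-- The regular solution of the hypergeometric equation in `u`. -/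
noncomputable def gFun (κ : ℝ) : ℂ → ℂ := powerSum fun k => (gCoeff κ k : ℂ)

/-- The regular part of the logarithmic solution. -/
noncomputable def jFun (κ : ℝ) : ℂ → ℂ := powerSum fun k => (jCoeff κ k : ℂ)

/-- The Wronskian series. -/
noncomputable def wFun (κ : ℝ) : ℂ → ℂ := powerSum (ofRealCoeff (wSeries κ))

lemma tame_gCoeff {κ : ℝ} (h0 : 0 < κ) (h1 : κ ≤ 1 / 4) : Tame fun k => (gCoeff κ k : ℂ) :=
  Tame.of_le (C := 1) fun k => by
    rw [Complex.norm_real, Real.norm_eq_abs]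
    have : (0 : ℝ) ≤ k := k.cast_nonneg
    linarith [abs_gCoeff_le h0 h1 k]

lemma tame_jCoeff {κ : ℝ} (h0 : 0 < κ) (h1 : κ ≤ 1 / 4) : Tame fun k => (jCoeff κ k : ℂ) :=
  Tame.of_le (C := 4) fun k => by
    rw [Complex.norm_real, Real.norm_eq_abs]
    linarith [abs_jCoeff_le h0 h1 k]

lemma tame_wSeries (κ : ℝ) : Tame (ofRealCoeff (wSeries κ)) :=
  Tame.of_le (C := 1) fun k => by
    rw [ofRealCoeff, Complex.norm_real, Real.norm_eq_abs]
    have : (0 : ℝ) ≤ k := k.cast_nonneg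
    linarith [abs_coeff_wSeries_le κ k]

/-- The derivative of `gFun`. -/
noncomputable def gFun' (κ : ℝ) : ℂ → ℂ := powerSum (derivCoeff fun k => (gCoeff κ k : ℂ))

/-- The derivative of `jFun`. -/
noncomputable def jFun' (κ : ℝ) : ℂ → ℂ := powerSum (derivCoeff fun k => (jCoeff κ k : ℂ))

lemma hasDerivAt_gFun {κ : ℝ} (h0 : 0 < κ) (h1 : κ ≤ 1 / 4) {u : ℂ} (hu : ‖u‖ < 1) :
    HasDerivAt (gFun κ) (gFun' κ u) u := hasDerivAt_powerSum (tame_gCoeff h0 h1) hu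

lemma hasDerivAt_jFun {κ : ℝ} (h0 : 0 < κ) (h1 : κ ≤ 1 / 4) {u : ℂ} (hu : ‖u‖ < 1) :
    HasDerivAt (jFun κ) (jFun' κ u) u := hasDerivAt_powerSum (tame_jCoeff h0 h1) hu

lemma gFun_zero (κ : ℝ) : gFun κ 0 = 1 := by simp [gFun, powerSum_zero, gCoeff]

lemma jFun_zero (κ : ℝ) : jFun κ 0 = 0 := by simp [jFun, powerSum_zero, jCoeff]

/-- The hypergeometric equation for `gFun`, in the form `4 (1 - u) (u g')' = 2 u g' + κ g`. -/
lemma exists_hasDerivAt_theta_gFun {κ : ℝ} (h0 : 0 < κ) (h1 : κ ≤ 1 / 4) {u : ℂ} (hu : ‖u‖ < 1) :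
    ∃ d, HasDerivAt (fun u => u * gFun' κ u) d u ∧
      4 * (1 - u) * d = 2 * (u * gFun' κ u) + κ * gFun κ u := by
  have ht := tame_gCoeff h0 h1
  have hev : (powerSum fun k => k * (gCoeff κ k : ℂ)) =ᶠ[𝓝 u] fun u => u * gFun' κ u := by
    filter_upwards [continuous_norm.continuousAt.eventually_lt_const hu] with v hv
    exact powerSum_nat_mul ht hv
  refine ⟨_, (hasDerivAt_powerSum ht.nat_mul hu).congr_of_eventuallyEq hev.symm, ?_⟩
  have e1 := powerSum_nat_mul ht hu
  have e2 := powerSum_nat_mul ht.nat_mul hu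
  have t0 := ht.const_mul κ
  have t1 := ht.nat_mul.const_mul 2
  have t2 := ht.nat_mul.nat_mul.const_mul 4
  have key : 4 * powerSum (derivCoeff fun k => (k : ℂ) * (gCoeff κ k : ℂ)) u
      = 4 * powerSum (fun k => (k : ℂ) * ((k : ℂ) * (gCoeff κ k : ℂ))) u
        + 2 * powerSum (fun k => (k : ℂ) * (gCoeff κ k : ℂ)) u
        + κ * powerSum (fun k => (gCoeff κ k : ℂ)) u := by
    rw [← powerSum_const_mul, ← powerSum_const_mul, ← powerSum_const_mul, ← powerSum_const_mul,
      ← powerSum_add t2 t1 hu, ← powerSum_add (t2.add t1) t0 hu]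
    congr 1
    funext k
    have h := congrArg (fun x : ℝ => (x : ℂ)) (gCoeff_succ κ k)
    push_cast at h
    simp only [derivCoeff]
    push_cast
    linear_combination 4 * h
  have e3 : u * gFun' κ u = powerSum (fun k => (k : ℂ) * (gCoeff κ k : ℂ)) u := e1.symm
  rw [e3, gFun]
  linear_combination key + 4 * e2

lemma ofRealCoeff_gSeries (κ : ℝ) : ofRealCoeff (gSeries κ) = fun k => (gCoeff κ k : ℂ) := by
  funext k; simp [ofRealCoeff, gSeries]

lemma ofRealCoeff_jSeries (κ : ℝ) : ofRealCoeff (jSeries κ) = fun k => (jCoeff κ k : ℂ) := by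
  funext k; simp [ofRealCoeff, jSeries]

lemma ofRealCoeff_theta (f : PowerSeries ℝ) :
    ofRealCoeff (theta f) = fun k : ℕ => (k : ℂ) * ofRealCoeff f k := by
  funext k; simp [ofRealCoeff, coeff_theta]

lemma wFun_eq {κ : ℝ} (h0 : 0 < κ) (h1 : κ ≤ 1 / 4) {u : ℂ} (hu : ‖u‖ < 1) :
    wFun κ u = gFun κ u * (u * jFun' κ u) - jFun κ u * (u * gFun' κ u) + gFun κ u ^ 2 := by
  have tg : Tame (ofRealCoeff (gSeries κ)) := by
    rw [ofRealCoeff_gSeries]; exact tame_gCoeff h0 h1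
  have tj : Tame (ofRealCoeff (jSeries κ)) := by
    rw [ofRealCoeff_jSeries]; exact tame_jCoeff h0 h1
  have tθg : Tame (ofRealCoeff (theta (gSeries κ))) := by
    rw [ofRealCoeff_theta]; exact tg.nat_mul
  have tθj : Tame (ofRealCoeff (theta (jSeries κ))) := by
    rw [ofRealCoeff_theta]; exact tj.nat_mul
  have p1 := powerSum_ofRealCoeff_mul tg tθj hu
  have p2 := powerSum_ofRealCoeff_mul tj tθg hu
  have p3 := powerSum_ofRealCoeff_mul tg tg hu
  have e : ofRealCoeff (wSeries κ) = fun k => (ofRealCoeff (gSeries κ * theta (jSeries κ)) k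
      + -1 * ofRealCoeff (jSeries κ * theta (gSeries κ)) k)
      + ofRealCoeff (gSeries κ * gSeries κ) k := by
    funext k
    simp only [ofRealCoeff, wSeries, map_add, map_sub]
    push_cast
    ring
  rw [wFun, e, powerSum_add ((tg.ofRealCoeff_mul tθj).add ((tj.ofRealCoeff_mul tθg).const_mul _))
    (tg.ofRealCoeff_mul tg) hu, powerSum_add (tg.ofRealCoeff_mul tθj)
    ((tj.ofRealCoeff_mul tθg).const_mul _) hu, powerSum_const_mul, ← p1, ← p2, ← p3,
    ofRealCoeff_theta, ofRealCoeff_theta, powerSum_nat_mul tj hu, powerSum_nat_mul tg hu,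
    ofRealCoeff_gSeries, ofRealCoeff_jSeries, gFun, jFun, gFun', jFun']
  ring

lemma exists_hasDerivAt_wFun (κ : ℝ) {u : ℂ} (hu : ‖u‖ < 1) :
    ∃ d, HasDerivAt (wFun κ) d u ∧ 2 * (1 - u) * d = wFun κ u := by
  have ht := tame_wSeries κ
  refine ⟨_, hasDerivAt_powerSum ht hu, ?_⟩
  have e1 := powerSum_nat_mul ht hu
  have key : 2 * powerSum (derivCoeff (ofRealCoeff (wSeries κ))) u
      = 2 * powerSum (fun k => (k : ℂ) * ofRealCoeff (wSeries κ) k) u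
        + powerSum (ofRealCoeff (wSeries κ)) u := by
    rw [← powerSum_const_mul, ← powerSum_const_mul, ← powerSum_add (ht.nat_mul.const_mul 2) ht hu]
    congr 1
    funext k
    have h := congrArg (fun x : ℝ => (x : ℂ)) (coeff_wSeries_succ κ k)
    push_cast at h
    simp only [derivCoeff, ofRealCoeff]
    linear_combination 2 * h
  rw [wFun]
  linear_combination key + 2 * e1

lemma wFun_zero (κ : ℝ) : wFun κ 0 = 1 := by
  rw [wFun, powerSum_zero, ofRealCoeff, coeff_wSeries_zero, Complex.ofReal_one]

lemma gFun_sq {κ : ℝ} (h0 : 0 < κ) (h1 : κ ≤ 1 / 4) {u : ℂ} (hu : ‖u‖ < 1) :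
    powerSum (fun k => (aCoeff κ k : ℂ)) u = gFun κ u * gFun κ u := by
  have tg : Tame (ofRealCoeff (gSeries κ)) := by
    rw [ofRealCoeff_gSeries]; exact tame_gCoeff h0 h1
  rw [gFun, ← ofRealCoeff_gSeries, powerSum_ofRealCoeff_mul tg tg hu]
  congr 1
  funext k
  rw [ofRealCoeff, coeff_g_sq]

lemma gFun_mul_jFun {κ : ℝ} (h0 : 0 < κ) (h1 : κ ≤ 1 / 4) {u : ℂ} (hu : ‖u‖ < 1) :
    powerSum (fun k => ((aCoeff κ k * logCoeff κ k : ℝ) : ℂ)) u = gFun κ u * jFun κ u := by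
  have tg : Tame (ofRealCoeff (gSeries κ)) := by
    rw [ofRealCoeff_gSeries]; exact tame_gCoeff h0 h1
  have tj : Tame (ofRealCoeff (jSeries κ)) := by
    rw [ofRealCoeff_jSeries]; exact tame_jCoeff h0 h1
  rw [gFun, jFun, ← ofRealCoeff_gSeries, ← ofRealCoeff_jSeries, powerSum_ofRealCoeff_mul tg tj hu]
  congr 1
  funext k
  rw [ofRealCoeff, coeff_g_mul_j h0]

lemma jFun_sq {κ : ℝ} (h0 : 0 < κ) (h1 : κ ≤ 1 / 4) {u : ℂ} (hu : ‖u‖ < 1) :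
    powerSum (fun k => ((aCoeff κ k * (logCoeff κ k ^ 2 + logCoeff₂ κ k) : ℝ) : ℂ)) u
      = jFun κ u * jFun κ u := by
  have tj : Tame (ofRealCoeff (jSeries κ)) := by
    rw [ofRealCoeff_jSeries]; exact tame_jCoeff h0 h1
  rw [jFun, ← ofRealCoeff_jSeries, powerSum_ofRealCoeff_mul tj tj hu]
  congr 1
  funext k
  rw [ofRealCoeff, coeff_j_sq h0]

/-! ### Power series with coefficients of bounded variation -/

/-- Sequences of bounded variation. -/
def BoundedVar (v : ℕ → ℂ) : Prop := Summable fun k => ‖v (k + 1) - v k‖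

/-- Abel's summation of the power series `∑ v k u ^ k`, where `v` is a null sequence of bounded
variation; the formula makes sense on the closed unit disc except at `u = 1`. -/
noncomputable def abelSum (v : ℕ → ℂ) (u : ℂ) : ℂ :=
  (v 0 + ∑' k, (v (k + 1) - v k) * u ^ (k + 1)) / (1 - u)

lemma BoundedVar.exists_bound {v : ℕ → ℂ} (h : BoundedVar v) : ∃ C, 0 ≤ C ∧ ∀ k, ‖v k‖ ≤ C := by
  refine ⟨‖v 0‖ + ∑' k, ‖v (k + 1) - v k‖,
    add_nonneg (norm_nonneg _) (tsum_nonneg fun k => norm_nonneg _), fun k => ?_⟩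
  have e : v k = v 0 + ∑ i ∈ Finset.range k, (v (i + 1) - v i) := by
    rw [Finset.sum_range_sub]; ring
  rw [e]
  refine (norm_add_le _ _).trans (add_le_add_right ((norm_sum_le _ _).trans ?_) _)
  exact h.sum_le_tsum _ fun i _ => norm_nonneg _

lemma BoundedVar.add {v w : ℕ → ℂ} (hv : BoundedVar v) (hw : BoundedVar w) :
    BoundedVar fun k => v k + w k := by
  refine Summable.of_nonneg_of_le (fun k => norm_nonneg _) (fun k => ?_) (Summable.add hv hw)
  rw [add_sub_add_comm]
  exact norm_add_le _ _

lemma BoundedVar.mul {v w : ℕ → ℂ} (hv : BoundedVar v) (hw : BoundedVar w) :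
    BoundedVar fun k => v k * w k := by
  obtain ⟨C, hC0, hC⟩ := hv.exists_bound
  obtain ⟨E, hE0, hE⟩ := hw.exists_bound
  refine Summable.of_nonneg_of_le (fun k => norm_nonneg _) (fun k => ?_)
    ((Summable.mul_left E hv).add (Summable.mul_left C hw))
  have e : v (k + 1) * w (k + 1) - v k * w k
      = w (k + 1) * (v (k + 1) - v k) + v k * (w (k + 1) - w k) := by ring
  rw [e]
  refine (norm_add_le _ _).trans ?_
  rw [norm_mul, norm_mul]
  exact add_le_add (mul_le_mul_of_nonneg_right (hE _) (norm_nonneg _))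
    (mul_le_mul_of_nonneg_right (hC _) (norm_nonneg _))

lemma boundedVar_const (c : ℂ) : BoundedVar fun _ => c := by
  simp [BoundedVar, summable_zero]

lemma boundedVar_of_antitone {v : ℕ → ℝ} (h : Antitone v) (h0 : ∀ k, 0 ≤ v k) :
    BoundedVar fun k => (v k : ℂ) := by
  refine summable_of_sum_range_le (c := v 0) (fun k => norm_nonneg _) fun n => ?_
  have e : ∀ k, ‖((v (k + 1) : ℂ) - v k)‖ = v k - v (k + 1) := fun k => by
    rw [← Complex.ofReal_sub, Complex.norm_real, Real.norm_eq_abs, abs_sub_comm,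
      abs_of_nonneg (sub_nonneg.2 (h k.le_succ))]
  simp only [e]
  rw [Finset.sum_range_sub']
  linarith [h0 n]

lemma boundedVar_of_sum {f : ℕ → ℝ} (hf : Summable f) :
    BoundedVar fun k => ((∑ i ∈ Finset.range k, f i : ℝ) : ℂ) := by
  refine hf.norm.congr fun k => ?_
  rw [← Complex.ofReal_sub, Complex.norm_real, Finset.sum_range_succ, add_sub_cancel_left]

lemma BoundedVar.summable_diff {v : ℕ → ℂ} (hv : BoundedVar v) {u : ℂ} (hu : ‖u‖ ≤ 1) :
    Summable fun k => (v (k + 1) - v k) * u ^ (k + 1) := by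
  refine Summable.of_norm_bounded hv fun k => ?_
  rw [norm_mul, norm_pow]
  exact mul_le_of_le_one_right (norm_nonneg _) (pow_le_one₀ (norm_nonneg _) hu)

/-- Dirichlet's test. -/
lemma tendsto_sum_abelSum {v : ℕ → ℂ} (hv : BoundedVar v) (h0 : Tendsto v atTop (𝓝 0)) {u : ℂ}
    (hu : ‖u‖ ≤ 1) (hu1 : u ≠ 1) :
    Tendsto (fun n => ∑ k ∈ Finset.range n, v k * u ^ k) atTop (𝓝 (abelSum v u)) := by
  have hne : 1 - u ≠ 0 := sub_ne_zero.2 hu1.symm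
  have hsum : ∀ n, (∑ k ∈ Finset.range n, v k * u ^ k)
      = (v 0 + ∑ k ∈ Finset.range n, (v (k + 1) - v k) * u ^ (k + 1) - v n * u ^ n) / (1 - u) := by
    intro n
    rw [eq_div_iff hne]
    induction n with
    | zero => simp
    | succ n ih =>
      rw [Finset.sum_range_succ, Finset.sum_range_succ, add_mul, ih]
      ring
  have hlast : Tendsto (fun n => v n * u ^ n) atTop (𝓝 0) := by
    refine squeeze_zero_norm (fun n => ?_) (tendsto_norm_zero.comp h0)
    rw [norm_mul, norm_pow]
    exact mul_le_of_le_one_right (norm_nonneg _) (pow_le_one₀ (norm_nonneg _) hu)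
  have := (((hv.summable_diff hu).hasSum.tendsto_sum_nat.const_add (v 0)).sub hlast).div_const
    (1 - u)
  rw [sub_zero] at this
  exact this.congr fun n => (hsum n).symm

lemma abelSum_eq_powerSum {v : ℕ → ℂ} (hv : BoundedVar v) (h0 : Tendsto v atTop (𝓝 0)) {u : ℂ}
    (hu : ‖u‖ < 1) : abelSum v u = powerSum v u := by
  obtain ⟨C, hC0, hC⟩ := hv.exists_bound
  have ht : Tame v := Tame.of_le (C := C) fun k => (hC k).trans (by
    have := mul_nonneg hC0 k.cast_nonneg (α := ℝ)
    linarith)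
  have hu1 : u ≠ 1 := by rintro rfl; simp at hu
  exact tendsto_nhds_unique (tendsto_sum_abelSum hv h0 hu.le hu1)
    (ht.summable hu).hasSum.tendsto_sum_nat

lemma continuousWithinAt_abelSum {v : ℕ → ℂ} (hv : BoundedVar v) {u : ℂ} (hu : ‖u‖ ≤ 1)
    (hu1 : u ≠ 1) : ContinuousWithinAt (abelSum v) (Metric.closedBall 0 1) u := by
  have hc : ContinuousOn (fun u : ℂ => ∑' k, (v (k + 1) - v k) * u ^ (k + 1))
      (Metric.closedBall 0 1) := by
    refine continuousOn_tsum (fun k => by fun_prop) hv fun k z hz => ?_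
    rw [mem_closedBall_zero_iff] at hz
    rw [norm_mul, norm_pow]
    exact mul_le_of_le_one_right (norm_nonneg _) (pow_le_one₀ (norm_nonneg _) hz)
  have h1 := hc u (mem_closedBall_zero_iff.2 hu)
  exact (h1.const_add (v 0)).div (by fun_prop) (sub_ne_zero.2 hu1.symm)

/-! ### The coefficients of Clausen's series -/

lemma aCoeff_pos {κ : ℝ} (h0 : 0 < κ) (k : ℕ) : 0 < aCoeff κ k := by
  induction k with
  | zero => simp [aCoeff]
  | succ k ih =>
    rw [aCoeff]
    exact mul_pos (div_pos (cubicPoly_pos h0 k) (by positivity)) ih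

/-- The bound `a k = O(k ^ (-3/2))`, obtained by comparison with `κ = 1/4`. -/
lemma aCoeff_sq_mul_le {κ : ℝ} (h0 : 0 < κ) (h1 : κ ≤ 1 / 4) (k : ℕ) :
    aCoeff κ k ^ 2 * (2 * k + 1) ^ 3 ≤ 1 := by
  induction k with
  | zero => simp [aCoeff]
  | succ k ih =>
    have hk : (0 : ℝ) ≤ k := k.cast_nonneg
    have hs := aCoeff_succ κ k
    have ha := aCoeff_pos h0 k
    have hQ : cubicPoly κ k ≤ (k + 1 / 2) ^ 3 := by
      rw [cubicPoly, pow_succ' _ 2]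
      exact mul_le_mul_of_nonneg_left (by nlinarith) (by positivity)
    have hQ0 := cubicPoly_pos h0 k
    have h2 : aCoeff κ (k + 1) ^ 2 * ((k : ℝ) + 1) ^ 6 ≤ aCoeff κ k ^ 2 * (k + 1 / 2) ^ 6 := by
      have e1 : aCoeff κ (k + 1) ^ 2 * ((k : ℝ) + 1) ^ 6
          = (((k : ℝ) + 1) ^ 3 * aCoeff κ (k + 1)) ^ 2 := by ring
      have e2 : aCoeff κ k ^ 2 * ((k : ℝ) + 1 / 2) ^ 6
          = (((k : ℝ) + 1 / 2) ^ 3 * aCoeff κ k) ^ 2 := by ring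
      rw [e1, e2, hs]
      exact pow_le_pow_left₀ (by positivity) (mul_le_mul_of_nonneg_right hQ ha.le) 2
    have h3 : ((k : ℝ) + 1 / 2) ^ 6 * (2 * k + 3) ^ 3 ≤ ((k : ℝ) + 1) ^ 6 * (2 * k + 1) ^ 3 := by
      have e1 : ((k : ℝ) + 1 / 2) ^ 6 * (2 * k + 3) ^ 3
          = ((k + 1 / 2) ^ 2 * (2 * k + 3)) ^ 3 := by ring
      have e2 : ((k : ℝ) + 1) ^ 6 * (2 * k + 1) ^ 3 = ((k + 1) ^ 2 * (2 * k + 1)) ^ 3 := by ring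
      rw [e1, e2]
      exact pow_le_pow_left₀ (by positivity) (by nlinarith) 3
    have hpos : 0 < ((k : ℝ) + 1) ^ 6 := by positivity
    refine le_of_mul_le_mul_left ?_ hpos
    push_cast
    calc ((k : ℝ) + 1) ^ 6 * (aCoeff κ (k + 1) ^ 2 * (2 * (k + 1) + 1) ^ 3)
        = (aCoeff κ (k + 1) ^ 2 * ((k : ℝ) + 1) ^ 6) * (2 * k + 3) ^ 3 := by ring
      _ ≤ (aCoeff κ k ^ 2 * (k + 1 / 2) ^ 6) * (2 * k + 3) ^ 3 := by gcongr
      _ = aCoeff κ k ^ 2 * (((k : ℝ) + 1 / 2) ^ 6 * (2 * k + 3) ^ 3) := by ring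
      _ ≤ aCoeff κ k ^ 2 * (((k : ℝ) + 1) ^ 6 * (2 * k + 1) ^ 3) := by gcongr
      _ = ((k : ℝ) + 1) ^ 6 * (aCoeff κ k ^ 2 * (2 * k + 1) ^ 3) := by ring
      _ ≤ ((k : ℝ) + 1) ^ 6 * 1 := by gcongr

lemma aCoeff_le {κ : ℝ} (h0 : 0 < κ) (h1 : κ ≤ 1 / 4) (k : ℕ) :
    aCoeff κ k ≤ ((k : ℝ) + 1) ^ (-(3 / 2) : ℝ) := by
  have hk : (0 : ℝ) ≤ k := k.cast_nonneg
  have hp : (0 : ℝ) < k + 1 := by linarith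
  refine le_of_sq_le_sq ?_ (Real.rpow_nonneg hp.le _)
  have e : (((k : ℝ) + 1) ^ (-(3 / 2) : ℝ)) ^ 2 = (((k : ℝ) + 1) ^ 3)⁻¹ := by
    rw [← Real.rpow_natCast, ← Real.rpow_mul hp.le, ← Real.rpow_natCast, ← Real.rpow_neg hp.le]
    norm_num
  rw [e, ← one_div, le_div_iff₀ (by positivity)]
  refine le_trans ?_ (aCoeff_sq_mul_le h0 h1 k)
  gcongr
  linarith

lemma antitone_aCoeff {κ : ℝ} (h0 : 0 < κ) (h1 : κ ≤ 1 / 4) :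
    Antitone fun k : ℕ => ((k : ℝ) + 1) * aCoeff κ k := by
  refine antitone_nat_of_succ_le fun k => ?_
  have hk : (0 : ℝ) ≤ k := k.cast_nonneg
  have ha := aCoeff_pos h0 k
  have hs : aCoeff κ (k + 1) = cubicPoly κ k / ((k : ℝ) + 1) ^ 3 * aCoeff κ k := rfl
  rw [hs, ← mul_assoc]
  refine mul_le_mul_of_nonneg_right ?_ ha.le
  rw [mul_div_assoc', div_le_iff₀ (by positivity), cubicPoly]
  push_cast
  have h2 := mul_nonneg h0.le hk
  have : κ * k ≤ 1 / 4 * k := mul_le_mul_of_nonneg_right h1 hk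
  have : κ * (k * k) ≤ 1 / 4 * (k * k) := mul_le_mul_of_nonneg_right h1 (by positivity)
  have : 0 ≤ (k : ℝ) ^ 3 := by positivity
  have : 0 ≤ (k : ℝ) ^ 2 := by positivity
  nlinarith

lemma tendsto_succ_mul_aCoeff {κ : ℝ} (h0 : 0 < κ) (h1 : κ ≤ 1 / 4) :
    Tendsto (fun k : ℕ => ((k : ℝ) + 1) * aCoeff κ k) atTop (𝓝 0) := by
  have hlim : Tendsto (fun k : ℕ => ((k : ℝ) + 1) ^ (-(1 / 2) : ℝ)) atTop (𝓝 0) :=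
    (tendsto_rpow_neg_atTop (by norm_num : (0 : ℝ) < 1 / 2)).comp
      (tendsto_atTop_add_const_right _ _ tendsto_natCast_atTop_atTop)
  refine squeeze_zero (fun k => ?_) (fun k => ?_) hlim
  · have := aCoeff_pos h0 k
    positivity
  · have hp : (0 : ℝ) < k + 1 := by positivity
    calc ((k : ℝ) + 1) * aCoeff κ k ≤ ((k : ℝ) + 1) * ((k : ℝ) + 1) ^ (-(3 / 2) : ℝ) :=
          mul_le_mul_of_nonneg_left (aCoeff_le h0 h1 k) hp.le
      _ = ((k : ℝ) + 1) ^ (-(1 / 2) : ℝ) := by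
          rw [← Real.rpow_one_add' hp.le (by norm_num)]; norm_num

lemma boundedVar_aCoeff {κ : ℝ} (h0 : 0 < κ) (h1 : κ ≤ 1 / 4) :
    BoundedVar fun k => (aCoeff κ k : ℂ) := by
  have ha : Antitone fun k => aCoeff κ k := by
    refine antitone_nat_of_succ_le fun k => ?_
    have h := antitone_aCoeff h0 h1 k.le_succ
    have hp := aCoeff_pos h0 (k + 1)
    simp only at h
    push_cast at h
    have hk : (0 : ℝ) ≤ k := k.cast_nonneg
    have : ((k : ℝ) + 1) * aCoeff κ (k + 1) ≤ ((k : ℝ) + 1) * aCoeff κ k := by nlinarith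
    exact le_of_mul_le_mul_left this (by positivity)
  exact boundedVar_of_antitone ha fun k => (aCoeff_pos h0 k).le

lemma boundedVar_nat_mul_aCoeff {κ : ℝ} (h0 : 0 < κ) (h1 : κ ≤ 1 / 4) :
    BoundedVar fun k : ℕ => (k : ℂ) * (aCoeff κ k : ℂ) := by
  have h2 := boundedVar_of_antitone (antitone_aCoeff h0 h1) fun k => by
    have := aCoeff_pos h0 k
    positivity
  have h3 := h2.add ((boundedVar_const (-1)).mul (boundedVar_aCoeff h0 h1))
  convert h3 using 2 with k
  push_cast
  ring

lemma tendsto_nat_mul_aCoeff {κ : ℝ} (h0 : 0 < κ) (h1 : κ ≤ 1 / 4) :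
    Tendsto (fun k : ℕ => (k : ℂ) * (aCoeff κ k : ℂ)) atTop (𝓝 0) := by
  refine squeeze_zero_norm (fun k => ?_) (tendsto_succ_mul_aCoeff h0 h1)
  have := aCoeff_pos h0 k
  rw [norm_mul, Complex.norm_natCast, Complex.norm_real, Real.norm_eq_abs, abs_of_pos this]
  nlinarith

lemma tendsto_aCoeff {κ : ℝ} (h0 : 0 < κ) (h1 : κ ≤ 1 / 4) :
    Tendsto (fun k : ℕ => (aCoeff κ k : ℂ)) atTop (𝓝 0) := by
  refine squeeze_zero_norm (fun k => ?_) (tendsto_succ_mul_aCoeff h0 h1)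
  have := aCoeff_pos h0 k
  have hk : (0 : ℝ) ≤ k := k.cast_nonneg
  rw [Complex.norm_real, Real.norm_eq_abs, abs_of_pos this]
  nlinarith

lemma cubicPoly_ge {κ : ℝ} (h0 : 0 < κ) (h1 : κ ≤ 1 / 4) (k : ℕ) :
    κ / 2 * ((k : ℝ) + 1) ^ 3 ≤ cubicPoly κ k := by
  have hk : (0 : ℝ) ≤ k := k.cast_nonneg
  have e1 : κ * ((k : ℝ) + 1) ^ 2 ≤ k ^ 2 + k + κ := by
    have : κ * (k : ℝ) ≤ 1 / 4 * k := mul_le_mul_of_nonneg_right h1 hk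
    have : κ * ((k : ℝ) * k) ≤ 1 / 4 * (k * k) := mul_le_mul_of_nonneg_right h1 (by positivity)
    nlinarith
  calc κ / 2 * ((k : ℝ) + 1) ^ 3 = (((k : ℝ) + 1) / 2) * (κ * ((k : ℝ) + 1) ^ 2) := by ring
    _ ≤ (k + 1 / 2) * (k ^ 2 + k + κ) := by gcongr; linarith

lemma summable_inv_succ_sq (C : ℝ) : Summable fun k : ℕ => C * (((k : ℝ) + 1) ^ 2)⁻¹ := by
  refine Summable.mul_left C ?_
  have := (summable_nat_add_iff 1).2 (Real.summable_nat_pow_inv.2 (one_lt_two))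
  simpa using this

lemma cubicPoly'_div_le {κ : ℝ} (h0 : 0 < κ) (h1 : κ ≤ 1 / 4) (k : ℕ) :
    cubicPoly' κ k / cubicPoly κ k ≤ 6 / κ * ((k : ℝ) + 1)⁻¹ := by
  have hk : (0 : ℝ) ≤ k := k.cast_nonneg
  have hg := cubicPoly_ge h0 h1 k
  rw [div_le_iff₀ (cubicPoly_pos h0 k)]
  calc cubicPoly' κ k ≤ 3 * ((k : ℝ) + 1) ^ 2 := by rw [cubicPoly']; nlinarith
    _ = 6 / κ * ((k : ℝ) + 1)⁻¹ * (κ / 2 * ((k : ℝ) + 1) ^ 3) := by field_simp; ring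
    _ ≤ 6 / κ * ((k : ℝ) + 1)⁻¹ * cubicPoly κ k := by gcongr

lemma cubicPoly'_nonneg {κ : ℝ} (h0 : 0 < κ) (k : ℕ) : 0 ≤ cubicPoly' κ k := by
  unfold cubicPoly'; positivity

lemma summable_logCoeff_diff {κ : ℝ} (h0 : 0 < κ) (h1 : κ ≤ 1 / 4) :
    Summable fun i : ℕ => cubicPoly' κ i / cubicPoly κ i - 3 / ((i : ℝ) + 1) := by
  refine Summable.of_norm_bounded (summable_inv_succ_sq (4 / κ)) fun k => ?_
  have hk : (0 : ℝ) ≤ k := k.cast_nonneg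
  have hg := cubicPoly_ge h0 h1 k
  have hp := cubicPoly_pos h0 k
  have hk1 : (0 : ℝ) < k + 1 := by linarith
  have hκk : κ * (k : ℝ) ≤ 1 / 4 * k := mul_le_mul_of_nonneg_right h1 hk
  have e : cubicPoly' κ k / cubicPoly κ k - 3 / ((k : ℝ) + 1)
      = (3 / 2 * k ^ 2 + (2 - 2 * κ) * k + 1 / 2 - κ / 2) / (cubicPoly κ k * (k + 1)) := by
    rw [div_sub_div _ _ hp.ne' hk1.ne', cubicPoly']
    congr 1
    rw [cubicPoly]
    ring
  have hn : 0 ≤ 3 / 2 * (k : ℝ) ^ 2 + (2 - 2 * κ) * k + 1 / 2 - κ / 2 := by nlinarith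
  rw [e, Real.norm_eq_abs, abs_of_nonneg (by positivity), div_le_iff₀ (by positivity)]
  calc 3 / 2 * (k : ℝ) ^ 2 + (2 - 2 * κ) * k + 1 / 2 - κ / 2
      ≤ 2 * ((k : ℝ) + 1) ^ 2 := by nlinarith [mul_nonneg h0.le hk]
    _ = 4 / κ * (((k : ℝ) + 1) ^ 2)⁻¹ * ((κ / 2 * ((k : ℝ) + 1) ^ 3) * (k + 1)) := by
        field_simp; ring
    _ ≤ 4 / κ * (((k : ℝ) + 1) ^ 2)⁻¹ * (cubicPoly κ k * (k + 1)) := by gcongr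

lemma summable_logCoeff₂_diff {κ : ℝ} (h0 : 0 < κ) (h1 : κ ≤ 1 / 4) :
    Summable fun i : ℕ => cubicPoly'' i / cubicPoly κ i
      - (cubicPoly' κ i / cubicPoly κ i) ^ 2 + 3 / ((i : ℝ) + 1) ^ 2 := by
  refine Summable.add (Summable.sub ?_ ?_) (summable_inv_succ_sq 3)
  · refine Summable.of_nonneg_of_le (fun k => ?_) (fun k => ?_) (summable_inv_succ_sq (12 / κ))
    · have := cubicPoly_pos h0 k
      unfold cubicPoly''; positivity
    · have hk : (0 : ℝ) ≤ k := k.cast_nonneg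
      rw [div_le_iff₀ (cubicPoly_pos h0 k)]
      calc cubicPoly'' k ≤ 6 * ((k : ℝ) + 1) := by rw [cubicPoly'']; linarith
        _ = 12 / κ * (((k : ℝ) + 1) ^ 2)⁻¹ * (κ / 2 * ((k : ℝ) + 1) ^ 3) := by
            field_simp; ring
        _ ≤ 12 / κ * (((k : ℝ) + 1) ^ 2)⁻¹ * cubicPoly κ k := by
            have := cubicPoly_ge h0 h1 k
            gcongr
  · refine Summable.of_nonneg_of_le (fun k => sq_nonneg _) (fun k => ?_)
      (summable_inv_succ_sq ((6 / κ) ^ 2))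
    rw [← inv_pow, ← mul_pow]
    exact pow_le_pow_left₀ (div_nonneg (cubicPoly'_nonneg h0 k) (cubicPoly_pos h0 k).le)
      (cubicPoly'_div_le h0 h1 k) 2

lemma boundedVar_logCoeff {κ : ℝ} (h0 : 0 < κ) (h1 : κ ≤ 1 / 4) :
    BoundedVar fun k => (logCoeff κ k : ℂ) := boundedVar_of_sum (summable_logCoeff_diff h0 h1)

lemma boundedVar_logCoeff₂ {κ : ℝ} (h0 : 0 < κ) (h1 : κ ≤ 1 / 4) :
    BoundedVar fun k => (logCoeff₂ κ k : ℂ) := boundedVar_of_sum (summable_logCoeff₂_diff h0 h1)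

lemma tendsto_mul_boundedVar {v m : ℕ → ℂ} (hv : Tendsto v atTop (𝓝 0)) (hm : BoundedVar m) :
    Tendsto (fun k => v k * m k) atTop (𝓝 0) := by
  obtain ⟨C, hC0, hC⟩ := hm.exists_bound
  refine squeeze_zero_norm (fun k => ?_) (by simpa using hv.norm.mul_const C)
  rw [norm_mul]
  exact mul_le_mul_of_nonneg_left (hC k) (norm_nonneg _)

/-! ### The binomial weights -/

/-- The separation constant `κ = -ν (ν + 1)` of the degree `ν`. -/
noncomputable def Degree.kappa (D : Degree) : ℝ := -D.nu * (D.nu + 1)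

lemma Degree.kappa_pos (D : Degree) : 0 < D.kappa := by
  cases D <;> norm_num [Degree.kappa, Degree.nu]

lemma Degree.kappa_le (D : Degree) : D.kappa ≤ 1 / 4 := by
  cases D <;> norm_num [Degree.kappa, Degree.nu]

lemma Degree.neg_half_le_nu (D : Degree) : -(1 / 2) ≤ D.nu := by
  cases D <;> norm_num [Degree.nu]

lemma Degree.nu_neg (D : Degree) : D.nu < 0 := by
  cases D <;> norm_num [Degree.nu]

lemma Degree.neg_one_lt_nu (D : Degree) : -1 < D.nu := by
  linarith [D.neg_half_le_nu]

lemma seriesConst_pos (D : Degree) : 0 < seriesConst D := by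
  cases D <;> norm_num [seriesConst]

lemma cast_choose_two_mul (k : ℕ) :
    ((2 * k).choose k : ℝ) = (2 * k).factorial / (k.factorial * k.factorial) := by
  rw [two_mul, Nat.cast_add_choose]

lemma cast_choose_three_mul (k : ℕ) :
    ((3 * k).choose k : ℝ) = (3 * k).factorial / (k.factorial * (2 * k).factorial) := by
  rw [show 3 * k = k + 2 * k by ring, Nat.cast_add_choose]

lemma cast_factorial_mul_succ (n k : ℕ) : ((n * (k + 1)).factorial : ℝ)
    = (n * k).factorial * ∏ j ∈ Finset.range n, ((n * k + j + 1 : ℕ) : ℝ) := by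
  rw [mul_add, mul_one]
  generalize n * k = m
  induction n with
  | zero => simp
  | succ n ih =>
    rw [Finset.prod_range_succ, ← mul_assoc, ← ih, ← add_assoc, Nat.factorial_succ]
    push_cast
    ring

/-- The recurrence of the binomial weights is that of Clausen's coefficients, up to the factor
`4 K`. -/
lemma binomialWeight_succ (D : Degree) (k : ℕ) :
    (binomialWeight D (k + 1) : ℝ) * ((k : ℝ) + 1) ^ 3
      = 4 * seriesConst D * (cubicPoly D.kappa k * binomialWeight D k) := by
  have f1 : (k.factorial : ℝ) ≠ 0 := by exact_mod_cast k.factorial_ne_zero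
  have f2 : ((2 * k).factorial : ℝ) ≠ 0 := by exact_mod_cast (2 * k).factorial_ne_zero
  have f3 : ((3 * k).factorial : ℝ) ≠ 0 := by exact_mod_cast (3 * k).factorial_ne_zero
  have hk : (0 : ℝ) ≤ k := k.cast_nonneg
  have g1 : ((k + 1).factorial : ℝ) = k.factorial * (k + 1) := by
    rw [Nat.factorial_succ]; push_cast; ring
  have g2 := cast_factorial_mul_succ 2 k
  have g3 := cast_factorial_mul_succ 3 k
  have g4 := cast_factorial_mul_succ 4 k
  have g6 := cast_factorial_mul_succ 6 k
  simp only [Finset.prod_range_succ, Finset.prod_range_zero, one_mul] at g2 g3 g4 g6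
  push_cast at g2 g3 g4 g6
  cases D
  · simp only [binomialWeight, seriesConst, cubicPoly, Degree.kappa, Degree.nu, Nat.cast_pow,
      cast_choose_two_mul]
    rw [g2, g1]
    field_simp
    ring
  · simp only [binomialWeight, seriesConst, cubicPoly, Degree.kappa, Degree.nu, Nat.cast_pow,
      Nat.cast_mul, cast_choose_two_mul, cast_choose_three_mul]
    rw [g2, g1, g3]
    field_simp
    ring
  · have e : ∀ k, ((4 * k).choose (2 * k) : ℝ)
        = (4 * k).factorial / ((2 * k).factorial * (2 * k).factorial) := fun k => by
      have h := cast_choose_two_mul (2 * k)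
      rwa [show 2 * (2 * k) = 4 * k by ring] at h
    simp only [binomialWeight, seriesConst, cubicPoly, Degree.kappa, Degree.nu, Nat.cast_pow,
      Nat.cast_mul, cast_choose_two_mul, e]
    rw [g2, g1, g4]
    field_simp
    ring
  · have e : ∀ k, ((6 * k).choose (3 * k) : ℝ)
        = (6 * k).factorial / ((3 * k).factorial * (3 * k).factorial) := fun k => by
      have h := cast_choose_two_mul (3 * k)
      rwa [show 2 * (3 * k) = 6 * k by ring] at h
    simp only [binomialWeight, seriesConst, cubicPoly, Degree.kappa, Degree.nu, Nat.cast_mul,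
      cast_choose_two_mul, cast_choose_three_mul, e]
    rw [g2, g1, g3, g6]
    field_simp
    ring

lemma binomialWeight_eq (D : Degree) (k : ℕ) :
    (binomialWeight D k : ℝ) = (4 * seriesConst D) ^ k * aCoeff D.kappa k := by
  induction k with
  | zero => cases D <;> simp [binomialWeight, aCoeff]
  | succ k ih =>
    have h1 := binomialWeight_succ D k
    have h2 := aCoeff_succ D.kappa k
    have h3 : ((k : ℝ) + 1) ^ 3 ≠ 0 := by positivity
    rw [ih] at h1
    apply mul_right_cancel₀ h3
    rw [h1, pow_succ]
    linear_combination -(4 * seriesConst D) ^ k * (4 * seriesConst D) * h2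

/-- In the variable `u = 4 t (1 - t)` the weighted powers become Clausen's coefficients. -/
lemma binomialWeight_mul_pow (D : Degree) (t : ℂ) (k : ℕ) :
    (binomialWeight D k : ℂ) * seriesVar D t ^ k
      = (aCoeff D.kappa k : ℂ) * (4 * t * (1 - t)) ^ k := by
  have hK : (seriesConst D : ℂ) ≠ 0 := by exact_mod_cast (seriesConst_pos D).ne'
  have h := congrArg (fun x : ℝ => (x : ℂ)) (binomialWeight_eq D k)
  push_cast at h
  rw [h, seriesVar_eq, mul_right_comm, ← mul_pow, mul_comm]
  congr 2
  field_simp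

lemma sigmaTerm_eq (D : Degree) (a b : ℂ) (c : ℕ → ℂ) (t : ℂ) (k : ℕ) :
    sigmaTerm D a b c t k = a * (k * (aCoeff D.kappa k : ℂ) * c k * (4 * t * (1 - t)) ^ k)
      + b * ((aCoeff D.kappa k : ℂ) * c k * (4 * t * (1 - t)) ^ k) := by
  have := binomialWeight_mul_pow D t k
  rw [sigmaTerm]
  linear_combination (a * k + b) * c k * this

/-! ### Harmonic numbers -/

/-- The harmonic numbers as real numbers. -/
noncomputable def harmonicReal (r m : ℕ) : ℝ := ∑ j ∈ Finset.Icc 1 m, 1 / (j : ℝ) ^ r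

lemma harmonicNumber_eq (r m : ℕ) : harmonicNumber r m = (harmonicReal r m : ℂ) := by
  simp [harmonicNumber, harmonicReal]

lemma harmonicReal_mul_succ (r n k : ℕ) (hn : 0 < n) : harmonicReal r (n * (k + 1))
    = harmonicReal r (n * k)
      + (1 / n) ^ r * ∑ j ∈ Finset.range n, (((k : ℝ) + (j + 1) / n)⁻¹) ^ r := by
  have hn' : (n : ℝ) ≠ 0 := by exact_mod_cast hn.ne'
  have key : ∀ m i, harmonicReal r (m + i)
      = harmonicReal r m + ∑ j ∈ Finset.range i, 1 / ((m : ℝ) + j + 1) ^ r := by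
    intro m i
    induction i with
    | zero => simp
    | succ i ih =>
      rw [← add_assoc, harmonicReal, Finset.sum_Icc_succ_top (by omega), ← harmonicReal, ih,
        Finset.sum_range_succ]
      push_cast
      ring
  rw [mul_add, mul_one, key, Finset.mul_sum]
  congr 1
  refine Finset.sum_congr rfl fun j _ => ?_
  rw [← mul_pow, ← one_div_pow]
  congr 1
  push_cast
  have h1 : (n : ℝ) * k + j + 1 ≠ 0 := by positivity
  have h2 : (k : ℝ) + (j + 1) / n ≠ 0 := by positivity
  rw [one_div_mul_eq_div, inv_eq_one_div, div_div, div_eq_div_iff h1 (mul_ne_zero h2 hn')]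
  field_simp
  ring

lemma harmonicReal_succ (r k : ℕ) :
    harmonicReal r (k + 1) = harmonicReal r k + (((k : ℝ) + 1)⁻¹) ^ r := by
  have := harmonicReal_mul_succ r 1 k one_pos
  simpa using this

/-- `cubicPoly` splits as `(k + 1/2) (k - ν) (k + 1 + ν)`. -/
lemma Degree.cubicPoly_logDeriv (D : Degree) (k : ℕ) :
    cubicPoly' D.kappa k / cubicPoly D.kappa k
      = ((k : ℝ) + 1 / 2)⁻¹ + ((k : ℝ) - D.nu)⁻¹ + ((k : ℝ) + 1 + D.nu)⁻¹ := by
  have h1 : (k : ℝ) + 1 / 2 ≠ 0 := by positivity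
  have hk : (0 : ℝ) ≤ k := k.cast_nonneg
  have h2 : (k : ℝ) - D.nu ≠ 0 := by linarith [D.nu_neg]
  have h3 : (k : ℝ) + 1 + D.nu ≠ 0 := by linarith [D.neg_one_lt_nu]
  rw [show cubicPoly D.kappa k = (k + 1 / 2) * ((k - D.nu) * (k + 1 + D.nu)) by
    simp only [cubicPoly, Degree.kappa]; ring]
  simp only [cubicPoly', Degree.kappa]
  field_simp
  ring

lemma Degree.cubicPoly_logDeriv₂ (D : Degree) (k : ℕ) :
    cubicPoly'' k / cubicPoly D.kappa k - (cubicPoly' D.kappa k / cubicPoly D.kappa k) ^ 2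
      = -((((k : ℝ) + 1 / 2)⁻¹) ^ 2 + (((k : ℝ) - D.nu)⁻¹) ^ 2
        + (((k : ℝ) + 1 + D.nu)⁻¹) ^ 2) := by
  have h1 : (k : ℝ) + 1 / 2 ≠ 0 := by positivity
  have hk : (0 : ℝ) ≤ k := k.cast_nonneg
  have h2 : (k : ℝ) - D.nu ≠ 0 := by linarith [D.nu_neg]
  have h3 : (k : ℝ) + 1 + D.nu ≠ 0 := by linarith [D.neg_one_lt_nu]
  rw [D.cubicPoly_logDeriv, show cubicPoly D.kappa k
    = (k + 1 / 2) * ((k - D.nu) * (k + 1 + D.nu)) by simp only [cubicPoly, Degree.kappa]; ring]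
  simp only [cubicPoly'']
  field_simp
  ring

/-- In each degree the linear factors `k + 1/2`, `k - ν`, `k + 1 + ν` of `cubicPoly` account for the
steps of the harmonic numbers. -/
lemma cWeight_eq (D : Degree) (k : ℕ) : cWeight D k = (logCoeff D.kappa k : ℂ) := by
  have h : ∀ k, logCoeff D.kappa (k + 1) = logCoeff D.kappa k
      + (((k : ℝ) + 1 / 2)⁻¹ + ((k : ℝ) - D.nu)⁻¹ + ((k : ℝ) + 1 + D.nu)⁻¹
        - 3 * ((k : ℝ) + 1)⁻¹) := fun k => by
    rw [logCoeff, Finset.sum_range_succ, ← logCoeff, D.cubicPoly_logDeriv]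
    ring
  have h0 : logCoeff D.kappa 0 = 0 := by simp [logCoeff]
  cases D
  all_goals
    simp only [cWeight, harmonicNumber_eq]
    norm_cast
    generalize logCoeff _ = c at h h0
    simp only [Degree.nu] at h
    induction k with
    | zero => simp [harmonicReal, h0]
    | succ k ih =>
      rw [h, ← ih]
      simp only [harmonicReal_mul_succ 1 2 k (by norm_num), harmonicReal_mul_succ 1 3 k
        (by norm_num), harmonicReal_mul_succ 1 4 k (by norm_num), harmonicReal_mul_succ 1 6 k
        (by norm_num), harmonicReal_succ, Finset.sum_range_succ, Finset.sum_range_zero]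
      push_cast
      ring_nf

lemma dWeight_eq (D : Degree) (k : ℕ) : dWeight D k = (logCoeff₂ D.kappa k : ℂ) := by
  have h : ∀ k, logCoeff₂ D.kappa (k + 1) = logCoeff₂ D.kappa k
      + (-((((k : ℝ) + 1 / 2)⁻¹) ^ 2 + (((k : ℝ) - D.nu)⁻¹) ^ 2
        + (((k : ℝ) + 1 + D.nu)⁻¹) ^ 2) + 3 * (((k : ℝ) + 1)⁻¹) ^ 2) := fun k => by
    rw [logCoeff₂, Finset.sum_range_succ, ← logCoeff₂, D.cubicPoly_logDeriv₂,
      div_eq_mul_inv (3 : ℝ), ← inv_pow ((k : ℝ) + 1)]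
  have h0 : logCoeff₂ D.kappa 0 = 0 := by simp [logCoeff₂]
  cases D
  all_goals
    simp only [dWeight, harmonicNumber_eq]
    norm_cast
    generalize logCoeff₂ _ = c at h h0
    simp only [Degree.nu] at h
    induction k with
    | zero => simp [harmonicReal, h0]
    | succ k ih =>
      rw [h, ← ih]
      simp only [harmonicReal_mul_succ 2 2 k (by norm_num), harmonicReal_mul_succ 2 3 k
        (by norm_num), harmonicReal_mul_succ 2 4 k (by norm_num), harmonicReal_mul_succ 2 6 k
        (by norm_num), harmonicReal_succ, Finset.sum_range_succ, Finset.sum_range_zero]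
      push_cast
      ring_nf

/-! ### Absolute convergence -/

lemma isBigO_aCoeff {κ : ℝ} (h0 : 0 < κ) (h1 : κ ≤ 1 / 4) :
    (fun k => (aCoeff κ k : ℂ)) =O[atTop] fun k : ℕ => (k : ℝ) ^ (-(3 / 2) : ℝ) := by
  refine IsBigO.of_bound 1 ?_
  filter_upwards [eventually_ge_atTop 1] with k hk
  have hk0 : (0 : ℝ) < k := by exact_mod_cast hk
  rw [Complex.norm_real, Real.norm_eq_abs, abs_of_pos (aCoeff_pos h0 k), one_mul,
    Real.norm_eq_abs, abs_of_nonneg (Real.rpow_nonneg hk0.le _)]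
  exact (aCoeff_le h0 h1 k).trans
    (Real.rpow_le_rpow_of_nonpos hk0 (by linarith) (by norm_num))

/-- For `a = 0` the terms are `O(k ^ (-3/2) log k)` on the whole closed disc. -/
lemma summable_sigmaTerm (D : Degree) {t : ℂ} (ht : ‖4 * t * (1 - t)‖ ≤ 1) (a b : ℂ) {c : ℕ → ℂ}
    (hc : c =O[atTop] fun k : ℕ => Real.log k) (h : ‖4 * t * (1 - t)‖ < 1 ∨ a = 0) :
    Summable (sigmaTerm D a b c t) := by
  have hlog : (fun k : ℕ => Real.log k) =O[atTop] fun k : ℕ => (k : ℝ) ^ (1 / 4 : ℝ) :=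
    ((isLittleO_log_rpow_atTop (by norm_num : (0 : ℝ) < 1 / 4)).isBigO).comp_tendsto
      tendsto_natCast_atTop_atTop
  have hO : (fun k => (aCoeff D.kappa k : ℂ) * c k) =O[atTop]
      fun k : ℕ => (k : ℝ) ^ (-(5 / 4) : ℝ) := by
    refine ((isBigO_aCoeff D.kappa_pos D.kappa_le).mul (hc.trans hlog)).congr' .rfl ?_
    filter_upwards [eventually_ge_atTop 1] with k hk
    have hk0 : (0 : ℝ) < k := by exact_mod_cast hk
    rw [← Real.rpow_add hk0]
    norm_num
  have hs : Summable fun k => ‖(aCoeff D.kappa k : ℂ) * c k‖ :=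
    summable_of_isBigO_nat (Real.summable_nat_rpow.2 (by norm_num)) hO.norm_left
  have hb : Summable fun k => b * ((aCoeff D.kappa k : ℂ) * c k * (4 * t * (1 - t)) ^ k) := by
    refine Summable.mul_left b (Summable.of_norm_bounded hs fun k => ?_)
    rw [norm_mul, norm_pow]
    exact mul_le_of_le_one_right (norm_nonneg _) (pow_le_one₀ (norm_nonneg _) ht)
  have ha : Summable fun k : ℕ =>
      a * (k * (aCoeff D.kappa k : ℂ) * c k * (4 * t * (1 - t)) ^ k) := by
    rcases h with h | rfl
    · have hT : Tame fun k => (aCoeff D.kappa k : ℂ) * c k := fun r hr0 hr1 =>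
        Summable.of_nonneg_of_le (fun k => by positivity)
          (fun k => mul_le_of_le_one_right (norm_nonneg _) (pow_le_one₀ hr0 hr1.le)) hs
      refine ((hT.nat_mul.summable h).mul_left a).congr fun k => ?_
      ring
    · simp [summable_zero]
  refine (ha.add hb).congr fun k => ?_
  rw [sigmaTerm_eq]

/-! ### The slit lens -/

/-- The open lens `|4 t (1 - t)| < 1`, `Re t < 1/2`, cut along the negative axis. -/
def slitLens : Set ℂ := {t | ‖4 * t * (1 - t)‖ < 1 ∧ t.re < 1 / 2 ∧ t ∈ Complex.slitPlane}

/-- The inverse of `t ↦ 4 t (1 - t)` on the half plane `Re t < 1/2`. -/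
noncomputable def lensParam (u : ℂ) : ℂ := (1 - (1 - u) ^ (2⁻¹ : ℂ)) / 2

lemma four_mul_lensParam (u : ℂ) : 4 * lensParam u * (1 - lensParam u) = u := by
  have h : ((1 - u) ^ (2⁻¹ : ℂ)) ^ 2 = 1 - u := Complex.cpow_nat_inv_pow (1 - u) two_ne_zero
  rw [lensParam]
  linear_combination -h

lemma lensParam_four_mul {t : ℂ} (ht : t.re < 1 / 2) : lensParam (4 * t * (1 - t)) = t := by
  have h : 0 < (1 - 2 * t).re := by simp; linarith
  rw [lensParam, show 1 - 4 * t * (1 - t) = (1 - 2 * t) ^ 2 by ring, Complex.sq_cpow_two_inv h]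
  ring

lemma lensParam_re_lt {u : ℂ} (hu : 1 - u ∈ Complex.slitPlane) : (lensParam u).re < 1 / 2 := by
  have h := re_cpow_pos (ν := -(1 / 2)) le_rfl (by norm_num) hu
  have h0 : ((1 - u) ^ ((-(1 / 2) : ℝ) : ℂ)) ≠ 0 := by
    intro h0; rw [h0] at h; simp at h
  have e : (1 - u) ^ (2⁻¹ : ℂ) = ((1 - u) ^ ((-(1 / 2) : ℝ) : ℂ))⁻¹ := by
    rw [← Complex.cpow_neg]
    congr 1
    push_cast
    norm_num
  have h2 : 0 < ((1 - u) ^ (2⁻¹ : ℂ)).re := by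
    rw [e, Complex.inv_re]
    exact div_pos h (Complex.normSq_pos.2 h0)
  have : lensParam u = ((1 / 2 : ℝ) : ℂ) * (1 - (1 - u) ^ (2⁻¹ : ℂ)) := by
    rw [lensParam]; push_cast; ring
  rw [this, Complex.re_ofReal_mul, Complex.sub_re, Complex.one_re]
  linarith

lemma one_sub_mem_slitPlane {u : ℂ} (hu : ‖u‖ ≤ 1) (hu1 : u ≠ 1) : 1 - u ∈ Complex.slitPlane := by
  rw [Complex.mem_slitPlane_iff]
  by_contra! h
  simp only [Complex.sub_re, Complex.one_re, Complex.sub_im, Complex.one_im] at h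
  have h1 := (Complex.re_le_norm u).trans hu
  exact hu1 (Complex.ext (by simp; linarith [h.1]) (by simp; linarith [h.2]))

lemma im_four_mul (t : ℂ) : (4 * t * (1 - t)).im = 4 * t.im * (1 - 2 * t.re) := by
  simp; ring

lemma re_four_mul {t : ℂ} (h : t.im = 0) : (4 * t * (1 - t)).re = 4 * t.re * (1 - t.re) := by
  simp [h]

lemma mem_slitPlane_of_four_mul {t : ℂ} (hre : t.re < 1 / 2)
    (h : 4 * t * (1 - t) ∈ Complex.slitPlane) : t ∈ Complex.slitPlane := by
  rw [Complex.mem_slitPlane_iff] at h ⊢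
  by_contra! h'
  rw [im_four_mul, re_four_mul h'.2, h'.2] at h
  rcases h with h | h
  · nlinarith [h'.1]
  · simp at h

lemma four_mul_mem_slitPlane {t : ℂ} (hre : t.re < 1 / 2) (h : t ∈ Complex.slitPlane) :
    4 * t * (1 - t) ∈ Complex.slitPlane := by
  rw [Complex.mem_slitPlane_iff] at h ⊢
  rw [im_four_mul]
  by_cases him : t.im = 0
  · left
    have : 0 < t.re := h.resolve_right (by simp [him])
    rw [re_four_mul him]
    exact mul_pos (by linarith) (by linarith)
  · right
    exact mul_ne_zero (mul_ne_zero four_ne_zero him) (by linarith)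

lemma slitLens_eq_image :
    slitLens = lensParam '' (Metric.ball 0 1 ∩ Complex.slitPlane) := by
  ext t
  constructor
  · rintro ⟨h1, h2, h3⟩
    exact ⟨4 * t * (1 - t), ⟨by simpa using h1, four_mul_mem_slitPlane h2 h3⟩,
      lensParam_four_mul h2⟩
  · rintro ⟨u, ⟨hu, hs⟩, rfl⟩
    rw [mem_ball_zero_iff] at hu
    have hre := lensParam_re_lt (one_sub_mem_slitPlane hu.le (by rintro rfl; simp at hu))
    refine ⟨by rwa [four_mul_lensParam], hre, mem_slitPlane_of_four_mul hre ?_⟩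
    rwa [four_mul_lensParam]

lemma continuousAt_lensParam {u : ℂ} (hu : 1 - u ∈ Complex.slitPlane) :
    ContinuousAt lensParam u := by
  unfold lensParam
  have : ContinuousAt (fun u : ℂ => (1 - u) ^ (2⁻¹ : ℂ)) u :=
    (continuousAt_const.sub continuousAt_id).cpow continuousAt_const hu
  exact (continuousAt_const.sub this).div_const _

/-- In the variable `u` the slit lens is the slit disc, which is star-shaped about `1/2`. -/
lemma isPreconnected_slitLens : IsPreconnected slitLens := by
  have hstar : StarConvex ℝ (((1 / 2 : ℝ) : ℂ)) (Metric.ball (0 : ℂ) 1 ∩ Complex.slitPlane) :=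
    ((convex_ball (0 : ℂ) 1).starConvex (by norm_num [mem_ball_zero_iff])).inter
      (Complex.starConvex_ofReal_slitPlane (by norm_num))
  rw [slitLens_eq_image]
  refine (hstar.isPathConnected ?_).isConnected.isPreconnected.image _ fun u hu => ?_
  · exact ⟨by norm_num [mem_ball_zero_iff], by norm_num [Complex.mem_slitPlane_iff]⟩
  · have hu1 := hu.1
    rw [mem_ball_zero_iff] at hu1
    exact (continuousAt_lensParam (one_sub_mem_slitPlane hu1.le
      (by rintro rfl; simp at hu1))).continuousWithinAt

lemma isOpen_slitLens : IsOpen slitLens := by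
  have h : Continuous fun t : ℂ => ‖4 * t * (1 - t)‖ := by fun_prop
  exact (isOpen_lt h continuous_const).inter
    ((isOpen_lt Complex.continuous_re continuous_const).inter Complex.isOpen_slitPlane)

lemma slitLens_subset_doubleSlit : slitLens ⊆ doubleSlit := fun t ht =>
  ⟨ht.2.2, Or.inl (by simp; linarith [ht.2.1])⟩

lemma isOpen_doubleSlit : IsOpen doubleSlit :=
  Complex.isOpen_slitPlane.inter
    (Complex.isOpen_slitPlane.preimage (continuous_const.sub continuous_id))

lemma isPreconnected_doubleSlit : IsPreconnected doubleSlit := by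
  have h : StarConvex ℝ (((1 / 2 : ℝ) : ℂ)) doubleSlit := by
    have h0 := Complex.starConvex_ofReal_slitPlane (x := 1 / 2) (by norm_num)
    refine h0.inter ?_
    intro y hy a b ha hb hab
    have h1 := h0 hy ha hb hab
    have hab' : (a : ℂ) + b = 1 := by exact_mod_cast hab
    have e : 1 - (a • (((1 / 2 : ℝ) : ℂ)) + b • y) = a • (((1 / 2 : ℝ) : ℂ)) + b • (1 - y) := by
      simp only [Complex.real_smul]
      push_cast
      linear_combination (-1 : ℂ) * hab'
    change 1 - (a • (((1 / 2 : ℝ) : ℂ)) + b • y) ∈ Complex.slitPlane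
    rwa [e]
  refine (h.isPathConnected ⟨?_, ?_⟩).isConnected.isPreconnected <;>
  norm_num [Complex.mem_slitPlane_iff]

lemma eq_of_hasDerivAt_zero {s : Set ℂ} (hs : IsOpen s) (hs' : IsPreconnected s) {f : ℂ → ℂ}
    (hf : ∀ z ∈ s, HasDerivAt f 0 z) {x y : ℂ} (hx : x ∈ s) (hy : y ∈ s) : f x = f y :=
  hs.is_const_of_deriv_eq_zero hs' (fun z hz => (hf z hz).differentiableAt.differentiableWithinAt)
    (fun z hz => (hf z hz).deriv) hx hy

/-- Small positive reals lie in the slit lens. -/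
lemma eventually_mem_slitLens : ∀ᶠ x : ℝ in 𝓝[>] 0, (x : ℂ) ∈ slitLens := by
  filter_upwards [Ioo_mem_nhdsGT (show (0 : ℝ) < 1 / 4 by norm_num)] with x hx
  refine ⟨?_, ?_, Or.inl (by simpa using hx.1)⟩
  · have : 4 * (x : ℂ) * (1 - x) = ((4 * x * (1 - x) : ℝ) : ℂ) := by push_cast; ring
    rw [this, Complex.norm_real, Real.norm_eq_abs, abs_lt]
    constructor <;> nlinarith [hx.1, hx.2]
  · simp only [Complex.ofReal_re]; linarith [hx.2]

lemma tendsto_ofReal_nhdsGT : Tendsto (fun x : ℝ => (x : ℂ)) (𝓝[>] 0) (𝓝 0) := by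
  have := Complex.continuous_ofReal.tendsto (0 : ℝ)
  rw [Complex.ofReal_zero] at this
  exact this.mono_left nhdsWithin_le_nhds

/-- A locally constant function on the slit lens is determined by its limit at the origin. -/
lemma eq_of_hasDerivAt_zero_of_continuousAt {f : ℂ → ℂ} (hf : ∀ z ∈ slitLens, HasDerivAt f 0 z)
    (h0 : ContinuousAt f 0) {t : ℂ} (ht : t ∈ slitLens) : f t = f 0 := by
  have h1 : Tendsto (fun x : ℝ => f x) (𝓝[>] 0) (𝓝 (f 0)) := h0.tendsto.comp tendsto_ofReal_nhdsGT
  refine tendsto_nhds_unique (Tendsto.congr' ?_ tendsto_const_nhds) h1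
  filter_upwards [eventually_mem_slitLens] with x hx
  exact eq_of_hasDerivAt_zero isOpen_slitLens isPreconnected_slitLens hf ht hx

/-! ### The two solutions of Legendre's equation -/

section Solutions
variable (D : Degree)

/-- The solution `t ↦ P_ν(1 - 2t)`, regular at `t = 0`. -/
noncomputable def regSol (t : ℂ) : ℂ := shiftedP D.nu (1 - t)

/-- The derivative of `regSol`. -/
noncomputable def regSol' (t : ℂ) : ℂ := -shiftedP' D.nu (1 - t)

/-- The solution `t ↦ P_ν(2t - 1)`, logarithmic at `t = 0`. -/
noncomputable def logSol (t : ℂ) : ℂ := shiftedP D.nu t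

/-- The derivative of `logSol`. -/
noncomputable def logSol' (t : ℂ) : ℂ := shiftedP' D.nu t

/-- The constant `sin (νπ) / π`, the Wronskian of the two solutions. -/
noncomputable def wronskianConst : ℝ := Real.sin (D.nu * Real.pi) / Real.pi

variable {D}

lemma hasDerivAt_one_sub (t : ℂ) : HasDerivAt (fun t : ℂ => 1 - t) (-1) t := by
  simpa using (hasDerivAt_id t).const_sub 1

lemma cast_kappa : (D.kappa : ℂ) = -D.nu * (D.nu + 1) := by
  rw [Degree.kappa]; push_cast; ring

lemma hasDerivAt_regSol {t : ℂ} (ht : 1 - t ∈ Complex.slitPlane) :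
    HasDerivAt (regSol D) (regSol' D t) t := by
  have := (hasDerivAt_shiftedP D.neg_one_lt_nu D.nu_neg ht).comp t (hasDerivAt_one_sub t)
  rwa [mul_neg_one] at this

lemma hasDerivAt_logSol {t : ℂ} (ht : t ∈ Complex.slitPlane) :
    HasDerivAt (logSol D) (logSol' D t) t := hasDerivAt_shiftedP D.neg_one_lt_nu D.nu_neg ht

lemma hasDerivAt_mul_regSol' {t : ℂ} (ht : 1 - t ∈ Complex.slitPlane) :
    HasDerivAt (fun t => t * (1 - t) * regSol' D t) (D.kappa * regSol D t) t := by
  have := ((hasDerivAt_mul_shiftedP' D.neg_one_lt_nu D.nu_neg ht).comp t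
    (hasDerivAt_one_sub t)).neg
  refine (this.congr_deriv ?_).congr_of_eventuallyEq (Eventually.of_forall fun z => ?_)
  · rw [cast_kappa, regSol]; ring
  · simp only [Pi.neg_apply, Function.comp_apply, regSol']; ring

lemma hasDerivAt_mul_logSol' {t : ℂ} (ht : t ∈ Complex.slitPlane) :
    HasDerivAt (fun t => t * (1 - t) * logSol' D t) (D.kappa * logSol D t) t := by
  rw [cast_kappa]
  exact hasDerivAt_mul_shiftedP' D.neg_one_lt_nu D.nu_neg ht

lemma regSol_ne_zero {t : ℂ} (ht : 1 - t ∈ Complex.slitPlane) : regSol D t ≠ 0 :=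
  shiftedP_ne_zero D.neg_half_le_nu D.nu_neg ht

lemma regSol_zero : regSol D 0 = 1 := by
  rw [regSol, sub_zero, shiftedP_one D.neg_one_lt_nu D.nu_neg]

lemma wronskianConst_neg : wronskianConst D < 0 :=
  div_neg_of_neg_of_pos (sin_nu_pi_neg D.neg_one_lt_nu D.nu_neg) Real.pi_pos

lemma hasDerivAt_four_mul (t : ℂ) :
    HasDerivAt (fun t : ℂ => 4 * t * (1 - t)) (4 * (1 - 2 * t)) t := by
  have := ((hasDerivAt_id t).const_mul 4).mul (hasDerivAt_one_sub t)
  refine this.congr_deriv ?_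
  simp only [id]; ring

lemma hasDerivAt_one_sub_two_mul (t : ℂ) : HasDerivAt (fun t : ℂ => 1 - 2 * t) (-2) t := by
  simpa using ((hasDerivAt_id t).const_mul 2).const_sub 1

lemma mul_one_sub_ne_zero {t : ℂ} (ht : t ∈ doubleSlit) : t * (1 - t) ≠ 0 :=
  mul_ne_zero (Complex.slitPlane_ne_zero ht.1) (Complex.slitPlane_ne_zero ht.2)

/-- On the slit lens the Wronskian series is `(1 - u) ^ (-1/2) = (1 - 2t)⁻¹`. -/
lemma one_sub_two_mul_mul_wFun {t : ℂ} (ht : t ∈ slitLens) :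
    (1 - 2 * t) * wFun D.kappa (4 * t * (1 - t)) = 1 := by
  have hd : ∀ z : ℂ, ‖4 * z * (1 - z)‖ < 1 →
      HasDerivAt (fun t : ℂ => (1 - 2 * t) * wFun D.kappa (4 * t * (1 - t))) 0 z := by
    intro z hz
    obtain ⟨d, hd, he⟩ := exists_hasDerivAt_wFun D.kappa hz
    have h := (hasDerivAt_one_sub_two_mul z).mul (hd.comp z (hasDerivAt_four_mul z))
    refine h.congr_deriv ?_
    simp only [Function.comp_apply]
    linear_combination 2 * he
  have := eq_of_hasDerivAt_zero_of_continuousAt (fun z hz => hd z hz.1)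
    (hd 0 (by simp)).continuousAt ht
  simpa [wFun_zero] using this

/-- On the slit lens the regular solution is the Gauss series in `4 t (1 - t)`: both satisfy
Legendre's equation and are regular at the origin. -/
lemma regSol_eq_gFun {t : ℂ} (ht : t ∈ slitLens) :
    regSol D t = gFun D.kappa (4 * t * (1 - t)) := by
  have hk0 := D.kappa_pos
  have hk1 := D.kappa_le
  have hg : ∀ z : ℂ, ‖4 * z * (1 - z)‖ < 1 → HasDerivAt
      (fun t : ℂ => gFun D.kappa (4 * t * (1 - t)))
      (gFun' D.kappa (4 * z * (1 - z)) * (4 * (1 - 2 * z))) z := fun z hz =>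
    (hasDerivAt_gFun hk0 hk1 hz).comp z (hasDerivAt_four_mul z)
  -- the Wronskian of the two functions
  have hW : ∀ z : ℂ, ‖4 * z * (1 - z)‖ < 1 → 1 - z ∈ Complex.slitPlane → HasDerivAt
      (fun t : ℂ => (1 - 2 * t) * (4 * t * (1 - t) * gFun' D.kappa (4 * t * (1 - t))) * regSol D t
        - t * (1 - t) * regSol' D t * gFun D.kappa (4 * t * (1 - t))) 0 z := by
    intro z hz hz'
    obtain ⟨d, hd, he⟩ := exists_hasDerivAt_theta_gFun hk0 hk1 hz
    have h := (((hasDerivAt_one_sub_two_mul z).mul (hd.comp z (hasDerivAt_four_mul z))).mul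
      (hasDerivAt_regSol (D := D) hz')).sub ((hasDerivAt_mul_regSol' (D := D) hz').mul (hg z hz))
    refine h.congr_deriv ?_
    simp only [Function.comp_apply, Pi.mul_apply]
    linear_combination regSol D z * he
  have h0 : (1 : ℂ) - 0 ∈ Complex.slitPlane := by simp
  have hu0 : ‖(4 : ℂ) * 0 * (1 - 0)‖ < 1 := by simp
  -- it is constant, and vanishes at the origin
  have hW0 : ∀ z ∈ slitLens, (1 - 2 * z) * (4 * z * (1 - z) * gFun' D.kappa (4 * z * (1 - z)))
      * regSol D z - z * (1 - z) * regSol' D z * gFun D.kappa (4 * z * (1 - z)) = 0 :=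
    fun z hz => by
      have := eq_of_hasDerivAt_zero_of_continuousAt
        (fun z hz => hW z hz.1 (slitLens_subset_doubleSlit hz).2) (hW 0 hu0 h0).continuousAt hz
      simpa using this
  -- the vanishing Wronskian makes the quotient constant
  have hquot := eq_of_hasDerivAt_zero_of_continuousAt
    (f := fun t => gFun D.kappa (4 * t * (1 - t)) / regSol D t) (fun z hz => by
      have hz' := slitLens_subset_doubleSlit hz
      have hne := regSol_ne_zero (D := D) hz'.2
      refine ((hg z hz.1).div (hasDerivAt_regSol hz'.2) hne).congr_deriv ?_
      rw [div_eq_zero_iff]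
      left
      apply mul_left_cancel₀ (mul_one_sub_ne_zero hz')
      linear_combination hW0 z hz)
    ((hg 0 hu0).div (hasDerivAt_regSol h0) (regSol_ne_zero h0)).continuousAt ht
  have hne := regSol_ne_zero (D := D) (slitLens_subset_doubleSlit ht).2
  simp only [mul_zero, zero_mul, gFun_zero, regSol_zero, div_one] at hquot
  exact ((div_eq_one_iff_eq hne).1 hquot).symm

/-- The logarithm of `t (1 - t) / K` completed to a quotient of two solutions of Legendre's
equation. -/
noncomputable def logQuot (D : Degree) (t : ℂ) : ℂ := Complex.log (seriesVar D t)
  + jFun D.kappa (4 * t * (1 - t)) / gFun D.kappa (4 * t * (1 - t))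

lemma seriesVar_eq_ofReal_mul (D : Degree) (t : ℂ) :
    seriesVar D t = ((1 / (4 * seriesConst D) : ℝ) : ℂ) * (4 * t * (1 - t)) := by
  have : (seriesConst D : ℂ) ≠ 0 := by exact_mod_cast (seriesConst_pos D).ne'
  rw [seriesVar_eq]; push_cast; field_simp

lemma seriesVar_mem_slitPlane {t : ℂ} (h : 4 * t * (1 - t) ∈ Complex.slitPlane) :
    seriesVar D t ∈ Complex.slitPlane := by
  have hK := seriesConst_pos D
  have hp : 0 < 1 / (4 * seriesConst D) := by positivity
  rw [seriesVar_eq_ofReal_mul, Complex.mem_slitPlane_iff, Complex.re_ofReal_mul,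
    Complex.im_ofReal_mul]
  exact (Complex.mem_slitPlane_iff.1 h).imp (mul_pos hp) (mul_ne_zero hp.ne')

lemma hasDerivAt_seriesVar (D : Degree) (t : ℂ) :
    HasDerivAt (seriesVar D) ((1 - 2 * t) / seriesConst D) t := by
  have hK : (seriesConst D : ℂ) ≠ 0 := by exact_mod_cast (seriesConst_pos D).ne'
  have := (hasDerivAt_four_mul t).div_const (4 * (seriesConst D : ℂ))
  refine (this.congr_deriv (by field_simp)).congr_of_eventuallyEq
    (Eventually.of_forall fun z => ?_)
  rw [seriesVar_eq]; field_simp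

lemma hasDerivAt_logQuot {t : ℂ} (ht : t ∈ slitLens) :
    HasDerivAt (logQuot D) (1 / (t * (1 - t) * regSol D t ^ 2)) t := by
  have hk0 := D.kappa_pos
  have hk1 := D.kappa_le
  have ht' := slitLens_subset_doubleSlit ht
  have hp := mul_one_sub_ne_zero ht'
  have hF := regSol_ne_zero (D := D) ht'.2
  rw [regSol_eq_gFun ht] at hF ⊢
  have hK : (seriesConst D : ℂ) ≠ 0 := by exact_mod_cast (seriesConst_pos D).ne'
  have hj := (hasDerivAt_jFun hk0 hk1 ht.1).comp t (hasDerivAt_four_mul t)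
  have hg := (hasDerivAt_gFun hk0 hk1 ht.1).comp t (hasDerivAt_four_mul t)
  have hlog := (hasDerivAt_seriesVar D t).clog
    (seriesVar_mem_slitPlane (four_mul_mem_slitPlane ht.2.1 ht.2.2))
  refine (hlog.add (hj.div hg hF)).congr_deriv ?_
  have hw := wFun_eq hk0 hk1 ht.1
  have hw1 := one_sub_two_mul_mul_wFun (D := D) ht
  rw [hw] at hw1
  have hX0 : seriesVar D t ≠ 0 := by
    rw [seriesVar_eq]; exact div_ne_zero hp hK
  simp only [Function.comp_apply]
  rw [seriesVar_eq]
  have ht0 := left_ne_zero_of_mul hp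
  have ht1 := right_ne_zero_of_mul hp
  generalize gFun' D.kappa (4 * t * (1 - t)) = g' at *
  generalize jFun' D.kappa (4 * t * (1 - t)) = j' at *
  generalize gFun D.kappa (4 * t * (1 - t)) = g at *
  generalize jFun D.kappa (4 * t * (1 - t)) = j at *
  field_simp
  linear_combination hw1

end Solutions

/-! ### The Wronskian and the logarithmic solution -/

section Wronskian
variable {D : Degree}

lemma hasDerivAt_wronskian {t : ℂ} (ht : t ∈ doubleSlit) :
    HasDerivAt (fun t => regSol D t * (t * (1 - t) * logSol' D t)
      - t * (1 - t) * regSol' D t * logSol D t) 0 t := by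
  refine (((hasDerivAt_regSol (D := D) ht.2).mul (hasDerivAt_mul_logSol' ht.1)).sub
    ((hasDerivAt_mul_regSol' (D := D) ht.2).mul (hasDerivAt_logSol ht.1))).congr_deriv ?_
  ring

lemma hasDerivAt_logSol_div {t : ℂ} (ht : t ∈ doubleSlit) :
    HasDerivAt (fun t => logSol D t / regSol D t)
      ((regSol D t * (t * (1 - t) * logSol' D t) - t * (1 - t) * regSol' D t * logSol D t)
        / (t * (1 - t) * regSol D t ^ 2)) t := by
  have hF := regSol_ne_zero (D := D) ht.2
  have hp := mul_one_sub_ne_zero ht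
  refine ((hasDerivAt_logSol ht.1).div (hasDerivAt_regSol ht.2) hF).congr_deriv ?_
  rw [div_eq_div_iff (pow_ne_zero 2 hF) (mul_ne_zero hp (pow_ne_zero 2 hF))]
  ring

/-- The real function `log t - log K`, the leading term of `logQuot` at the origin. -/
noncomputable def logLead (D : Degree) (x : ℝ) : ℂ :=
  ((Real.log x - Real.log (seriesConst D) : ℝ) : ℂ)

lemma continuousAt_jFun_div_gFun_zero : ContinuousAt (fun t : ℂ =>
    jFun D.kappa (4 * t * (1 - t)) / gFun D.kappa (4 * t * (1 - t))) 0 := by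
  have hu : ‖(4 : ℂ) * 0 * (1 - 0)‖ < 1 := by simp
  have hj := (hasDerivAt_jFun D.kappa_pos D.kappa_le hu).comp (0 : ℂ) (hasDerivAt_four_mul 0)
  have hg := (hasDerivAt_gFun D.kappa_pos D.kappa_le hu).comp (0 : ℂ) (hasDerivAt_four_mul 0)
  exact hj.continuousAt.div hg.continuousAt (by simp [gFun_zero])

lemma tendsto_logQuot_sub : Tendsto (fun x : ℝ => logQuot D x - logLead D x) (𝓝[>] 0) (𝓝 0) := by
  have h1 := (continuousAt_jFun_div_gFun_zero (D := D)).tendsto.comp tendsto_ofReal_nhdsGT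
  simp only [mul_zero, zero_mul, gFun_zero, jFun_zero, zero_div] at h1
  have h2 : Tendsto (fun x : ℝ => ((Real.log (1 - x) : ℝ) : ℂ)) (𝓝[>] 0) (𝓝 0) := by
    have : ContinuousAt (fun x : ℝ => ((Real.log (1 - x) : ℝ) : ℂ)) 0 :=
      Complex.continuous_ofReal.continuousAt.comp
        (ContinuousAt.log (by fun_prop) (by norm_num))
    simpa using this.tendsto.mono_left nhdsWithin_le_nhds
  have h3 := h2.add h1
  rw [add_zero] at h3
  refine h3.congr' ?_
  filter_upwards [Ioo_mem_nhdsGT (show (0 : ℝ) < 1 by norm_num)] with x hx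
  have hK := seriesConst_pos D
  have hx1 : 0 < 1 - x := by linarith [hx.2]
  have e : seriesVar D x = ((x * (1 - x) / seriesConst D : ℝ) : ℂ) := by
    rw [seriesVar_eq]; push_cast; ring
  have hpos : 0 < x * (1 - x) := mul_pos hx.1 hx1
  rw [logQuot, e, ← Complex.ofReal_log (by positivity), Real.log_div hpos.ne' hK.ne',
    Real.log_mul hx.1.ne' hx1.ne', logLead]
  simp only [Function.comp_apply]
  push_cast
  ring

lemma tendsto_regSol_sub_one_mul :
    Tendsto (fun x : ℝ => (regSol D x - 1) * logLead D x) (𝓝[>] 0) (𝓝 0) := by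
  have h0 : (1 : ℂ) - 0 ∈ Complex.slitPlane := by simp
  have hd := (hasDerivAt_regSol (D := D) h0).tendsto_slope
  have hs : Tendsto (fun x : ℝ => slope (regSol D) 0 x) (𝓝[>] 0) (𝓝 (regSol' D 0)) := by
    refine hd.comp (tendsto_nhdsWithin_iff.2 ⟨tendsto_ofReal_nhdsGT, ?_⟩)
    filter_upwards [self_mem_nhdsWithin] with x hx
    simpa using (ne_of_gt hx : x ≠ 0)
  have hl : Tendsto (fun x : ℝ => (x : ℂ) * logLead D x) (𝓝[>] 0) (𝓝 0) := by
    have h1 := tendsto_log_mul_rpow_nhdsGT_zero zero_lt_one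
    have h2 : Tendsto (fun x : ℝ => Real.log (seriesConst D) * x) (𝓝[>] 0) (𝓝 0) := by
      have : Continuous fun x : ℝ => Real.log (seriesConst D) * x := by fun_prop
      simpa using (this.tendsto 0).mono_left nhdsWithin_le_nhds
    have h3 := (Complex.continuous_ofReal.tendsto _).comp (h1.sub h2)
    simp only [sub_zero, Complex.ofReal_zero] at h3
    refine h3.congr fun x => ?_
    simp only [Function.comp_apply, Real.rpow_one, logLead]
    push_cast; ring
  have := hs.mul hl
  rw [mul_zero] at this
  refine this.congr' ?_
  filter_upwards [self_mem_nhdsWithin] with x hx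
  have hx0 : (x : ℂ) ≠ 0 := by exact_mod_cast (ne_of_gt hx : x ≠ 0)
  rw [slope_def_field, regSol_zero, sub_zero]
  field_simp

lemma tendsto_norm_logLead : Tendsto (fun x : ℝ => ‖logLead D x‖) (𝓝[>] 0) atTop := by
  simp only [logLead, Complex.norm_real, Real.norm_eq_abs]
  exact tendsto_abs_atBot_atTop.comp
    (tendsto_atBot_add_const_right _ (-Real.log (seriesConst D)) Real.tendsto_log_nhdsGT_zero)

/-- The Wronskian of `P_ν(1 - 2t)` and `P_ν(2t - 1)`, and the second solution on the slit lens. With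
an unknown Wronskian `c` and an unknown constant of integration `A`, the expansion at the origin
involves `c log t` and `A`; both are read off from `tendsto_shiftedP_sub_log`. -/
lemma wronskian_and_logSol :
    (∀ t ∈ doubleSlit, regSol D t * (t * (1 - t) * logSol' D t)
      - t * (1 - t) * regSol' D t * logSol D t = wronskianConst D) ∧
    ∀ t ∈ slitLens, logSol D t = regSol D t * (wronskianConst D * logQuot D t) := by
  have hhalf : (1 / 2 : ℂ) ∈ doubleSlit := by
    constructor <;> norm_num [Complex.mem_slitPlane_iff]
  obtain ⟨c, hc⟩ : ∃ c, ∀ t ∈ doubleSlit, regSol D t * (t * (1 - t) * logSol' D t)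
      - t * (1 - t) * regSol' D t * logSol D t = c :=
    ⟨_, fun t ht => eq_of_hasDerivAt_zero isOpen_doubleSlit isPreconnected_doubleSlit
      (fun z hz => hasDerivAt_wronskian hz) ht hhalf⟩
  obtain ⟨x₀, hx₀⟩ := (eventually_mem_slitLens).exists
  obtain ⟨A, hA⟩ : ∃ A, ∀ t ∈ slitLens, logSol D t / regSol D t - c * logQuot D t = A :=
    ⟨_, fun t ht => eq_of_hasDerivAt_zero isOpen_slitLens isPreconnected_slitLens
      (fun z hz => by
        have hz' := slitLens_subset_doubleSlit hz
        refine ((hasDerivAt_logSol_div (D := D) hz').sub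
          ((hasDerivAt_logQuot (D := D) hz).const_mul c)).congr_deriv ?_
        rw [hc z hz']
        ring) ht hx₀⟩
  have hG : ∀ t ∈ slitLens, logSol D t = regSol D t * (c * logQuot D t + A) := fun t ht => by
    have hF := regSol_ne_zero (D := D) (slitLens_subset_doubleSlit ht).2
    rw [← hA t ht]
    field_simp
    ring
  have h0 : (1 : ℂ) - 0 ∈ Complex.slitPlane := by simp
  have hF0 : Tendsto (fun x : ℝ => regSol D x) (𝓝[>] 0) (𝓝 1) := by
    have := (hasDerivAt_regSol (D := D) h0).continuousAt.tendsto.comp tendsto_ofReal_nhdsGT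
    rwa [regSol_zero] at this
  have hlim : Tendsto (fun x : ℝ => logSol D x - c * logLead D x) (𝓝[>] 0) (𝓝 A) := by
    have h1 := (tendsto_regSol_sub_one_mul (D := D)).const_mul c
    have h2 := hF0.mul (((tendsto_logQuot_sub (D := D)).const_mul c).add_const A)
    have h3 := h1.add h2
    simp only [mul_zero, zero_add, one_mul] at h3
    refine h3.congr' ?_
    filter_upwards [eventually_mem_slitLens] with x hx
    rw [hG x hx]
    ring
  have hlim' := tendsto_shiftedP_sub_log D.neg_one_lt_nu D.nu_neg
  have hdiff : Tendsto (fun x : ℝ => (wronskianConst D - c) * logLead D x) (𝓝[>] 0) (𝓝 A) := by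
    have := hlim.sub hlim'
    rw [sub_zero] at this
    refine this.congr fun x => ?_
    simp only [wronskianConst, logLead, logSol]
    ring
  -- a multiple of the unbounded function `logLead` converges, hence the factor vanishes
  have hcs : (wronskianConst D : ℂ) - c = 0 := by
    have h := hdiff.norm.mul (tendsto_inv_atTop_zero.comp (tendsto_norm_logLead (D := D)))
    rw [mul_zero] at h
    have h' : Tendsto (fun _ : ℝ => ‖(wronskianConst D : ℂ) - c‖) (𝓝[>] 0) (𝓝 0) := by
      refine h.congr' ?_
      filter_upwards [(tendsto_norm_logLead (D := D)).eventually_gt_atTop 0] with x hx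
      rw [norm_mul, Function.comp_apply, mul_inv_cancel_right₀ hx.ne']
    exact norm_eq_zero.1 (tendsto_nhds_unique tendsto_const_nhds h')
  have hA0 : A = 0 := by
    simp only [hcs, zero_mul] at hdiff
    exact tendsto_nhds_unique hdiff tendsto_const_nhds
  have hc' : c = wronskianConst D := (sub_eq_zero.1 hcs).symm
  refine ⟨fun t ht => by rw [hc t ht, hc'], fun t ht => ?_⟩
  rw [hG t ht, hA0, hc', add_zero]

lemma wronskian_eq {t : ℂ} (ht : t ∈ doubleSlit) :
    regSol D t * (t * (1 - t) * logSol' D t) - t * (1 - t) * regSol' D t * logSol D t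
      = wronskianConst D := wronskian_and_logSol.1 t ht

lemma logSol_eq {t : ℂ} (ht : t ∈ slitLens) :
    logSol D t = regSol D t * (wronskianConst D * logQuot D t) := wronskian_and_logSol.2 t ht

end Wronskian

/-! ### The sums on the open slit lens -/

section Sums
variable {D : Degree}

/-- The difference `P_ν(2t - 1) / (s P_ν(1 - 2t)) - log X_ν(t)`, with `s = sin (νπ) / π`. -/
noncomputable def logDefect (D : Degree) (t : ℂ) : ℂ :=
  logSol D t / (wronskianConst D * regSol D t) - Complex.log (seriesVar D t)

lemma jFun_eq_regSol_mul_logDefect {t : ℂ} (ht : t ∈ slitLens) :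
    jFun D.kappa (4 * t * (1 - t)) = regSol D t * logDefect D t := by
  have hF := regSol_ne_zero (D := D) (slitLens_subset_doubleSlit ht).2
  have hs : (wronskianConst D : ℂ) ≠ 0 := by exact_mod_cast wronskianConst_neg.ne
  rw [logDefect, logSol_eq ht, logQuot, ← regSol_eq_gFun ht]
  field_simp
  ring

lemma hasDerivAt_logDefect {t : ℂ} (ht : t ∈ slitLens) : HasDerivAt (logDefect D)
    (1 / (t * (1 - t) * regSol D t ^ 2) - (1 - 2 * t) / (t * (1 - t))) t := by
  have ht' := slitLens_subset_doubleSlit ht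
  have hF := regSol_ne_zero (D := D) ht'.2
  have hp := mul_one_sub_ne_zero ht'
  have hs : (wronskianConst D : ℂ) ≠ 0 := by exact_mod_cast wronskianConst_neg.ne
  have hK : (seriesConst D : ℂ) ≠ 0 := by exact_mod_cast (seriesConst_pos D).ne'
  have hlog := (hasDerivAt_seriesVar D t).clog
    (seriesVar_mem_slitPlane (four_mul_mem_slitPlane ht.2.1 ht.2.2))
  have h := (hasDerivAt_logSol_div (D := D) ht').div_const (wronskianConst D : ℂ)
  rw [wronskian_eq ht'] at h
  refine ((h.sub hlog).congr_deriv ?_).congr_of_eventuallyEq (Eventually.of_forall fun z => ?_)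
  · rw [seriesVar_eq]
    have ht0 := left_ne_zero_of_mul hp
    have ht1 := right_ne_zero_of_mul hp
    field_simp
  · rw [logDefect]; simp only [Pi.sub_apply]; congr 1; rw [div_div, mul_comm]

/-- A power series in `u = 4 t (1 - t)` is differentiated termwise. -/
lemma powerSum_nat_mul_of_hasDerivAt {c : ℕ → ℂ} (hc : Tame c) {f : ℂ → ℂ} {f' t : ℂ}
    (hf : ∀ z ∈ slitLens, powerSum c (4 * z * (1 - z)) = f z) (ht : t ∈ slitLens)
    (hd : HasDerivAt f f' t) :
    (1 - 2 * t) * powerSum (fun k => k * c k) (4 * t * (1 - t)) = t * (1 - t) * f' := by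
  have h := (hasDerivAt_powerSum hc ht.1).comp t (hasDerivAt_four_mul t)
  have h' : HasDerivAt f _ t := h.congr_of_eventuallyEq <| by
    filter_upwards [isOpen_slitLens.mem_nhds ht] with z hz using (hf z hz).symm
  rw [powerSum_nat_mul hc ht.1, hd.unique h']
  ring

end Sums

section Weighted
variable {D : Degree}

/-- The sum `∑ a_k m_k u ^ k` of Clausen's series with weights `m`. -/
noncomputable def clausenSum (D : Degree) (m : ℕ → ℂ) : ℂ → ℂ :=
  abelSum fun k => (aCoeff D.kappa k : ℂ) * m k

/-- The sum `∑ k a_k m_k u ^ k`. -/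
noncomputable def clausenSum' (D : Degree) (m : ℕ → ℂ) : ℂ → ℂ :=
  abelSum fun k => (k : ℂ) * (aCoeff D.kappa k : ℂ) * m k

lemma boundedVar_aCoeff_mul {m : ℕ → ℂ} (hm : BoundedVar m) :
    BoundedVar fun k => (aCoeff D.kappa k : ℂ) * m k :=
  (boundedVar_aCoeff D.kappa_pos D.kappa_le).mul hm

lemma boundedVar_nat_mul_aCoeff_mul {m : ℕ → ℂ} (hm : BoundedVar m) :
    BoundedVar fun k : ℕ => (k : ℂ) * (aCoeff D.kappa k : ℂ) * m k :=
  (boundedVar_nat_mul_aCoeff D.kappa_pos D.kappa_le).mul hm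

lemma tendsto_aCoeff_mul {m : ℕ → ℂ} (hm : BoundedVar m) :
    Tendsto (fun k => (aCoeff D.kappa k : ℂ) * m k) atTop (𝓝 0) :=
  tendsto_mul_boundedVar (tendsto_aCoeff D.kappa_pos D.kappa_le) hm

lemma tendsto_nat_mul_aCoeff_mul {m : ℕ → ℂ} (hm : BoundedVar m) :
    Tendsto (fun k : ℕ => (k : ℂ) * (aCoeff D.kappa k : ℂ) * m k) atTop (𝓝 0) :=
  tendsto_mul_boundedVar (tendsto_nat_mul_aCoeff D.kappa_pos D.kappa_le) hm

lemma hasSigma_clausenSum {m : ℕ → ℂ} (hm : BoundedVar m) {t : ℂ}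
    (ht : ‖4 * t * (1 - t)‖ ≤ 1) (ht1 : 4 * t * (1 - t) ≠ 1) (a b : ℂ) :
    HasSigma D a b m t (a * clausenSum' D m (4 * t * (1 - t))
      + b * clausenSum D m (4 * t * (1 - t))) := by
  have h1 := (tendsto_sum_abelSum (boundedVar_nat_mul_aCoeff_mul (D := D) hm)
    (tendsto_nat_mul_aCoeff_mul hm) ht ht1).const_mul a
  have h2 := (tendsto_sum_abelSum (boundedVar_aCoeff_mul (D := D) hm)
    (tendsto_aCoeff_mul hm) ht ht1).const_mul b
  refine (h1.add h2).congr fun n => ?_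
  rw [Finset.mul_sum, Finset.mul_sum, ← Finset.sum_add_distrib]
  exact Finset.sum_congr rfl fun k _ => (sigmaTerm_eq D a b m t k).symm

lemma clausenSum_eq_powerSum {m : ℕ → ℂ} (hm : BoundedVar m) {u : ℂ} (hu : ‖u‖ < 1) :
    clausenSum D m u = powerSum (fun k => (aCoeff D.kappa k : ℂ) * m k) u :=
  abelSum_eq_powerSum (boundedVar_aCoeff_mul hm) (tendsto_aCoeff_mul hm) hu

/-- If `∑ a_k m_k u ^ k = f (t)` on the slit lens, then `∑ k a_k m_k u ^ k` is given by `f'`. -/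
lemma clausenSum'_eq {m : ℕ → ℂ} (hm : BoundedVar m) {f : ℂ → ℂ} {f' t : ℂ}
    (hf : ∀ z ∈ slitLens, clausenSum D m (4 * z * (1 - z)) = f z) (ht : t ∈ slitLens)
    (hd : HasDerivAt f f' t) :
    (1 - 2 * t) * clausenSum' D m (4 * t * (1 - t)) = t * (1 - t) * f' := by
  obtain ⟨C, hC0, hC⟩ := (boundedVar_aCoeff_mul (D := D) hm).exists_bound
  have hT : Tame fun k => (aCoeff D.kappa k : ℂ) * m k := Tame.of_le (C := C) fun k =>
    (hC k).trans (le_add_of_nonneg_left (by positivity))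
  rw [← powerSum_nat_mul_of_hasDerivAt hT
    (fun z hz => by rw [← clausenSum_eq_powerSum hm hz.1, hf z hz]) ht hd, clausenSum',
    abelSum_eq_powerSum (boundedVar_nat_mul_aCoeff_mul hm) (tendsto_nat_mul_aCoeff_mul hm) ht.1]
  simp only [mul_assoc]

/-- The weights of the log-squared series. -/
noncomputable def logSqCoeff (κ : ℝ) (k : ℕ) : ℂ := (logCoeff κ k : ℂ) ^ 2 + (logCoeff₂ κ k : ℂ)

lemma boundedVar_logSqCoeff : BoundedVar (logSqCoeff D.kappa) := by
  have h := boundedVar_logCoeff D.kappa_pos D.kappa_le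
  have h2 := (h.mul h).add (boundedVar_logCoeff₂ D.kappa_pos D.kappa_le)
  simp only [← sq] at h2
  exact h2

lemma clausenSum_one {t : ℂ} (ht : t ∈ slitLens) :
    clausenSum D (fun _ => 1) (4 * t * (1 - t)) = regSol D t ^ 2 := by
  rw [clausenSum_eq_powerSum (boundedVar_const 1) ht.1]
  simp only [mul_one]
  rw [gFun_sq D.kappa_pos D.kappa_le ht.1, ← regSol_eq_gFun ht, sq]

lemma clausenSum_log {t : ℂ} (ht : t ∈ slitLens) :
    clausenSum D (fun k => (logCoeff D.kappa k : ℂ)) (4 * t * (1 - t))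
      = regSol D t ^ 2 * logDefect D t := by
  rw [clausenSum_eq_powerSum (boundedVar_logCoeff D.kappa_pos D.kappa_le) ht.1]
  have := gFun_mul_jFun D.kappa_pos D.kappa_le ht.1
  push_cast at this
  rw [this, ← regSol_eq_gFun ht, jFun_eq_regSol_mul_logDefect ht]
  ring

lemma clausenSum_logSq {t : ℂ} (ht : t ∈ slitLens) :
    clausenSum D (logSqCoeff D.kappa) (4 * t * (1 - t))
      = regSol D t ^ 2 * logDefect D t ^ 2 := by
  rw [clausenSum_eq_powerSum boundedVar_logSqCoeff ht.1]
  have := jFun_sq D.kappa_pos D.kappa_le ht.1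
  push_cast at this
  simp only [logSqCoeff]
  rw [this, jFun_eq_regSol_mul_logDefect ht]
  ring

lemma clausenSum'_one {t : ℂ} (ht : t ∈ slitLens) :
    (1 - 2 * t) * clausenSum' D (fun _ => 1) (4 * t * (1 - t))
      = 2 * (t * (1 - t) * regSol' D t) * regSol D t := by
  have hd := (hasDerivAt_regSol (D := D) (slitLens_subset_doubleSlit ht).2).pow 2
  rw [clausenSum'_eq (boundedVar_const 1) (fun z hz => clausenSum_one hz) ht hd]
  push_cast
  ring

lemma clausenSum'_log {t : ℂ} (ht : t ∈ slitLens) :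
    (1 - 2 * t) * clausenSum' D (fun k => (logCoeff D.kappa k : ℂ)) (4 * t * (1 - t))
      = 2 * (t * (1 - t) * regSol' D t) * regSol D t * logDefect D t + 1
        - regSol D t ^ 2 * (1 - 2 * t) := by
  have ht' := slitLens_subset_doubleSlit ht
  have hF := regSol_ne_zero (D := D) ht'.2
  have ht0 := Complex.slitPlane_ne_zero ht'.1
  have ht1 := Complex.slitPlane_ne_zero ht'.2
  have hd := ((hasDerivAt_regSol (D := D) ht'.2).pow 2).mul (hasDerivAt_logDefect (D := D) ht)
  rw [clausenSum'_eq (boundedVar_logCoeff D.kappa_pos D.kappa_le)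
    (fun z hz => clausenSum_log hz) ht hd]
  push_cast
  simp only [Pi.pow_apply]
  field_simp
  ring

lemma clausenSum'_logSq {t : ℂ} (ht : t ∈ slitLens) :
    (1 - 2 * t) * clausenSum' D (logSqCoeff D.kappa) (4 * t * (1 - t))
      = 2 * logDefect D t * (1 + t * (1 - t) * regSol' D t * regSol D t * logDefect D t
        - regSol D t ^ 2 * (1 - 2 * t)) := by
  have ht' := slitLens_subset_doubleSlit ht
  have hF := regSol_ne_zero (D := D) ht'.2
  have ht0 := Complex.slitPlane_ne_zero ht'.1
  have ht1 := Complex.slitPlane_ne_zero ht'.2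
  have hd := ((hasDerivAt_regSol (D := D) ht'.2).pow 2).mul
    ((hasDerivAt_logDefect (D := D) ht).pow 2)
  rw [clausenSum'_eq boundedVar_logSqCoeff (fun z hz => clausenSum_logSq hz) ht hd]
  push_cast
  simp only [Pi.pow_apply]
  field_simp
  ring

end Weighted

/-! ### The closed lens -/

section Closed
variable {D : Degree}

/-- The part of the slit lens from which a point `t` of the closed lens is approached: from above
if `t` lies on the cut. -/
def approachSet (t : ℂ) : Set ℂ := {z | z ∈ slitLens ∧ (t.im = 0 → t.re < 0 → 0 ≤ z.im)}

lemma re_lt_half {t : ℂ} (ht_le : ‖4 * t * (1 - t)‖ ≤ 1) (ht_re : t.re ≤ 1 / 2)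
    (ht_ne : t ≠ 1 / 2) : t.re < 1 / 2 := by
  refine lt_of_le_of_ne ht_re fun h => ht_ne ?_
  have h1 := (Complex.re_le_norm _).trans ht_le
  have h2 : (4 * t * (1 - t)).re = 1 + 4 * t.im ^ 2 := by
    simp [h]; ring
  have h3 : t.im = 0 := by nlinarith [sq_nonneg t.im]
  exact Complex.ext (by simpa using h) (by simpa using h3)

lemma four_mul_ne_one {t : ℂ} (hre : t.re < 1 / 2) : 4 * t * (1 - t) ≠ 1 := by
  intro h
  have h2 : (1 - 2 * t) ^ 2 = 0 := by linear_combination -h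
  have h3 := congrArg Complex.re (pow_eq_zero_iff two_ne_zero |>.1 h2)
  simp at h3
  linarith

lemma mem_slitPlane_or {t : ℂ} (ht : t ≠ 0) : t ∈ Complex.slitPlane ∨ t.im = 0 ∧ t.re < 0 := by
  rw [Complex.mem_slitPlane_iff]
  by_cases him : t.im = 0
  · rcases lt_trichotomy t.re 0 with h | h | h
    · exact Or.inr ⟨him, h⟩
    · exact absurd (Complex.ext h him) ht
    · exact Or.inl (Or.inl h)
  · exact Or.inl (Or.inr him)

lemma lensParam_mem_slitLens {w : ℂ} (hw : ‖w‖ < 1) (hs : w ∈ Complex.slitPlane) :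
    lensParam w ∈ slitLens := by
  rw [slitLens_eq_image]
  exact ⟨w, ⟨by simpa using hw, hs⟩, rfl⟩

/-- Points of the closed lens are limits of points of the slit lens: in the `u`-plane, move
radially towards the origin, and also upwards if `u` is negative. -/
lemma neBot_approachSet {t : ℂ} (ht0 : t ≠ 0) (ht_le : ‖4 * t * (1 - t)‖ ≤ 1)
    (hre : t.re < 1 / 2) : (𝓝[approachSet t] t).NeBot := by
  rw [← mem_closure_iff_nhdsWithin_neBot]
  have h1u := one_sub_mem_slitPlane ht_le (four_mul_ne_one hre)
  have key : ∀ w : ℝ → ℂ, Continuous w → w 0 = 4 * t * (1 - t) →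
      (∀ ε, 0 < ε → ε < 1 → lensParam (w ε) ∈ approachSet t) → t ∈ closure (approachSet t) := by
    intro w hw hw0 hmem
    have hlim : Tendsto (fun ε => lensParam (w ε)) (𝓝[>] 0) (𝓝 t) := by
      have h := (continuousAt_lensParam h1u).tendsto.comp (hw0 ▸ hw.tendsto 0)
      rw [lensParam_four_mul hre] at h
      exact h.mono_left nhdsWithin_le_nhds
    refine mem_closure_of_tendsto hlim ?_
    filter_upwards [Ioo_mem_nhdsGT (show (0 : ℝ) < 1 by norm_num)] with ε hε
    exact hmem ε hε.1 hε.2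
  rcases mem_slitPlane_or ht0 with hs | ⟨him, hneg⟩
  · refine key (fun ε => ((1 - ε : ℝ) : ℂ) * (4 * t * (1 - t))) (by fun_prop) (by simp)
      fun ε h0 h1 => ⟨lensParam_mem_slitLens ?_ ?_, fun h2 h3 => ?_⟩
    · rw [norm_mul, Complex.norm_real, Real.norm_eq_abs, abs_of_pos (by linarith)]
      nlinarith [norm_nonneg (4 * t * (1 - t))]
    · have hu := Complex.mem_slitPlane_iff.1 (four_mul_mem_slitPlane hre hs)
      have hp : 0 < 1 - ε := by linarith
      rw [Complex.mem_slitPlane_iff, Complex.re_ofReal_mul, Complex.im_ofReal_mul]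
      exact hu.imp (mul_pos hp) (mul_ne_zero hp.ne')
    · rw [Complex.mem_slitPlane_iff] at hs
      rcases hs with h | h
      · linarith
      · exact absurd h2 h
  · have hu_im : (4 * t * (1 - t)).im = 0 := by rw [im_four_mul, him]; ring
    set u := 4 * t * (1 - t) with hu
    have hur : u.re ^ 2 ≤ 1 := by
      have := (Complex.abs_re_le_norm u).trans ht_le
      rwa [← sq_le_one_iff_abs_le_one] at this
    refine key (fun ε => ((1 - ε : ℝ) : ℂ) * u + ε * Complex.I) (by fun_prop) (by simp)
      fun ε h0 h1 => ?_
    have hwre : (((1 - ε : ℝ) : ℂ) * u + ε * Complex.I).re = (1 - ε) * u.re := by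
      rw [Complex.add_re, Complex.re_ofReal_mul]; simp
    have hwim : (((1 - ε : ℝ) : ℂ) * u + ε * Complex.I).im = ε := by
      rw [Complex.add_im, Complex.im_ofReal_mul, hu_im]; simp
    have hm : lensParam (((1 - ε : ℝ) : ℂ) * u + ε * Complex.I) ∈ slitLens := by
      refine lensParam_mem_slitLens ?_ (Or.inr (by rw [hwim]; exact h0.ne'))
      have hsq : ‖((1 - ε : ℝ) : ℂ) * u + ε * Complex.I‖ ^ 2 = ((1 - ε) * u.re) ^ 2 + ε ^ 2 := by
        rw [Complex.sq_norm, Complex.normSq_apply, hwre, hwim]; ring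
      nlinarith [norm_nonneg (((1 - ε : ℝ) : ℂ) * u + ε * Complex.I), sq_nonneg (1 - ε)]
    refine ⟨hm, fun _ _ => ?_⟩
    have him' := im_four_mul (lensParam (((1 - ε : ℝ) : ℂ) * u + ε * Complex.I))
    rw [four_mul_lensParam, hwim] at him'
    have := hm.2.1
    by_contra! hlt
    nlinarith

lemma eq_of_continuousWithinAt_approachSet {t : ℂ} (hne : (𝓝[approachSet t] t).NeBot)
    {f g : ℂ → ℂ} (hf : ContinuousWithinAt f (approachSet t) t)
    (hg : ContinuousWithinAt g (approachSet t) t) (h : ∀ z ∈ slitLens, f z = g z) : f t = g t :=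
  tendsto_nhds_unique_of_eventuallyEq hf hg <| by
    filter_upwards [self_mem_nhdsWithin] with z hz using h z hz.1

lemma continuousWithinAt_logSol {t : ℂ} (ht0 : t ≠ 0) :
    ContinuousWithinAt (logSol D) (approachSet t) t := by
  rcases mem_slitPlane_or ht0 with hs | ⟨him, hneg⟩
  · exact (hasDerivAt_logSol hs).continuousAt.continuousWithinAt
  · exact (continuousWithinAt_shiftedP_upper D.neg_one_lt_nu D.nu_neg ht0).mono
      fun z hz => hz.2 him hneg

lemma continuousWithinAt_log_seriesVar {t : ℂ} (ht0 : t ≠ 0) (hre : t.re < 1 / 2) :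
    ContinuousWithinAt (fun z => Complex.log (seriesVar D z)) (approachSet t) t := by
  have hX := (hasDerivAt_seriesVar D t).continuousAt
  rcases mem_slitPlane_or ht0 with hs | ⟨him, hneg⟩
  · exact (hX.clog (seriesVar_mem_slitPlane
      (four_mul_mem_slitPlane hre hs))).continuousWithinAt
  · have hp : 0 < 1 / (4 * seriesConst D) := by have := seriesConst_pos D; positivity
    refine ContinuousWithinAt.comp (t := {z : ℂ | 0 ≤ z.im})
      (Complex.continuousWithinAt_log_of_re_neg_of_im_zero ?_ ?_) hX.continuousWithinAt
      fun z hz => ?_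
    · rw [seriesVar_eq_ofReal_mul, Complex.re_ofReal_mul, re_four_mul him]
      exact mul_neg_of_pos_of_neg hp (by nlinarith)
    · rw [seriesVar_eq_ofReal_mul, Complex.im_ofReal_mul, im_four_mul, him]
      ring
    · have h1 := hz.2 him hneg
      have h2 := hz.1.2.1
      rw [mem_ofPred_eq, seriesVar_eq_ofReal_mul, Complex.im_ofReal_mul, im_four_mul]
      exact mul_nonneg hp.le (mul_nonneg (by linarith) (by linarith))

lemma continuousAt_regSol {t : ℂ} (hre : t.re < 1 / 2) : ContinuousAt (regSol D) t :=
  (hasDerivAt_regSol (Or.inl (by simp; linarith))).continuousAt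

lemma continuousAt_mul_regSol' {t : ℂ} (hre : t.re < 1 / 2) :
    ContinuousAt (fun t => t * (1 - t) * regSol' D t) t :=
  (hasDerivAt_mul_regSol' (Or.inl (by simp; linarith))).continuousAt

lemma continuousWithinAt_logDefect {t : ℂ} (ht0 : t ≠ 0) (hre : t.re < 1 / 2) :
    ContinuousWithinAt (logDefect D) (approachSet t) t := by
  have hs : (wronskianConst D : ℂ) ≠ 0 := by exact_mod_cast wronskianConst_neg.ne
  have hF : regSol D t ≠ 0 := regSol_ne_zero (Or.inl (by simp; linarith))
  exact ((continuousWithinAt_logSol ht0).div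
    (continuousWithinAt_const.mul (continuousAt_regSol hre).continuousWithinAt)
    (mul_ne_zero hs hF)).sub (continuousWithinAt_log_seriesVar ht0 hre)

lemma continuousWithinAt_abelSum_comp {v : ℕ → ℂ} (hv : BoundedVar v) {t : ℂ}
    (ht_le : ‖4 * t * (1 - t)‖ ≤ 1) (hre : t.re < 1 / 2) :
    ContinuousWithinAt (fun z => abelSum v (4 * z * (1 - z))) (approachSet t) t :=
  (continuousWithinAt_abelSum hv ht_le (four_mul_ne_one hre)).comp
    (f := fun z : ℂ => 4 * z * (1 - z)) (t := Metric.closedBall 0 1)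
    (hasDerivAt_four_mul t).continuousAt.continuousWithinAt
    fun z hz => by simpa using hz.1.1.le

end Closed

section Identities
variable {D : Degree} {t : ℂ}

lemma continuousWithinAt_clausenSum {m : ℕ → ℂ} (hm : BoundedVar m)
    (ht_le : ‖4 * t * (1 - t)‖ ≤ 1) (hre : t.re < 1 / 2) :
    ContinuousWithinAt (fun z => clausenSum D m (4 * z * (1 - z))) (approachSet t) t :=
  continuousWithinAt_abelSum_comp (boundedVar_aCoeff_mul hm) ht_le hre

lemma continuousWithinAt_clausenSum' {m : ℕ → ℂ} (hm : BoundedVar m)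
    (ht_le : ‖4 * t * (1 - t)‖ ≤ 1) (hre : t.re < 1 / 2) :
    ContinuousWithinAt (fun z => (1 - 2 * z) * clausenSum' D m (4 * z * (1 - z)))
      (approachSet t) t :=
  (hasDerivAt_one_sub_two_mul t).continuousAt.continuousWithinAt.mul
    (continuousWithinAt_abelSum_comp (boundedVar_nat_mul_aCoeff_mul hm) ht_le hre)

/-- The sums of the series on the closed lens, by continuity from the open slit lens. -/
lemma clausenSum_closed (ht0 : t ≠ 0) (ht_le : ‖4 * t * (1 - t)‖ ≤ 1) (hre : t.re < 1 / 2) :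
    clausenSum D (fun _ => 1) (4 * t * (1 - t)) = regSol D t ^ 2 ∧
    clausenSum D (fun k => (logCoeff D.kappa k : ℂ)) (4 * t * (1 - t))
      = regSol D t ^ 2 * logDefect D t ∧
    clausenSum D (logSqCoeff D.kappa) (4 * t * (1 - t)) = regSol D t ^ 2 * logDefect D t ^ 2 := by
  have hne := neBot_approachSet ht0 ht_le hre
  have hF := (continuousAt_regSol (D := D) hre).continuousWithinAt (s := approachSet t)
  have hL := continuousWithinAt_logDefect (D := D) ht0 hre
  exact ⟨eq_of_continuousWithinAt_approachSet hne
      (continuousWithinAt_clausenSum (boundedVar_const 1) ht_le hre) (hF.pow 2)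
      fun z hz => clausenSum_one hz,
    eq_of_continuousWithinAt_approachSet hne (continuousWithinAt_clausenSum
      (boundedVar_logCoeff D.kappa_pos D.kappa_le) ht_le hre) ((hF.pow 2).mul hL)
      fun z hz => clausenSum_log hz,
    eq_of_continuousWithinAt_approachSet hne
      (continuousWithinAt_clausenSum boundedVar_logSqCoeff ht_le hre) ((hF.pow 2).mul (hL.pow 2))
      fun z hz => clausenSum_logSq hz⟩

/-- The sums of the differentiated series on the closed lens. -/
lemma clausenSum'_closed (ht0 : t ≠ 0) (ht_le : ‖4 * t * (1 - t)‖ ≤ 1) (hre : t.re < 1 / 2) :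
    (1 - 2 * t) * clausenSum' D (fun _ => 1) (4 * t * (1 - t))
      = 2 * (t * (1 - t) * regSol' D t) * regSol D t ∧
    (1 - 2 * t) * clausenSum' D (fun k => (logCoeff D.kappa k : ℂ)) (4 * t * (1 - t))
      = 2 * (t * (1 - t) * regSol' D t) * regSol D t * logDefect D t + 1
        - regSol D t ^ 2 * (1 - 2 * t) ∧
    (1 - 2 * t) * clausenSum' D (logSqCoeff D.kappa) (4 * t * (1 - t))
      = 2 * logDefect D t * (1 + t * (1 - t) * regSol' D t * regSol D t * logDefect D t
        - regSol D t ^ 2 * (1 - 2 * t)) := by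
  have hne := neBot_approachSet ht0 ht_le hre
  have hF := (continuousAt_regSol (D := D) hre).continuousWithinAt (s := approachSet t)
  have hF' := (continuousAt_mul_regSol' (D := D) hre).continuousWithinAt (s := approachSet t)
  have hL := continuousWithinAt_logDefect (D := D) ht0 hre
  have h2 := (hasDerivAt_one_sub_two_mul t).continuousAt.continuousWithinAt (s := approachSet t)
  exact ⟨eq_of_continuousWithinAt_approachSet hne
      (continuousWithinAt_clausenSum' (boundedVar_const 1) ht_le hre)
      ((continuousWithinAt_const.mul hF').mul hF) fun z hz => clausenSum'_one hz,
    eq_of_continuousWithinAt_approachSet hne (continuousWithinAt_clausenSum'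
      (boundedVar_logCoeff D.kappa_pos D.kappa_le) ht_le hre)
      (((((continuousWithinAt_const.mul hF').mul hF).mul hL).add continuousWithinAt_const).sub
        ((hF.pow 2).mul h2)) fun z hz => clausenSum'_log hz,
    eq_of_continuousWithinAt_approachSet hne
      (continuousWithinAt_clausenSum' boundedVar_logSqCoeff ht_le hre)
      ((continuousWithinAt_const.mul hL).mul ((continuousWithinAt_const.add
        ((hF'.mul hF).mul hL)).sub ((hF.pow 2).mul h2))) fun z hz => clausenSum'_logSq hz⟩

/-! ### The ratio of the solutions and the Legendre–Ramanujan function -/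

lemma legendreP_one_sub (ν : ℝ) (t : ℂ) : legendreP ν (1 - 2 * t) = shiftedP ν (1 - t) := by
  rw [shiftedP]; congr 1; ring

lemma ratio_eq : ratio D.nu t = Complex.I * (logSol D t / regSol D t) := by
  rw [ratio, legendreP_one_sub, mul_div_assoc]; rfl

lemma ratio_im : (ratio D.nu t).im = (logSol D t / regSol D t).re := by
  rw [ratio_eq, Complex.I_mul_im]

lemma re_div_pos_of_re_conj_mul_pos {a b : ℂ} (h : 0 < (starRingEnd ℂ a * b).re) :
    0 < (b / a).re := by
  have ha : a ≠ 0 := by rintro rfl; simp at h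
  have e : b / a = ((Complex.normSq a)⁻¹ : ℝ) * (starRingEnd ℂ a * b) := by
    rw [div_eq_mul_inv, Complex.inv_def]; push_cast; ring
  rw [e, Complex.re_ofReal_mul]
  exact mul_pos (inv_pos.2 (Complex.normSq_pos.2 ha)) h

lemma ratio_im_pos_of_mem_doubleSlit (ht : t ∈ doubleSlit) : 0 < (ratio D.nu t).im := by
  rw [ratio_im]
  exact re_div_pos_of_re_conj_mul_pos (re_conj_shiftedP_mul_pos D.neg_half_le_nu D.nu_neg ht)

lemma one_sub_mem_slitPlane_of_re {t : ℂ} (hre : t.re < 1 / 2) : 1 - t ∈ Complex.slitPlane :=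
  Or.inl (by simp; linarith)

lemma logSol_ne_zero_and_ratio_im_pos (ht0 : t ≠ 0) (hre : t.re < 1 / 2) :
    logSol D t ≠ 0 ∧ 0 < (ratio D.nu t).im := by
  have hs1 := one_sub_mem_slitPlane_of_re hre
  rcases mem_slitPlane_or ht0 with hs | ⟨him, hneg⟩
  · exact ⟨shiftedP_ne_zero D.neg_half_le_nu D.nu_neg hs, ratio_im_pos_of_mem_doubleSlit ⟨hs, hs1⟩⟩
  · have hG : 0 < (logSol D t).re := re_shiftedP_pos_of_neg D.neg_half_le_nu D.nu_neg him hneg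
    refine ⟨fun h => by simp [h] at hG, ?_⟩
    have hF : 0 < (regSol D t).re := re_shiftedP_pos D.neg_half_le_nu D.nu_neg hs1
    have hFi : (regSol D t).im = 0 := shiftedP_im_zero hs1 (by simp [him])
    rw [ratio_im]
    refine re_div_pos_of_re_conj_mul_pos ?_
    rw [Complex.mul_re, Complex.conj_re, Complex.conj_im, hFi]
    simpa using mul_pos hF hG

/-- The closed form `-4 t (1 - t) F' / F - 2 s / (F² Im ρ)` of the Legendre–Ramanujan function at
`1 - 2t`, where `F = P_ν(1 - 2t)` and `s = sin (νπ) / π`. -/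
noncomputable def ramanujanValue (D : Degree) (t : ℂ) : ℂ :=
  -4 * (t * (1 - t) * regSol' D t) / regSol D t
    - 2 * wronskianConst D / (regSol D t ^ 2 * ((ratio D.nu t).im : ℂ))

/-- The term of the formula that contains `Im (i P_ν(ξ) / P_ν(-ξ))` is eliminated by means of
`Re r⁻¹ = Re r / |r|²`. -/
lemma re_inv_identity {F G : ℂ} (hF : F ≠ 0) (hG : G ≠ 0) (h : (G / F).re ≠ 0) :
    -2 / (F * G) + 1 / (G ^ 2 * ((F / G).re : ℂ)) = -1 / (F ^ 2 * ((G / F).re : ℂ)) := by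
  set r := G / F with hr
  have hr0 : r ≠ 0 := div_ne_zero hG hF
  have hGr : G = F * r := by rw [hr]; field_simp
  have e : F / G = r⁻¹ := by rw [hr, inv_div]
  have hc : (r.re : ℂ) ≠ 0 := by exact_mod_cast h
  have hn : (Complex.normSq r : ℂ) ≠ 0 := by exact_mod_cast (Complex.normSq_pos.2 hr0).ne'
  have h1 : (Complex.normSq r : ℂ) = r * starRingEnd ℂ r := (Complex.mul_conj r).symm
  have h2 : r + starRingEnd ℂ r = 2 * (r.re : ℂ) := by
    rw [Complex.add_conj]; push_cast; ring
  rw [e, Complex.inv_re, hGr, Complex.ofReal_div]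
  have h3 : (1 : ℂ) / ((F * r) ^ 2 * ((r.re : ℂ) / (Complex.normSq r : ℂ)))
      = starRingEnd ℂ r / (F ^ 2 * r * r.re) := by
    rw [h1] at hn ⊢
    have := right_ne_zero_of_mul hn
    field_simp
  rw [h3]
  field_simp
  linear_combination h2

lemma legendreRamanujanFormula_eq (ht : t ∈ doubleSlit) :
    legendreRamanujanFormula D.nu (1 - 2 * t) = ramanujanValue D t := by
  have hF := regSol_ne_zero (D := D) ht.2
  have hG : logSol D t ≠ 0 := shiftedP_ne_zero D.neg_half_le_nu D.nu_neg ht.1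
  have hm := ratio_im_pos_of_mem_doubleSlit (D := D) ht
  have e1 : legendreP D.nu (1 - 2 * t) = regSol D t := legendreP_one_sub _ _
  have e2 : legendreP D.nu (-(1 - 2 * t)) = logSol D t := by
    rw [logSol, shiftedP]; congr 1; ring
  have d1 : deriv (legendreP D.nu) (1 - 2 * t) = -(regSol' D t) / 2 := by
    have hlin : HasDerivAt (fun x : ℂ => (1 + x) / 2) (1 / 2) (1 - 2 * t) :=
      ((hasDerivAt_id _).const_add 1).div_const 2
    have hz : (1 + (1 - 2 * t)) / 2 ∈ Complex.slitPlane := by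
      convert ht.2 using 1; ring
    have h := HasDerivAt.comp (h := fun x : ℂ => (1 + x) / 2) (1 - 2 * t)
      (hasDerivAt_shiftedP D.neg_one_lt_nu D.nu_neg hz) hlin
    have e : (shiftedP D.nu ∘ fun x : ℂ => (1 + x) / 2) = legendreP D.nu := by
      funext x; simp only [Function.comp_apply, shiftedP]; congr 1; ring
    rw [e] at h
    rw [h.deriv, regSol', show (1 + (1 - 2 * t)) / 2 = 1 - t by ring]
    ring
  have d2 : deriv (fun z : ℂ => legendreP D.nu (-z)) (1 - 2 * t) = -(logSol' D t) / 2 := by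
    have hlin : HasDerivAt (fun x : ℂ => (1 - x) / 2) (-1 / 2) (1 - 2 * t) :=
      ((hasDerivAt_id _).const_sub 1).div_const 2
    have hz : (1 - (1 - 2 * t)) / 2 ∈ Complex.slitPlane := by
      convert ht.1 using 1; ring
    have h := HasDerivAt.comp (h := fun x : ℂ => (1 - x) / 2) (1 - 2 * t)
      (hasDerivAt_shiftedP D.neg_one_lt_nu D.nu_neg hz) hlin
    have e : (shiftedP D.nu ∘ fun x : ℂ => (1 - x) / 2) = fun z => legendreP D.nu (-z) := by
      funext x; simp only [Function.comp_apply, shiftedP]; congr 1; ring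
    rw [e] at h
    rw [h.deriv, logSol', show (1 - (1 - 2 * t)) / 2 = t by ring]
    ring
  have hW := wronskian_eq (D := D) ht
  rw [ratio_im] at hm
  have key := re_inv_identity hF hG hm.ne'
  rw [legendreRamanujanFormula, e1, e2, d1, d2, ramanujanValue, ratio_im, mul_div_assoc,
    mul_div_assoc, Complex.I_mul_im, Complex.I_mul_im]
  change _ - (wronskianConst D : ℂ) * _ = _
  have hpG : t * (1 - t) * logSol' D t
      = (wronskianConst D + t * (1 - t) * regSol' D t * logSol D t) / regSol D t := by
    rw [eq_div_iff hF]; linear_combination hW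
  have h1 : (1 - (1 - 2 * t) ^ 2) / logSol D t * (-(logSol' D t) / 2)
      = -2 * (t * (1 - t) * logSol' D t) / logSol D t := by ring
  have h2 : -2 * ((wronskianConst D + t * (1 - t) * regSol' D t * logSol D t) / regSol D t)
      / logSol D t = wronskianConst D * (-2 / (regSol D t * logSol D t))
        - 2 * (t * (1 - t) * regSol' D t) / regSol D t := by
    field_simp
    ring
  rw [h1, hpG, h2]
  linear_combination (wronskianConst D : ℂ) * key

end Identities

/-! ### Boundary values of the Legendre–Ramanujan function -/

section BranchCut
variable {D : Degree} {t : ℂ}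

lemma mem_doubleSlit_of_im_ne_zero {z : ℂ} (h : z.im ≠ 0) : z ∈ doubleSlit :=
  ⟨Or.inr h, Or.inr (by simpa using h)⟩

/-- Indeed `ρ(conj t) = -conj (ρ(t))`. -/
lemma ratio_im_conj {z : ℂ} (hz : z ∈ doubleSlit) :
    (ratio D.nu (starRingEnd ℂ z)).im = (ratio D.nu z).im := by
  rw [ratio_im, ratio_im, logSol, regSol, shiftedP_conj hz.1,
    show 1 - starRingEnd ℂ z = starRingEnd ℂ (1 - z) by simp, shiftedP_conj hz.2, ← map_div₀,
    Complex.conj_re]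
  rfl

lemma tendsto_add_mul_I (t : ℂ) (c : ℝ) :
    Tendsto (fun ε : ℝ => t + ((c * ε : ℝ) : ℂ) * Complex.I) (𝓝[>] 0) (𝓝 t) := by
  have h : Continuous fun ε : ℝ => t + ((c * ε : ℝ) : ℂ) * Complex.I := by fun_prop
  simpa using (h.tendsto 0).mono_left nhdsWithin_le_nhds

lemma tendsto_logSol_above (ht0 : t ≠ 0) (him : t.im = 0) {c : ℝ} (hc : 0 < c) :
    Tendsto (fun ε : ℝ => logSol D (t + ((c * ε : ℝ) : ℂ) * Complex.I)) (𝓝[>] 0)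
      (𝓝 (logSol D t)) := by
  refine (continuousWithinAt_shiftedP_upper D.neg_one_lt_nu D.nu_neg ht0).tendsto.comp
    (tendsto_nhdsWithin_iff.2 ⟨tendsto_add_mul_I t c, ?_⟩)
  filter_upwards [self_mem_nhdsWithin] with ε hε
  have : 0 < c * ε := mul_pos hc hε
  simpa [him] using this.le

lemma tendsto_ratio_im_above (ht0 : t ≠ 0) (him : t.im = 0) (hre : t.re < 1 / 2) {c : ℝ}
    (hc : 0 < c) :
    Tendsto (fun ε : ℝ => (ratio D.nu (t + ((c * ε : ℝ) : ℂ) * Complex.I)).im) (𝓝[>] 0)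
      (𝓝 (ratio D.nu t).im) := by
  simp only [ratio_im]
  have hF := (continuousAt_regSol (D := D) hre).tendsto.comp (tendsto_add_mul_I t c)
  exact (Complex.continuous_re.tendsto _).comp ((tendsto_logSol_above ht0 him hc).div hF
    (regSol_ne_zero (one_sub_mem_slitPlane_of_re hre)))

lemma tendsto_ratio_im (ht0 : t ≠ 0) (him : t.im = 0) (hre : t.re < 1 / 2) {c : ℝ}
    (hc : c ≠ 0) :
    Tendsto (fun ε : ℝ => (ratio D.nu (t + ((c * ε : ℝ) : ℂ) * Complex.I)).im) (𝓝[>] 0)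
      (𝓝 (ratio D.nu t).im) := by
  rcases hc.lt_or_gt with h | h
  · refine (tendsto_ratio_im_above ht0 him hre (neg_pos.2 h)).congr' ?_
    filter_upwards [self_mem_nhdsWithin] with ε hε
    have hne : c * ε ≠ 0 := mul_ne_zero hc (ne_of_gt hε)
    rw [← ratio_im_conj (mem_doubleSlit_of_im_ne_zero (by simpa [him] using hne))]
    congr 2
    rw [map_add, Complex.conj_eq_iff_im.2 him]
    simp
  · exact tendsto_ratio_im_above ht0 him hre h

/-- The boundary values of the Legendre–Ramanujan function agree on both sides of the cut,
since `Im ρ` is invariant under complex conjugation of `t`. -/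
lemma tendsto_legendreRamanujanFormula (ht0 : t ≠ 0) (him : t.im = 0) (hre : t.re < 1 / 2) {c : ℝ}
    (hc : c ≠ 0) :
    Tendsto (fun ε : ℝ => legendreRamanujanFormula D.nu (1 - 2 * t + ((c * ε : ℝ) : ℂ) * Complex.I))
      (𝓝[>] 0) (𝓝 (ramanujanValue D t)) := by
  -- the point `1 - 2t + i c ε` belongs to the parameter `t - i c ε / 2`
  have hc' : -c / 2 ≠ 0 := div_ne_zero (neg_ne_zero.2 hc) two_ne_zero
  have hF := (continuousAt_regSol (D := D) hre).tendsto.comp (tendsto_add_mul_I t (-c / 2))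
  have hF' := (continuousAt_mul_regSol' (D := D) hre).tendsto.comp (tendsto_add_mul_I t (-c / 2))
  have hm := (Complex.continuous_ofReal.tendsto _).comp
    (tendsto_ratio_im (D := D) ht0 him hre hc')
  have hF0 : regSol D t ≠ 0 := regSol_ne_zero (one_sub_mem_slitPlane_of_re hre)
  have hm0 : ((ratio D.nu t).im : ℂ) ≠ 0 := by
    exact_mod_cast (logSol_ne_zero_and_ratio_im_pos ht0 hre).2.ne'
  have h := ((hF'.const_mul (-4)).div hF hF0).sub
    ((tendsto_const_nhds (x := 2 * (wronskianConst D : ℂ))).div ((hF.pow 2).mul hm)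
      (mul_ne_zero (pow_ne_zero 2 hF0) hm0))
  refine h.congr' ?_
  filter_upwards [self_mem_nhdsWithin] with ε hε
  have hne : -c / 2 * ε ≠ 0 := mul_ne_zero hc' (ne_of_gt hε)
  have hz : t + ((-c / 2 * ε : ℝ) : ℂ) * Complex.I ∈ doubleSlit :=
    mem_doubleSlit_of_im_ne_zero (by simpa [him] using hne)
  rw [show 1 - 2 * t + ((c * ε : ℝ) : ℂ) * Complex.I
    = 1 - 2 * (t + ((-c / 2 * ε : ℝ) : ℂ) * Complex.I) by push_cast; ring,
    legendreRamanujanFormula_eq hz]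
  rfl

lemma legendreRamanujan_eq (ht0 : t ≠ 0) (hre : t.re < 1 / 2) :
    legendreRamanujan D.nu (1 - 2 * t) = ramanujanValue D t := by
  have e1 : (1 - 2 * t).re = 1 - 2 * t.re := by simp
  have e2 : (1 - 2 * t).im = -(2 * t.im) := by simp
  have hs := one_sub_mem_slitPlane_of_re hre
  rw [legendreRamanujan, e1, e2]
  rcases mem_slitPlane_or ht0 with h | ⟨him, hneg⟩
  · rw [if_pos, legendreRamanujanFormula_eq ⟨h, hs⟩]
    by_cases him : t.im = 0
    · have hpos := (Complex.mem_slitPlane_iff.1 h).resolve_right (by simp [him])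
      right
      rw [abs_lt]
      constructor <;> linarith
    · left
      simpa using him
  · have ha : |1 - 2 * t.re| = 1 - 2 * t.re := abs_of_pos (by linarith)
    rw [if_neg, ha, if_neg (by linarith), if_pos (by linarith)]
    · have := tendsto_legendreRamanujanFormula (D := D) ht0 him hre one_ne_zero
      simp only [one_mul] at this
      exact this.limUnder_eq
    · rw [ha, him]
      rintro (h | h)
      · simp at h
      · linarith

end BranchCut

/-! ### Elimination of the derivatives -/

section Final
variable {D : Degree} {t : ℂ}

lemma logDefect_eq_ratio (hF : regSol D t ≠ 0) :
    wronskianConst D * logDefect D t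
      = -Complex.I * ratio D.nu t - wronskianConst D * Complex.log (seriesVar D t) := by
  have hs : (wronskianConst D : ℂ) ≠ 0 := by exact_mod_cast wronskianConst_neg.ne
  rw [logDefect, ratio_eq, ← mul_assoc, neg_mul, Complex.I_mul_I]
  field_simp

lemma cast_wronskianConst :
    (wronskianConst D : ℂ) = ((Real.sin (D.nu * Real.pi) : ℝ) : ℂ) / (Real.pi : ℂ) := by
  rw [wronskianConst]; push_cast; ring

lemma ramanujanValue_mul_sq (hF : regSol D t ≠ 0) (hm : ((ratio D.nu t).im : ℂ) ≠ 0) :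
    ramanujanValue D t * regSol D t ^ 2 = -4 * (t * (1 - t) * regSol' D t) * regSol D t
      - 2 * wronskianConst D / ((ratio D.nu t).im : ℂ) := by
  rw [ramanujanValue]
  field_simp

/-- The series with weights `1`: the terms in `F'` cancel, leaving `2 s / Im ρ`. -/
lemma ramanujan_identity (ht0 : t ≠ 0) (ht_le : ‖4 * t * (1 - t)‖ ≤ 1) (hre : t.re < 1 / 2) :
    2 * (2 * t - 1) * clausenSum' D (fun _ => 1) (4 * t * (1 - t))
      + -ramanujanValue D t * clausenSum D (fun _ => 1) (4 * t * (1 - t))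
      = 2 * wronskianConst D / ((ratio D.nu t).im : ℂ) := by
  have hF : regSol D t ≠ 0 := regSol_ne_zero (one_sub_mem_slitPlane_of_re hre)
  have hm : ((ratio D.nu t).im : ℂ) ≠ 0 := by
    exact_mod_cast (logSol_ne_zero_and_ratio_im_pos ht0 hre).2.ne'
  rw [(clausenSum_closed ht0 ht_le hre).1]
  linear_combination (-2) * (clausenSum'_closed (D := D) ht0 ht_le hre).1
    - ramanujanValue_mul_sq hF hm

/-- The series with weights `c_k`: the sum is `2 s (L - log X) / Im ρ - 2`, and `s L = -i ρ`. -/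
lemma sun_identity (ht0 : t ≠ 0) (ht_le : ‖4 * t * (1 - t)‖ ≤ 1) (hre : t.re < 1 / 2) :
    2 * (2 * t - 1) * clausenSum' D (fun k => (logCoeff D.kappa k : ℂ)) (4 * t * (1 - t))
      + -ramanujanValue D t * clausenSum D (fun k => (logCoeff D.kappa k : ℂ)) (4 * t * (1 - t))
      + 2 * (2 * t - 1) * clausenSum D (fun _ => 1) (4 * t * (1 - t))
      = -(2 * wronskianConst D * Complex.log (seriesVar D t) / ((ratio D.nu t).im : ℂ))
        - 2 * Complex.I * ((ratio D.nu t).re / (ratio D.nu t).im) := by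
  have hF : regSol D t ≠ 0 := regSol_ne_zero (one_sub_mem_slitPlane_of_re hre)
  have hm : ((ratio D.nu t).im : ℂ) ≠ 0 := by
    exact_mod_cast (logSol_ne_zero_and_ratio_im_pos ht0 hre).2.ne'
  have hρ := Complex.re_add_im (ratio D.nu t)
  have hL := logDefect_eq_ratio hF
  rw [← hρ] at hL
  have e : 2 * wronskianConst D / ((ratio D.nu t).im : ℂ) * logDefect D t - 2
      = -(2 * wronskianConst D * Complex.log (seriesVar D t) / ((ratio D.nu t).im : ℂ))
        - 2 * Complex.I * ((ratio D.nu t).re / (ratio D.nu t).im) := by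
    field_simp
    linear_combination hL - (ratio D.nu t).im * Complex.I_sq
  rw [(clausenSum_closed ht0 ht_le hre).1, (clausenSum_closed ht0 ht_le hre).2.1, ← e]
  linear_combination (-2) * (clausenSum'_closed (D := D) ht0 ht_le hre).2.1
    - logDefect D t * ramanujanValue_mul_sq hF hm

/-- The series with weights `c_k² + d_k`: the sum is `2 s (L - log X)² / Im ρ - 4 (L - log X)`. -/
lemma logSq_identity (ht0 : t ≠ 0) (ht_le : ‖4 * t * (1 - t)‖ ≤ 1) (hre : t.re < 1 / 2) :
    2 * (2 * t - 1) * clausenSum' D (logSqCoeff D.kappa) (4 * t * (1 - t))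
      + -ramanujanValue D t * clausenSum D (logSqCoeff D.kappa) (4 * t * (1 - t))
      + 4 * (2 * t - 1) * clausenSum D (fun k => (logCoeff D.kappa k : ℂ)) (4 * t * (1 - t))
      = -(2 * (‖ratio D.nu t‖ : ℂ) ^ 2 / (wronskianConst D * ((ratio D.nu t).im : ℂ)))
        + 4 * Complex.I * ((ratio D.nu t).re / (ratio D.nu t).im) * Complex.log (seriesVar D t)
        + 2 * wronskianConst D / ((ratio D.nu t).im : ℂ) * Complex.log (seriesVar D t) ^ 2 := by
  have hF : regSol D t ≠ 0 := regSol_ne_zero (one_sub_mem_slitPlane_of_re hre)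
  have hs : (wronskianConst D : ℂ) ≠ 0 := by exact_mod_cast wronskianConst_neg.ne
  have hm : ((ratio D.nu t).im : ℂ) ≠ 0 := by
    exact_mod_cast (logSol_ne_zero_and_ratio_im_pos ht0 hre).2.ne'
  have hρ := Complex.re_add_im (ratio D.nu t)
  have hn : (‖ratio D.nu t‖ : ℂ) ^ 2 = (ratio D.nu t).re ^ 2 + (ratio D.nu t).im ^ 2 := by
    have := Complex.sq_norm (ratio D.nu t)
    rw [Complex.normSq_apply] at this
    exact_mod_cast this.trans (by ring)
  have hL := logDefect_eq_ratio hF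
  rw [← hρ] at hL
  have e : 2 * wronskianConst D / ((ratio D.nu t).im : ℂ) * logDefect D t ^ 2
        - 4 * logDefect D t
      = -(2 * (‖ratio D.nu t‖ : ℂ) ^ 2 / (wronskianConst D * ((ratio D.nu t).im : ℂ)))
        + 4 * Complex.I * ((ratio D.nu t).re / (ratio D.nu t).im) * Complex.log (seriesVar D t)
        + 2 * wronskianConst D / ((ratio D.nu t).im : ℂ) * Complex.log (seriesVar D t) ^ 2 := by
    rw [hn]
    have hL' : logDefect D t = (-Complex.I * ((ratio D.nu t).re + (ratio D.nu t).im * Complex.I)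
        - wronskianConst D * Complex.log (seriesVar D t)) / wronskianConst D := by
      rw [eq_div_iff hs, ← hL, mul_comm]
    rw [hL']
    field_simp
    ring_nf
    rw [show Complex.I ^ 4 = 1 from Complex.I_pow_four, Complex.I_pow_three, Complex.I_sq]
    ring
  rw [(clausenSum_closed ht0 ht_le hre).2.1, (clausenSum_closed ht0 ht_le hre).2.2, ← e]
  linear_combination (-2) * (clausenSum'_closed (D := D) ht0 ht_le hre).2.2
    - logDefect D t ^ 2 * ramanujanValue_mul_sq hF hm

end Final

end RamanujanSun

theorem mainTheorem2 (D : RamanujanSun.Degree) (t : ℂ)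
    (ht_pos : 0 < ‖4 * t * (1 - t)‖) (ht_le : ‖4 * t * (1 - t)‖ ≤ 1)
    (ht_re : t.re ≤ 1 / 2) (ht_ne : t ≠ 1 / 2) :
    -- absolute convergence of the series with general weights
    (∀ (a b : ℂ) (c : ℕ → ℂ), c =O[atTop] (fun k : ℕ => Real.log k) →
      (‖4 * t * (1 - t)‖ < 1 ∨ a = 0) →
      Summable (RamanujanSun.sigmaTerm D a b c t)) ∧
    -- for negative `t` the values on the branch cut are the boundary values
    (t.im = 0 → t.re < 0 →
      Tendsto (fun ε : ℝ => RamanujanSun.legendreP D.nu (2 * (t + ε * Complex.I) - 1))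
        (𝓝[>] 0) (𝓝 (RamanujanSun.legendreP D.nu (2 * t - 1))) ∧
      Tendsto (fun ε : ℝ =>
          RamanujanSun.legendreRamanujanFormula D.nu (1 - 2 * t + ε * Complex.I))
        (𝓝[>] 0) (𝓝 (RamanujanSun.legendreRamanujan D.nu (1 - 2 * t))) ∧
      Tendsto (fun ε : ℝ =>
          RamanujanSun.legendreRamanujanFormula D.nu (1 - 2 * t - ε * Complex.I))
        (𝓝[>] 0) (𝓝 (RamanujanSun.legendreRamanujan D.nu (1 - 2 * t)))) ∧
    -- all denominators are nonzero
    RamanujanSun.legendreP D.nu (1 - 2 * t) ≠ 0 ∧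
    RamanujanSun.legendreP D.nu (2 * t - 1) ≠ 0 ∧
    (RamanujanSun.ratio D.nu t).im ≠ 0 ∧
    -- the series of Ramanujan's type
    RamanujanSun.HasSigma D (2 * (2 * t - 1)) (-RamanujanSun.legendreRamanujan D.nu (1 - 2 * t))
      (fun _ => 1) t
      (2 * Real.sin (D.nu * Real.pi) / (Real.pi * (RamanujanSun.ratio D.nu t).im)) ∧
    -- the series of Sun's type
    (∃ S₁ S₂ : ℂ,
      RamanujanSun.HasSigma D (2 * (2 * t - 1))
        (-RamanujanSun.legendreRamanujan D.nu (1 - 2 * t)) (RamanujanSun.cWeight D) t S₁ ∧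
      RamanujanSun.HasSigma D 0 (2 * (2 * t - 1)) (fun _ => 1) t S₂ ∧
      S₁ + S₂ =
        -(2 * Real.sin (D.nu * Real.pi) * Complex.log (RamanujanSun.seriesVar D t)
            / (Real.pi * (RamanujanSun.ratio D.nu t).im))
          - 2 * Complex.I * ((RamanujanSun.ratio D.nu t).re / (RamanujanSun.ratio D.nu t).im)) ∧
    -- the log-squared series
    (∃ S₁ S₂ : ℂ,
      RamanujanSun.HasSigma D (2 * (2 * t - 1))
        (-RamanujanSun.legendreRamanujan D.nu (1 - 2 * t))
        (fun k => RamanujanSun.cWeight D k ^ 2 + RamanujanSun.dWeight D k) t S₁ ∧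
      RamanujanSun.HasSigma D 0 (4 * (2 * t - 1)) (RamanujanSun.cWeight D) t S₂ ∧
      S₁ + S₂ =
        -(2 * Real.pi * ‖RamanujanSun.ratio D.nu t‖ ^ 2
            / (Real.sin (D.nu * Real.pi) * (RamanujanSun.ratio D.nu t).im))
          + 4 * Complex.I * ((RamanujanSun.ratio D.nu t).re / (RamanujanSun.ratio D.nu t).im)
            * Complex.log (RamanujanSun.seriesVar D t)
          + 2 * Real.sin (D.nu * Real.pi) / (Real.pi * (RamanujanSun.ratio D.nu t).im)
            * Complex.log (RamanujanSun.seriesVar D t) ^ 2) := by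
  have hre := RamanujanSun.re_lt_half ht_le ht_re ht_ne
  have ht0 : t ≠ 0 := by rintro rfl; simp at ht_pos
  have hu1 := RamanujanSun.four_mul_ne_one hre
  have hpos := RamanujanSun.logSol_ne_zero_and_ratio_im_pos (D := D) ht0 hre
  have hR := RamanujanSun.legendreRamanujan_eq (D := D) ht0 hre
  have hbl := RamanujanSun.boundedVar_logCoeff D.kappa_pos D.kappa_le
  have hc : RamanujanSun.cWeight D = fun k => (RamanujanSun.logCoeff D.kappa k : ℂ) :=
    funext (RamanujanSun.cWeight_eq D)
  have hcd : (fun k => RamanujanSun.cWeight D k ^ 2 + RamanujanSun.dWeight D k)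
      = RamanujanSun.logSqCoeff D.kappa := by
    funext k
    rw [RamanujanSun.cWeight_eq, RamanujanSun.dWeight_eq, RamanujanSun.logSqCoeff]
  have hs := RamanujanSun.cast_wronskianConst (D := D)
  have hsin : ((Real.sin (D.nu * Real.pi) : ℝ) : ℂ) ≠ 0 := by
    exact_mod_cast (RamanujanSun.sin_nu_pi_neg D.neg_one_lt_nu D.nu_neg).ne
  have hpi : (Real.pi : ℂ) ≠ 0 := by exact_mod_cast Real.pi_ne_zero
  have hm : ((RamanujanSun.ratio D.nu t).im : ℂ) ≠ 0 := by exact_mod_cast hpos.2.ne'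
  refine ⟨fun a b c hcO h => RamanujanSun.summable_sigmaTerm D ht_le a b hcO h,
    fun him hneg => ⟨?_, ?_, ?_⟩, ?_, hpos.1, hpos.2.ne', ?_, ?_, ?_⟩
  · simpa [RamanujanSun.logSol, RamanujanSun.shiftedP] using
      RamanujanSun.tendsto_logSol_above (D := D) ht0 him one_pos
  · rw [hR]
    simpa using RamanujanSun.tendsto_legendreRamanujanFormula (D := D) ht0 him hre one_ne_zero
  · rw [hR]
    have := RamanujanSun.tendsto_legendreRamanujanFormula (D := D) ht0 him hre
      (neg_ne_zero.2 one_ne_zero)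
    simpa [sub_eq_add_neg] using this
  · rw [RamanujanSun.legendreP_one_sub]
    exact RamanujanSun.regSol_ne_zero (RamanujanSun.one_sub_mem_slitPlane_of_re hre)
  · rw [hR]
    have h := RamanujanSun.hasSigma_clausenSum (D := D) (RamanujanSun.boundedVar_const 1) ht_le hu1
      (2 * (2 * t - 1)) (-RamanujanSun.ramanujanValue D t)
    rw [RamanujanSun.ramanujan_identity ht0 ht_le hre, hs] at h
    convert h using 1
    field_simp
  · rw [hR, hc]
    refine ⟨_, _, RamanujanSun.hasSigma_clausenSum hbl ht_le hu1 _ _,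
      RamanujanSun.hasSigma_clausenSum (RamanujanSun.boundedVar_const 1) ht_le hu1 _ _, ?_⟩
    rw [zero_mul, zero_add, RamanujanSun.sun_identity ht0 ht_le hre, hs]
    field_simp
  · rw [hR, hcd, hc]
    refine ⟨_, _, RamanujanSun.hasSigma_clausenSum RamanujanSun.boundedVar_logSqCoeff ht_le hu1 _ _,
      RamanujanSun.hasSigma_clausenSum hbl ht_le hu1 _ _, ?_⟩
    rw [zero_mul, zero_add, RamanujanSun.logSq_identity ht0 ht_le hre, hs]
    field_simp
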